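/- **Model.** In the binary-forking model a computation consists of asynchronous threads sharing a memory; each thread is a RAM with a constant number of registers and, besides the usual instructions, has an atomic test-and-set (if a word is $0$ it becomes $1$ and the instruction succeeds, otherwise the word is unchanged and the instruction fails), an instruction forking one child thread, an instruction ending the thread, and one finishing the computation. An execution is an arbitrary interleaving of the instructions of the threads. The executed instructions form a tree (the child of an instruction is the next instruction of its thread; a fork has also the first instruction of the forked thread as a child). The *work* is the number of nodes of this tree and the *span* is its depth. Parallel loops of size $n$ are implemented by forking along a binary tree with $n$ leaves, and joined through test-and-set. **Algorithm (list contraction).** The input is a doubly-linked list of $n$ elements in which every element $c$ has pointers $c.\mathrm{prev}$, $c.\mathrm{next}$ and a priority $\mathrm{pri}(c)$; the priorities form a permutation, and $\mathrm{pri}(\mathrm{null})=\infty$. Call an element a *leaf* if its priority is smaller than those of its two neighbours in the input list. 1. In parallel for every element $c$: set $c.\mathrm{flag}\leftarrow 1$ if $\mathrm{pri}(c)<\mathrm{pri}(c.\mathrm{prev})$ or $\mathrm{pri}(c)<\mathrm{pri}(c.\mathrm{next})$, and $c.\mathrm{flag}\leftarrow 0$ otherwise; record whether $c$ is a leaf.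 2. After the first loop has ended, in parallel for every element that is a leaf, start with $c$ equal to that element, and as long as $c.\mathrm{prev}$ and $c.\mathrm{next}$ are not both null: splice $c$ out of the list; let $c'$ be the one of $c.\mathrm{prev}$, $c.\mathrm{next}$ with the smaller priority; perform a test-and-set on $c'.\mathrm{flag}$; stop if it succeeds, otherwise set $c\leftarrow c'$ and repeat. The *dependence tree* of the input list is the binary tree whose root is the element with the largest priority and whose two subtrees are the dependence trees of the two sublists into which this element separates the list. (Its leaves are the leaves defined above.) **Theorem.** There is a constant $C>0$ such that the following holds for this algorithm. * (Work, worst case.) For every $n\ge 1$, every list of size $n$, every assignment of the priorities and every execution, the work is at most $Cn$; moreover all registers hold numbers at most $2n$, so words of $O(\log n)$ bits suffice. * (Span and tree height.) For every $n\ge 1$, every list of size $n$, every assignment of the priorities and every execution, the span is at most $C(\log n+h)$, where $h$ is the height (number of levels) of the dependence tree. * (Span, with high probability.) For every $n\ge 2$, every real $k\ge 1$ and every list of size $n$ whose priorities are a uniformly random permutation, with probability at least $1-n^{-k}$ every execution has span at most $C\,k\log n$. -/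

import Mathlib

/-! ## The binary-forking model

A computation consists of threads that share a memory.  Each thread is a RAM: it has a program
counter (a label of the program) and a constant number of word registers.  Besides the usual RAM
instructions there are an atomic test-and-set, an instruction that forks one child thread, an
instruction that ends the thread, and an instruction that finishes the whole computation.  The
threads are asynchronous: an execution is an arbitrary interleaving of their instructions. -/

namespace BinaryForking

/-- The register-to-register operations of the RAM. -/
inductive Op
  | add
  | sub
  /-- the truth value (0 or 1) of `x < y` -/
  | lt
  /-- bitwise and -/
  | and
  /-- bitwise or -/
  | or

def Op.eval : Op → ℕ → ℕ → ℕ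
  | .add, x, y => x + y
  | .sub, x, y => x - y
  | .lt, x, y => if x < y then 1 else 0
  | .and, x, y => x &&& y
  | .or, x, y => x ||| y

/-- Instructions, for programs with labels `L`, registers `R` and named memory arrays `F`.
The trailing arguments of type `L` are the labels at which the thread goes on. -/
inductive Instr (L R F : Type)
  /-- `r := k` -/
  | const (r : R) (k : ℕ) (next : L)
  /-- `r := s` -/
  | move (r s : R) (next : L)
  /-- `r := s o t` -/
  | op (o : Op) (r s t : R) (next : L)
  /-- `r := ⌊s / 2⌋` -/
  | half (r s : R) (next : L)
  /-- read: `r := f[s]` -/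
  | load (r : R) (f : F) (s : R) (next : L)
  /-- write: `f[s] := r` -/
  | store (f : F) (s r : R) (next : L)
  /-- `r := test-and-set(f[s])`: if `f[s]` is zero, set it to one and return zero; otherwise leave
  it unchanged and return one -/
  | tas (r : R) (f : F) (s : R) (next : L)
  /-- branch: go to `yes` if `r < s`, to `no` otherwise -/
  | ifLt (r s : R) (yes no : L)
  /-- branch: go to `yes` if `r = 0`, to `no` otherwise -/
  | ifZero (r : R) (yes no : L)
  /-- fork a child thread with a copy of the registers; `r` becomes zero in the forking thread and
  one in the child, and both go on at `next` -/
  | fork (r : R) (next : L)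
  /-- end this thread -/
  | quit
  /-- finish the whole computation -/
  | finish

/-- The shared memory: the word `M f a` is the entry with index `a` of the array `f`. -/
abbrev Mem (F : Type) := F → ℕ → ℕ

/-- A live thread: its next instruction is the one at `label`.  In the tree of executed
instructions (where the child of an instruction is the next instruction of the same thread and a
fork has in addition the first instruction of the forked thread as a child) `depth` is the number
of instructions on the path from the root to the last instruction before the next one. -/
structure Thread (L R : Type) where
  label : L
  regs : R → ℕ
  depth : ℕ

/-- The state of a computation.  `work` is the number of nodes and `span` the depth (the number
of nodes on a longest path) of the tree of the instructions executed so far. -/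
structure Config (L R F : Type) where
  mem : Mem F
  threads : Multiset (Thread L R)
  work : ℕ
  span : ℕ
  finished : Bool

variable {L R F : Type} [DecidableEq R] [DecidableEq F]

def Mem.write (M : Mem F) (f : F) (a x : ℕ) : Mem F :=
  Function.update M f (Function.update (M f) a x)

/-- The thread after an instruction that leads to `l` and does not change the registers. -/
def Thread.goto (t : Thread L R) (l : L) : Thread L R := ⟨l, t.regs, t.depth + 1⟩

/-- The thread after an instruction that leads to `l` and puts `x` into the register `r`. -/
def Thread.set (t : Thread L R) (r : R) (x : ℕ) (l : L) : Thread L R :=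
  ⟨l, Function.update t.regs r x, t.depth + 1⟩

/-- The effect of one instruction of thread `t` on memory `M`: the new memory, the threads that
replace `t`, and whether the computation is finished. -/
def Instr.exec (i : Instr L R F) (M : Mem F) (t : Thread L R) :
    Mem F × Multiset (Thread L R) × Bool :=
  match i with
  | .const r k l => (M, {t.set r k l}, false)
  | .move r s l => (M, {t.set r (t.regs s) l}, false)
  | .op o r s u l => (M, {t.set r (o.eval (t.regs s) (t.regs u)) l}, false)
  | .half r s l => (M, {t.set r (t.regs s / 2) l}, false)
  | .load r f s l => (M, {t.set r (M f (t.regs s)) l}, false)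
  | .store f s r l => (M.write f (t.regs s) (t.regs r), {t.goto l}, false)
  | .tas r f s l =>
      if M f (t.regs s) = 0 then (M.write f (t.regs s) 1, {t.set r 0 l}, false)
      else (M, {t.set r 1 l}, false)
  | .ifLt r s yes no => (M, {t.goto (if t.regs r < t.regs s then yes else no)}, false)
  | .ifZero r yes no => (M, {t.goto (if t.regs r = 0 then yes else no)}, false)
  | .fork r l => (M, {t.set r 0 l, t.set r 1 l}, false)
  | .quit => (M, 0, false)
  | .finish => (M, 0, true)

/-- One step of a computation of `program`: any one of the live threads executes its next
instruction.  No step is possible after the computation is finished. -/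
inductive Step (program : L → Instr L R F) : Config L R F → Config L R F → Prop
  | run (M : Mem F) (t : Thread L R) (T : Multiset (Thread L R)) (w s : ℕ) :
      Step program ⟨M, t ::ₘ T, w, s, false⟩
        ⟨((program t.label).exec M t).1, ((program t.label).exec M t).2.1 + T,
          w + 1, max s (t.depth + 1), ((program t.label).exec M t).2.2⟩

/-- `c'` can be reached from `c` by some interleaving of the threads. -/
def Reaches (program : L → Instr L R F) : Config L R F → Config L R F → Prop :=
  Relation.ReflTransGen (Step program)

/-- A single thread, about to execute its first instruction. -/
def Config.initial (l : L) (regs : R → ℕ) (M : Mem F) : Config L R F :=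
  ⟨M, {⟨l, regs, 0⟩}, 0, 0, false⟩

end BinaryForking

/-! ## The list-contraction algorithm

The elements of the list are numbered `1, …, n`, and `0` is the null pointer.  The program is

    parallel foreach element c:                                            (loop `one`)
      flag[c] := pri(c) < pri(prev[c]) or  pri(c) < pri(next[c])
      leaf[c] := pri(c) < pri(prev[c]) and pri(c) < pri(next[c])
    parallel foreach element c:                                            (loop `two`)
      if leaf[c]:
        while not (prev[c] = null and next[c] = null):
          splice c out
          c' := the one of prev[c], next[c] with the smaller priority
          if test-and-set(flag[c']) succeeds (finds zero): break
          c := c'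
    finish

with `pri(null) = ∞`.  Only the leaves of the dependence tree of the input list start splicing.
Being a leaf is a property of the input list, so it is recorded in the first loop, before any
element is spliced out: in the second loop other threads may already have changed `prev[c]` and
`next[c]`.  Priorities are `0, …, n - 1`, and `n` serves as `∞`.

A parallel loop forks along a binary tree with internal nodes `1 ≤ v < n` and leaves
`n ≤ v < 2 n`, where `v < n` has the children `2 v` and `2 v + 1`, and leaf `v` runs the body of
the loop for element `v - n + 1`.  A thread that is done with a node `v > 1` does a test-and-set
on the synchronization word of its parent, which was zeroed before the fork; the first of the two
threads to arrive ends and the second one takes over the parent.  The thread that takes over the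
root goes on after the loop. -/

namespace ListContraction

open BinaryForking

inductive Loop
  | one
  | two
  deriving DecidableEq

/-- The arrays in memory. -/
inductive Arr
  | prio
  | next
  | prev
  | flag
  | leaf
  /-- the synchronization words of the two parallel loops -/
  | sync (i : Loop)
  deriving DecidableEq

inductive Reg
  /-- the size of the list -/
  | n
  /-- the current node in the fork tree of the parallel loop -/
  | v
  /-- the current element `c` -/
  | c
  /-- the element `c'` -/
  | c'
  /-- `prev[c]` -/
  | a
  /-- `next[c]` -/
  | b
  /-- `pri(prev[c])` -/
  | x
  /-- `pri(next[c])` -/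
  | y
  /-- `pri(c)` -/
  | z
  /-- temporary words -/
  | t
  | u
  deriving DecidableEq

/-- The instruction labels; `i` tells in which of the two loops a block of code is used. -/
inductive Label
  | start
  /-- forking the threads of a parallel loop -/
  | spawn0 (i : Loop) | spawn1 (i : Loop) | spawn2 (i : Loop) | spawn3 (i : Loop)
  | spawn4 (i : Loop) | spawn5 (i : Loop)
  /-- computing the element that belongs to a leaf of the fork tree -/
  | elem0 (i : Loop) | elem1 (i : Loop) | elem2 (i : Loop)
  /-- joining the threads of a parallel loop -/
  | join0 (i : Loop) | join1 (i : Loop) | join2 (i : Loop) | join3 (i : Loop) | join4 (i : Loop)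
  /-- computing the priorities of the two neighbours -/
  | pri0 (i : Loop) | pri1 (i : Loop) | pri2 (i : Loop) | pri3 (i : Loop) | pri4 (i : Loop)
  | pri5 (i : Loop)
  /-- the body of the first loop -/
  | init0 | init1 | init2 | init3 | init4 | init5 | init6 | init7 | init8
  /-- the leaf test -/
  | leaf0 | leaf1
  /-- the condition of the while loop -/
  | while0 | while1 | while2 | while3
  /-- splicing out the current element -/
  | splice0 | splice1 | splice2 | splice3
  /-- choosing `c'` -/
  | pick0 | pick1 | pick2
  /-- the test-and-set on the flag of `c'`, and `c := c'` -/
  | test0 | test1 | test2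
  | dead
  | halt
  deriving DecidableEq

/-- The program. -/
def program : Label → Instr Label Reg Arr
  | .start => .const .v 1 (.spawn0 .one)
  -- while `v < n`: zero the synchronization word of `v`, then fork; the two threads go on with
  -- the nodes `2 v` and `2 v + 1`
  | .spawn0 i => .ifLt .v .n (.spawn1 i) (.elem0 i)
  | .spawn1 i => .const .t 0 (.spawn2 i)
  | .spawn2 i => .store (.sync i) .v .t (.spawn3 i)
  | .spawn3 i => .op .add .v .v .v (.spawn4 i)
  | .spawn4 i => .fork .t (.spawn5 i)
  | .spawn5 i => .op .add .v .v .t (.spawn0 i)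
  -- `c := v - n + 1`, then the body of the loop
  | .elem0 i => .op .sub .c .v .n (.elem1 i)
  | .elem1 i => .const .t 1 (.elem2 i)
  | .elem2 .one => .op .add .c .c .t .init0
  | .elem2 .two => .op .add .c .c .t .leaf0
  -- while `1 < v`: `v := ⌊v / 2⌋`, and end if first at the synchronization word of `v`
  | .join0 i => .const .t 1 (.join1 i)
  | .join1 .one => .ifLt .t .v (.join2 .one) (.spawn0 .two)
  | .join1 .two => .ifLt .t .v (.join2 .two) .halt
  | .join2 i => .half .v .v (.join3 i)
  | .join3 i => .tas .t (.sync i) .v (.join4 i)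
  | .join4 i => .ifZero .t .dead (.join0 i)
  -- `x := pri(a)`, `y := pri(b)`
  | .pri0 i => .ifZero .a (.pri1 i) (.pri2 i)
  | .pri1 i => .move .x .n (.pri3 i)
  | .pri2 i => .load .x .prio .a (.pri3 i)
  | .pri3 i => .ifZero .b (.pri4 i) (.pri5 i)
  | .pri4 .one => .move .y .n .init3
  | .pri4 .two => .move .y .n .pick0
  | .pri5 .one => .load .y .prio .b .init3
  | .pri5 .two => .load .y .prio .b .pick0
  -- `flag[c] := z < x or z < y`, `leaf[c] := z < x and z < y`
  | .init0 => .load .a .prev .c .init1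
  | .init1 => .load .b .next .c .init2
  | .init2 => .load .z .prio .c (.pri0 .one)
  | .init3 => .op .lt .x .z .x .init4
  | .init4 => .op .lt .y .z .y .init5
  | .init5 => .op .or .t .x .y .init6
  | .init6 => .op .and .u .x .y .init7
  | .init7 => .store .flag .c .t .init8
  | .init8 => .store .leaf .c .u (.join0 .one)
  -- the iteration for `c` is over at once if `c` is not a leaf
  | .leaf0 => .load .t .leaf .c .leaf1
  | .leaf1 => .ifZero .t (.join0 .two) .while0
  -- leave the while loop if `prev[c]` and `next[c]` are null
  | .while0 => .load .a .prev .c .while1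
  | .while1 => .load .b .next .c .while2
  | .while2 => .ifZero .a .while3 .splice0
  | .while3 => .ifZero .b (.join0 .two) .splice0
  -- if `a` is not null then `next[a] := b`; if `b` is not null then `prev[b] := a`
  | .splice0 => .ifZero .a .splice2 .splice1
  | .splice1 => .store .next .a .b .splice2
  | .splice2 => .ifZero .b (.pri0 .two) .splice3
  | .splice3 => .store .prev .b .a (.pri0 .two)
  -- `c'` is the one of `a` and `b` with the smaller priority
  | .pick0 => .ifLt .x .y .pick1 .pick2
  | .pick1 => .move .c' .a .test0
  | .pick2 => .move .c' .b .test0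
  -- leave the while loop if the test-and-set on `flag[c']` succeeds
  | .test0 => .tas .t .flag .c' .test1
  | .test1 => .ifZero .t (.join0 .two) .test2
  | .test2 => .move .c .c' .while0
  | .dead => .quit
  | .halt => .finish

/-- The memory `M` holds a doubly-linked list with the elements `0, …, n - 1`, element `e` being
represented by the pointer `e + 1`: the `k`-th element in the order of the list is `σ k`, and the
priority of element `e` is `π e`.  The rest of the memory is arbitrary. -/
structure IsInput {n : ℕ} (σ π : Equiv.Perm (Fin n)) (M : Mem Arr) : Prop where
  prio : ∀ e : Fin n, M .prio ((e : ℕ) + 1) = π e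
  next : ∀ k : Fin n, M .next ((σ k : ℕ) + 1) =
    if h : (k : ℕ) + 1 < n then (σ ⟨k + 1, h⟩ : ℕ) + 1 else 0
  prev : ∀ k : Fin n, M .prev ((σ k : ℕ) + 1) =
    if 0 < (k : ℕ) then (σ ⟨k - 1, lt_of_le_of_lt (Nat.sub_le _ _) k.2⟩ : ℕ) + 1 else 0

/-- `c` is the state of some execution of the algorithm (complete or not) on the list of size `n`
in memory `M`. -/
def IsExecution (n : ℕ) (M : Mem Arr) (c : Config Label Reg Arr) : Prop :=
  Reaches program (Config.initial .start (fun r => if r = Reg.n then n else 0) M) c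

/-- The largest of the numbers in `x :: xs`. -/
def largest (x : ℕ) (xs : List ℕ) : ℕ := xs.foldr max x

theorem largest_mem (x : ℕ) (xs : List ℕ) : largest x xs ∈ x :: xs := by
  unfold largest
  induction xs with
  | nil => simp
  | cons y ys ih =>
    simp only [List.foldr_cons, List.mem_cons] at ih ⊢
    rcases max_choice y (ys.foldr max x) with h | h <;> rw [h]
    · simp
    · tauto

/-- The dependence tree of a list with the given (distinct) priorities, in list order: the root is
the element with the largest priority, and its two subtrees are the dependence trees of the two
sublists into which it separates the list. -/
def dependenceTree : List ℕ → BinaryTree ℕ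
  | [] => .nil
  | x :: xs =>
    .node (largest x xs)
      (dependenceTree ((x :: xs).take ((x :: xs).idxOf (largest x xs))))
      (dependenceTree ((x :: xs).drop ((x :: xs).idxOf (largest x xs) + 1)))
termination_by l => l.length
decreasing_by
  · have := List.idxOf_lt_length_of_mem (largest_mem x xs)
    rw [List.length_take]
    omega
  · rw [List.length_drop, List.length_cons]
    omega

/-- The height of the dependence tree of the list in which the `k`-th element is `σ k` and
element `e` has priority `π e`. -/
def dependenceHeight {n : ℕ} (σ π : Equiv.Perm (Fin n)) : ℕ :=
  (dependenceTree (List.ofFn fun k : Fin n => (π (σ k) : ℕ))).height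

end ListContraction

/-! The second loop climbs the dependence tree. An element is started only when both of its subtrees
are finished. All positions between it and the nearest larger priorities on either side are then
spliced out, while those two positions, being ancestors of it or null, have not been started. So its
current neighbours are exactly these two positions, the one with the smaller priority is its parent,
and elements that are being spliced out at the same time are never adjacent. This is why concurrent
splices do not disturb each other (`DataInv.load_prev`, `DataInv.set_next`, `DataInv.set_prev`).

The flag of an element that has not been started is one exactly if one of its subtrees is finished,
an empty subtree counting as finished. A child whose test-and-set succeeds leaves the parent to the
other side. A child whose test-and-set fails knows that the other side is finished and takes over
the parent (`DataInv.finish_activate`). Hence every element is processed at most once.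

Both deterministic bounds come from one invariant, `Inv`, preserved by every instruction
(`At.stepGood`). Every live thread is attached to a node of one of the two fork trees, nodes pass
through phases and elements through stages, and between two such changes a thread executes fewer
than 40 instructions, which `rank` measures. Work is bounded by a potential that adds 40 for every
outstanding change of phase or stage. Span is bounded because a thread descends and ascends fork
trees of logarithmic height and because every iteration of the while loop moves to a parent, whose
level `f` is smaller.

For random priorities, let the weight of a tree be the sum of `2 ^ depth` over its external nodes.
Inserting a new minimum at a uniformly random place multiplies the mean weight by `(n + 4) / (n +
1)`, so the mean is the binomial coefficient of `n + 3` over 3 (`sum_weight_perm`). Since the weight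
is at least `2 ^ height`, Markov's inequality gives the tail of the height (`card_height_mul_le`).
-/

namespace ListContraction

/-! ### Dependence trees and their decomposition at the maximum. -/

theorem dependenceTree_nil : dependenceTree [] = .nil := by
  rw [dependenceTree]

theorem le_largest (x : ℕ) (xs : List ℕ) : ∀ y ∈ x :: xs, y ≤ largest x xs := by
  unfold largest
  induction xs with
  | nil => simp
  | cons z zs ih =>
    intro y hy
    simp only [List.mem_cons, List.foldr_cons, le_max_iff] at hy ih ⊢
    grind

/-- Replaces the recursion through `idxOf` by one at an explicit maximum. Strictness on both sides
ensures that the first occurrence of `m` is the displayed one. -/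
theorem dependenceTree_append {A B : List ℕ} {m : ℕ} (hA : ∀ x ∈ A, x < m) (hB : ∀ x ∈ B, x < m) :
    dependenceTree (A ++ m :: B) = .node m (dependenceTree A) (dependenceTree B) := by
  obtain ⟨x, xs, hx⟩ : ∃ x xs, A ++ m :: B = x :: xs := by
    cases A <;> simp
  have hm : largest x xs = m := by
    have h1 := largest_mem x xs
    have h2 := le_largest x xs m (by rw [← hx]; simp)
    rw [← hx] at h1
    simp only [List.mem_append, List.mem_cons] at h1
    rcases h1 with h1 | h1 | h1
    · have := hA _ h1; omega
    · exact h1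
    · have := hB _ h1; omega
  have hi : (x :: xs).idxOf m = A.length := by
    rw [← hx, List.idxOf_append_of_notMem (fun h => lt_irrefl _ (hA _ h))]
    simp
  rw [hx, dependenceTree, hm, hi, ← hx]
  simp [List.drop_append, List.drop_of_length_le]

theorem exists_eq_append_max {l : List ℕ} (hl : l ≠ []) (hd : l.Nodup) :
    ∃ A m B, l = A ++ m :: B ∧ (∀ x ∈ A, x < m) ∧ ∀ x ∈ B, x < m := by
  obtain ⟨x, xs, rfl⟩ := List.exists_cons_of_ne_nil hl
  obtain ⟨A, B, h⟩ := List.append_of_mem (largest_mem x xs)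
  have hle := le_largest x xs
  refine ⟨A, _, B, h, ?_⟩
  rw [h] at hle hd
  generalize largest x xs = m at *
  constructor
  · intro y hy
    refine lt_of_le_of_ne (hle y (by simp [hy])) ?_
    rintro rfl
    rw [List.nodup_append] at hd
    exact hd.2.2 _ hy _ (by simp) rfl
  · intro y hy
    refine lt_of_le_of_ne (hle y (by simp [hy])) ?_
    rintro rfl
    rw [List.nodup_append, List.nodup_cons] at hd
    exact hd.2.1.1 hy

/-- Induction on a list with distinct entries along its dependence tree. -/
theorem nodup_induction {motive : (l : List ℕ) → l.Nodup → Prop} (nil : motive [] List.nodup_nil)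
    (node : ∀ A m B, (∀ x ∈ A, x < m) → (∀ x ∈ B, x < m) → ∀ (hA : A.Nodup) (hB : B.Nodup)
      (hl : (A ++ m :: B).Nodup), motive A hA → motive B hB → motive (A ++ m :: B) hl)
    (l : List ℕ) (hl : l.Nodup) : motive l hl := by
  induction hk : l.length using Nat.strong_induction_on generalizing l with
  | _ k ih =>
    rcases eq_or_ne l [] with rfl | hne
    · exact nil
    · obtain ⟨A, m, B, rfl, hA, hB⟩ := exists_eq_append_max hne hl
      have h := List.nodup_append.1 hl
      have h2 := (List.nodup_cons.1 h.2.1).2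
      simp only [List.length_append, List.length_cons] at hk
      exact node A m B hA hB h.1 h2 hl (ih A.length (by omega) A h.1 rfl)
        (ih B.length (by omega) B h2 rfl)

/-! ### The mean weight of the dependence tree of a random permutation. -/

/-- The sum of `2 ^ d` over the external nodes of a binary tree, `d` being their depth. -/
def weight : BinaryTree ℕ → ℕ
  | .nil => 1
  | .node _ l r => 2 * (weight l + weight r)

/-- A deepest external node has depth equal to the height and alone contributes this much. -/
theorem two_pow_height_le_weight (t : BinaryTree ℕ) : 2 ^ t.height ≤ weight t := by
  induction t with
  | nil => simp [weight, BinaryTree.height]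
  | node a l r hl hr =>
    simp only [weight, BinaryTree.height, pow_succ]
    rcases max_choice l.height r.height with h | h <;> rw [h] <;> omega

/-- Inserting a new smallest entry at all possible places replaces every external node of the
dependence tree once. -/
theorem sum_weight_insert (a : ℕ) (l : List ℕ) (hl : l.Nodup) (ha : ∀ x ∈ l, a < x) :
    ∑ p ∈ Finset.range (l.length + 1), weight (dependenceTree (l.take p ++ a :: l.drop p)) =
      (l.length + 4) * weight (dependenceTree l) := by
  induction l, hl using nodup_induction with
  | nil =>
    have := dependenceTree_append (A := []) (B := []) (m := a) (by simp) (by simp)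
    simp only [List.nil_append] at this
    simp [this, dependenceTree_nil, weight]
  | node A m B hA hB hAn hBn _ ihA ihB =>
    specialize ihA (fun x hx => ha x (by simp [hx]))
    specialize ihB (fun x hx => ha x (by simp [hx]))
    have ham : a < m := ha m (by simp)
    -- The gaps of the whole list are the gaps of `A` followed by those of `B`; an insertion changes
    -- only the subtree on its own side of `m`.
    have e : (A ++ m :: B).length + 1 = (A.length + 1) + (B.length + 1) := by
      simp; omega
    have h1 : ∀ p ∈ Finset.range (A.length + 1),
        weight (dependenceTree ((A ++ m :: B).take p ++ a :: (A ++ m :: B).drop p)) =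
          2 * (weight (dependenceTree (A.take p ++ a :: A.drop p))
            + weight (dependenceTree B)) := by
      intro p hp
      have hp' : p ≤ A.length := by simpa [Nat.lt_succ_iff] using hp
      rw [List.take_append_of_le_length hp', List.drop_append_of_le_length hp']
      have : A.take p ++ a :: (A.drop p ++ m :: B) = (A.take p ++ a :: A.drop p) ++ m :: B := by
        simp
      rw [this, dependenceTree_append _ hB, weight]
      intro x hx
      simp only [List.mem_append, List.mem_cons] at hx
      rcases hx with hx | rfl | hx
      · exact hA _ (List.mem_of_mem_take hx)
      · exact ham
      · exact hA _ (List.mem_of_mem_drop hx)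
    have h2 : ∀ q ∈ Finset.range (B.length + 1),
        weight (dependenceTree ((A ++ m :: B).take (A.length + 1 + q)
            ++ a :: (A ++ m :: B).drop (A.length + 1 + q))) =
          2 * (weight (dependenceTree A)
            + weight (dependenceTree (B.take q ++ a :: B.drop q))) := by
      intro q _
      have : (A ++ m :: B).take (A.length + 1 + q) ++ a :: (A ++ m :: B).drop (A.length + 1 + q)
          = A ++ m :: (B.take q ++ a :: B.drop q) := by
        rw [List.take_append, List.drop_append, List.take_of_length_le (by omega),
          List.drop_of_length_le (by omega), show A.length + 1 + q - A.length = q + 1 by omega]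
        simp
      rw [this, dependenceTree_append hA, weight]
      intro x hx
      simp only [List.mem_append, List.mem_cons] at hx
      rcases hx with hx | rfl | hx
      · exact hB _ (List.mem_of_mem_take hx)
      · exact ham
      · exact hB _ (List.mem_of_mem_drop hx)
    -- The weight of `A` occurs `|A| + 4` times from insertions into `A` and `|B| + 1` times from
    -- insertions into `B`, and symmetrically for `B`. Both coefficients equal the length of the
    -- whole list plus 4.
    rw [e, Finset.sum_range_add, Finset.sum_congr rfl h1, Finset.sum_congr rfl h2,
      ← Finset.mul_sum, ← Finset.mul_sum, Finset.sum_add_distrib, Finset.sum_add_distrib, ihA, ihB,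
      dependenceTree_append hA hB, weight]
    simp only [Finset.sum_const, Finset.card_range, smul_eq_mul, List.length_append,
      List.length_cons]
    ring

/-- The permutation of `Fin (n + 1)` with the value `0` at `p` and, apart from that, the values of
`τ`, each increased by one. -/
noncomputable def insertPerm {n : ℕ} (x : Fin (n + 1) × Equiv.Perm (Fin n)) :
    Equiv.Perm (Fin (n + 1)) :=
  Equiv.ofBijective (Fin.insertNth (α := fun _ => Fin (n + 1)) x.1 0 (fun k => (x.2 k).succ))
    (Finite.injective_iff_bijective.1 (by
      intro i j h
      induction i using Fin.succAboveCases x.1 <;> induction j using Fin.succAboveCases x.1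
      · rfl
      · simp at h
        exact absurd h.symm (Fin.succ_ne_zero _)
      · simp at h
      · simpa using h))

theorem insertPerm_self {n : ℕ} (p : Fin (n + 1)) (τ : Equiv.Perm (Fin n)) :
    insertPerm (p, τ) p = 0 := by simp [insertPerm]

theorem insertPerm_succAbove {n : ℕ} (p : Fin (n + 1)) (τ : Equiv.Perm (Fin n)) (k : Fin n) :
    insertPerm (p, τ) (p.succAbove k) = (τ k).succ := by simp [insertPerm]

/-- The place of the value `0` recovers the first component and the remaining values the second; the
cardinalities agree because `(n + 1)! = (n + 1) * n!`. -/
theorem insertPerm_bijective (n : ℕ) : Function.Bijective (insertPerm (n := n)) := by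
  rw [Fintype.bijective_iff_injective_and_card]
  constructor
  · rintro ⟨p, τ⟩ ⟨q, τ'⟩ h
    have hpq : p = q := by
      apply (insertPerm (p, τ)).injective
      rw [insertPerm_self, h, insertPerm_self]
    subst hpq
    have : τ = τ' := by
      ext k
      have := insertPerm_succAbove p τ k
      rw [h, insertPerm_succAbove] at this
      rw [Fin.succ_injective _ this]
    rw [this]
  · simp [Fintype.card_perm, Nat.factorial_succ]

/-- Brings `insertPerm` into the form of `sum_weight_insert`. The offset turns the new value `0`
into `c` and passes to `c + 1` on the old values, which `insertPerm` has raised by one. -/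
theorem ofFn_insertPerm {n : ℕ} (c : ℕ) (p : Fin (n + 1)) (τ : Equiv.Perm (Fin n)) :
    List.ofFn (fun k => (insertPerm (p, τ) k : ℕ) + c) =
      (List.ofFn fun k => (τ k : ℕ) + (c + 1)).take p ++
        c :: (List.ofFn fun k => (τ k : ℕ) + (c + 1)).drop p := by
  apply List.ext_getElem
  · simp
    omega
  · intro i h1 h2
    have hi : i < n + 1 := by simpa using h1
    obtain hip | rfl | hip := lt_trichotomy i (p : ℕ)
    · have e : (⟨i, hi⟩ : Fin (n + 1)) = p.succAbove ⟨i, by omega⟩ := by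
        rw [Fin.succAbove_of_castSucc_lt]
        · rfl
        · exact hip
      rw [List.getElem_append_left (by simp; omega)]
      simp only [List.getElem_ofFn, List.getElem_take]
      rw [e, insertPerm_succAbove]
      simp
      omega
    · rw [List.getElem_append_right (by simp)]
      have e : (⟨(p : ℕ), hi⟩ : Fin (n + 1)) = p := rfl
      rw [List.getElem_ofFn, e, insertPerm_self]
      simp [Nat.min_eq_left (Nat.lt_succ_iff.1 p.2)]
    · have e : (⟨i, hi⟩ : Fin (n + 1)) = p.succAbove ⟨i - 1, by omega⟩ := by
        rw [Fin.succAbove_of_le_castSucc]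
        · ext; simp; omega
        · rw [Fin.le_def]; simp; omega
      rw [List.getElem_append_right (by simp; omega)]
      simp only [List.getElem_ofFn, List.length_take, List.length_ofFn,
        Nat.min_eq_left (Nat.lt_succ_iff.1 p.2)]
      obtain ⟨d, rfl⟩ : ∃ d, i = p + 1 + d := ⟨i - p - 1, by omega⟩
      simp only [show (p : ℕ) + 1 + d - p = d + 1 by omega, List.getElem_cons_succ,
        List.getElem_drop, List.getElem_ofFn, e, insertPerm_succAbove, Fin.val_succ]
      have : (⟨(p : ℕ) + 1 + d - 1, by omega⟩ : Fin n) = ⟨p + d, by omega⟩ := by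
        ext; simp
      rw [this]
      omega

theorem nodup_ofFn_perm {n : ℕ} (c : ℕ) (τ : Equiv.Perm (Fin n)) :
    (List.ofFn fun k => (τ k : ℕ) + c).Nodup := by
  rw [List.nodup_ofFn]
  intro i j h
  simpa [Fin.val_inj] using h

/-- The sum for `n + 1` is `n + 4` times the sum for `n`, starting from `1`; the factor 6 is `3!`.
The offset `c` is arbitrary because inserting a minimum shifts the other values. -/
theorem sum_weight_perm (n c : ℕ) :
    6 * ∑ τ : Equiv.Perm (Fin n), weight (dependenceTree (List.ofFn fun k => (τ k : ℕ) + c)) =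
      (n + 3).factorial := by
  induction n generalizing c with
  | zero => simp [dependenceTree_nil, weight, Nat.factorial]
  | succ n ih =>
    rw [← (insertPerm_bijective n).sum_comp
      (fun τ => weight (dependenceTree (List.ofFn fun k => (τ k : ℕ) + c))),
      Fintype.sum_prod_type_right]
    have h : ∀ τ : Equiv.Perm (Fin n), ∑ p : Fin (n + 1),
        weight (dependenceTree (List.ofFn fun k => (insertPerm (p, τ) k : ℕ) + c)) =
        (n + 4) * weight (dependenceTree (List.ofFn fun k => (τ k : ℕ) + (c + 1))) := by
      intro τ
      have := sum_weight_insert c _ (nodup_ofFn_perm (c + 1) τ) (by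
        intro x hx
        rw [List.mem_ofFn] at hx
        obtain ⟨k, rfl⟩ := hx
        omega)
      rw [List.length_ofFn] at this
      rw [← this, Finset.sum_range]
      exact Finset.sum_congr rfl fun p _ => by rw [ofFn_insertPerm]
    rw [Finset.sum_congr rfl fun τ _ => h τ, ← Finset.mul_sum, mul_left_comm, ih]
    rw [show n + 1 + 3 = (n + 3) + 1 by ring, Nat.factorial_succ (n + 3)]

/-- The number of levels of the dependence tree exceeds a bound only for few priorities. -/
theorem card_height_mul_le {n : ℕ} (σ : Equiv.Perm (Fin n)) (m : ℕ) :
    6 * ((Finset.univ.filter fun π : Equiv.Perm (Fin n) => m ≤ dependenceHeight σ π).card * 2 ^ m) ≤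
      (n + 3).factorial := by
  rw [← sum_weight_perm n 0]
  refine Nat.mul_le_mul_left _ ?_
  -- Only `π * σ` enters the tree, and it runs through all permutations as `π` does, so the order of
  -- the list is irrelevant. The rest is Markov's inequality.
  rw [← Equiv.sum_comp (Equiv.mulRight σ) fun τ : Equiv.Perm (Fin n) =>
    weight (dependenceTree (List.ofFn fun k => (τ k : ℕ) + 0))]
  rw [← smul_eq_mul, ← Finset.sum_const]
  refine (Finset.sum_le_sum ?_).trans (Finset.sum_le_sum_of_subset (Finset.filter_subset _ _))
  intro π hπ
  rw [Finset.mem_filter] at hπ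
  exact (Nat.pow_le_pow_right two_pos hπ.2).trans (two_pow_height_le_weight _)

/-! ### Levels in the dependence tree. -/

/-- A depth function of the dependence tree: it is less than the height, and it increases from
every entry of the list to its descendants. -/
theorem exists_depth (l : List ℕ) (hl : l.Nodup) :
    ∃ f : ℕ → ℕ, (∀ k, k < l.length → f k < (dependenceTree l).height) ∧
      ∀ p k (hp : p < l.length), k < l.length → p ≠ k →
        (∀ i (hi : i < l.length), min p k ≤ i → i ≤ max p k → l[i] ≤ l[p]) → f p < f k := by
  induction l, hl using nodup_induction with
  | nil => exact ⟨id, by simp, by simp⟩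
  | node A m B hA hB hAn hBn _ ihA ihB =>
    obtain ⟨f, hf1, hf2⟩ := ihA
    obtain ⟨g, hg1, hg2⟩ := ihB
    refine ⟨fun k => if k < A.length then f k + 1 else if k = A.length then 0
      else g (k - A.length - 1) + 1, ?_, ?_⟩
    · intro k hk
      simp only [List.length_append, List.length_cons] at hk
      rw [dependenceTree_append hA hB, BinaryTree.height]
      dsimp only
      split_ifs with h1 h2
      · have := hf1 k h1
        omega
      · omega
      · have := hg1 (k - A.length - 1) (by omega)
        omega
    · intro p k hp hk hpk hi
      simp only [List.length_append, List.length_cons] at hp hk hi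
      have hm : ∀ q (hq : q < A.length + (B.length + 1)), q ≠ A.length →
          (A ++ m :: B)[q]'(by simpa using hq) < m := by
        intro q hq hne
        rcases lt_or_gt_of_ne hne with h | h
        · rw [List.getElem_append_left h]
          exact hA _ (List.getElem_mem _)
        · rw [List.getElem_append_right h.le]
          obtain ⟨d, rfl⟩ : ∃ d, q = A.length + 1 + d := ⟨q - A.length - 1, by omega⟩
          simp only [show A.length + 1 + d - A.length = d + 1 by omega, List.getElem_cons_succ]
          exact hB _ (List.getElem_mem _)
      -- An entry other than the global maximum dominates no interval that contains the maximum, so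
      -- `p` and `k` lie on the same side and the induction hypothesis of that side applies.
      have hmid : p ≠ A.length → ¬ (min p k ≤ A.length ∧ A.length ≤ max p k) := by
        intro hpne hmk
        have h1 := hi A.length (by omega) hmk.1 hmk.2
        have h2 := hm p hp hpne
        simp at h1
        omega
      rcases lt_trichotomy p A.length with h | h | h
      · have hkA : k < A.length := by
          have := hmid h.ne
          omega
        simp only [h, hkA, if_true]
        refine Nat.succ_lt_succ (hf2 p k h hkA hpk fun i hiA h1 h2 => ?_)
        have := hi i (by omega) h1 h2
        rwa [List.getElem_append_left hiA, List.getElem_append_left h] at this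
      · subst h
        dsimp only
        rw [if_neg (lt_irrefl _), if_pos rfl]
        split_ifs <;> omega
      · have hkA : A.length < k := by
          have := hmid h.ne'
          omega
        dsimp only
        rw [if_neg (by omega), if_neg (by omega), if_neg (by omega), if_neg (by omega)]
        refine Nat.succ_lt_succ (hg2 _ _ (by omega) (by omega) (by omega) fun i hiB h1 h2 => ?_)
        have := hi (A.length + 1 + i) (by omega) (by omega) (by omega)
        rw [List.getElem_append_right (by omega), List.getElem_append_right (by omega)] at this
        simp only [show A.length + 1 + i - A.length = i + 1 by omega, List.getElem_cons_succ] at this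
        obtain ⟨d, rfl⟩ : ∃ d, p = A.length + 1 + d := ⟨p - A.length - 1, by omega⟩
        simp only [show A.length + 1 + d - A.length = d + 1 by omega, List.getElem_cons_succ] at this
        simpa only [show A.length + 1 + d - A.length - 1 = d by omega] using this

end ListContraction

namespace ListContraction
open BinaryForking

/-! ### The layout of the input list -/

/-- Position `j` belongs to the left subtree of position `p` in the dependence tree of the
priorities `P`. -/
def LeftDesc (P : ℕ → ℕ) (p j : ℕ) : Prop := j < p ∧ ∀ i, j ≤ i → i < p → P i < P p

/-- Position `j` belongs to the right subtree of position `p`. -/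
def RightDesc (P : ℕ → ℕ) (p j : ℕ) : Prop := p < j ∧ ∀ i, p < i → i ≤ j → P i < P p

/-- An input list in terms of the positions `1, …, n` of its elements, with the sentinels `0` and
`n + 1`: the priority `P k` and the pointer `ptr k` of the element at position `k`, and a depth
function of the dependence tree with values less than `h`. -/
structure Layout where
  (n h : ℕ)
  (P ptr f : ℕ → ℕ)
  pos : 1 ≤ n
  ptr_zero : ptr 0 = 0
  ptr_last : ptr (n + 1) = 0
  ptr_pos : ∀ k, 1 ≤ k → k ≤ n → 1 ≤ ptr k
  ptr_le : ∀ k, k ≤ n + 1 → ptr k ≤ n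
  ptr_inj : ∀ j k, 1 ≤ j → j ≤ n → 1 ≤ k → k ≤ n → ptr j = ptr k → j = k
  ptr_surj : ∀ e, 1 ≤ e → e ≤ n → ∃ k, 1 ≤ k ∧ k ≤ n ∧ ptr k = e
  P_zero : P 0 = n
  P_last : P (n + 1) = n
  P_lt : ∀ k, 1 ≤ k → k ≤ n → P k < n
  P_inj : ∀ j k, 1 ≤ j → j ≤ n → 1 ≤ k → k ≤ n → P j = P k → j = k
  f_lt : ∀ k, 1 ≤ k → k ≤ n → f k < h
  f_desc : ∀ p k, 1 ≤ p → p ≤ n → LeftDesc P p k ∨ RightDesc P p k → f p < f k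

/-- `l` is the closest position to the left of `k` with a larger priority. -/
def LeftUp (P : ℕ → ℕ) (k l : ℕ) : Prop := l < k ∧ P k < P l ∧ ∀ i, l < i → i < k → P i < P k

/-- `r` is the closest position to the right of `k` with a larger priority. -/
def RightUp (P : ℕ → ℕ) (k r : ℕ) : Prop := k < r ∧ P k < P r ∧ ∀ i, k < i → i < r → P i < P k

/-- `m` is the one of `l` and `r` with the smaller priority, as a position of an element. -/
def Parent (D : Layout) (l r m : ℕ) : Prop :=
  1 ≤ m ∧ m ≤ D.n ∧ (m = l ∧ D.P l < D.P r ∨ m = r ∧ D.P r < D.P l)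

/-- In a `Layout` the sentinels have priority `n`, above all elements, so the two ends of the list
need no separate case. -/
def IsLeaf (P : ℕ → ℕ) (k : ℕ) : Prop := P k < P (k - 1) ∧ P k < P (k + 1)

namespace Layout
variable (D : Layout) {k l r m : ℕ}

theorem P_le (hk : k ≤ D.n + 1) : D.P k ≤ D.n := by
  rcases Nat.eq_zero_or_pos k with rfl | h
  · exact D.P_zero.le
  · rcases hk.eq_or_lt with rfl | h2
    · exact D.P_last.le
    · exact (D.P_lt k h (by omega)).le

theorem P_ne (j k : ℕ) (hj : j ≤ D.n + 1) (h1 : 1 ≤ k) (h2 : k ≤ D.n) (h : j ≠ k) :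
    D.P j ≠ D.P k := by
  have h4 := D.P_lt k h1 h2
  rcases Nat.eq_zero_or_pos j with rfl | h3
  · rw [D.P_zero]; omega
  · rcases hj.eq_or_lt with rfl | h5
    · rw [D.P_last]; omega
    · exact fun e => h (D.P_inj _ _ h3 (by omega) h1 h2 e)

/-- The sentinel at `0` is larger, so there is a smallest distance to a larger priority; the
positions in between are smaller strictly because priorities are distinct. -/
theorem exists_leftUp (h1 : 1 ≤ k) (h2 : k ≤ D.n) : ∃ l, LeftUp D.P k l := by
  have H : ∃ d, d ≤ k ∧ D.P k < D.P (k - d) := ⟨k, le_rfl, by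
    rw [Nat.sub_self, D.P_zero]; exact D.P_lt k h1 h2⟩
  classical
  have hs := Nat.find_spec H
  have hm := fun d => Nat.find_min H (m := d)
  generalize Nat.find H = d at hs hm
  have hd : d ≠ 0 := by rintro rfl; simp at hs
  refine ⟨k - d, by omega, hs.2, fun i hi1 hi2 => ?_⟩
  have := hm (k - i) (by omega)
  have hne := D.P_ne i k (by omega) h1 h2 (by omega)
  rw [show k - (k - i) = i by omega] at this
  omega

theorem exists_rightUp (h1 : 1 ≤ k) (h2 : k ≤ D.n) : ∃ r, r ≤ D.n + 1 ∧ RightUp D.P k r := by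
  have H : ∃ r, k < r ∧ r ≤ D.n + 1 ∧ D.P k < D.P r := ⟨D.n + 1, by omega, le_rfl, by
    rw [D.P_last]; exact D.P_lt k h1 h2⟩
  classical
  have hs := Nat.find_spec H
  have hm := fun d => Nat.find_min H (m := d)
  generalize Nat.find H = r at hs hm
  refine ⟨r, hs.2.1, hs.1, hs.2.2, fun i hi1 hi2 => ?_⟩
  have := hm i hi2
  have hne := D.P_ne i k (by omega) h1 h2 (by omega)
  omega

theorem not_isLeaf_left (hk : 1 ≤ k) (h : LeftDesc D.P m k) : ¬ IsLeaf D.P m := by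
  intro hl
  have := h.2 (m - 1) (by have := h.1; omega) (by have := h.1; omega)
  have := hl.1
  omega

theorem not_isLeaf_right (h : RightDesc D.P m k) : ¬ IsLeaf D.P m := by
  intro hl
  have := h.2 (m + 1) (by omega) h.1
  have := hl.2
  omega

theorem leftDesc_pos (h1 : 1 ≤ m) (h2 : m ≤ D.n) (h : LeftDesc D.P m k) : 1 ≤ k := by
  by_contra hk
  have := h.2 0 (by omega) (by omega)
  have := D.P_lt m h1 h2
  have := D.P_zero
  omega

theorem rightDesc_of_leftUp (h : LeftUp D.P k l) : RightDesc D.P l k := by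
  refine ⟨h.1, fun i h1 h2 => ?_⟩
  rcases h2.eq_or_lt with rfl | h3
  · exact h.2.1
  · exact (h.2.2 i h1 h3).trans h.2.1

theorem leftDesc_of_rightUp (h : RightUp D.P k r) : LeftDesc D.P r k := by
  refine ⟨h.1, fun i h1 h2 => ?_⟩
  rcases h1.eq_or_lt with rfl | h3
  · exact h.2.1
  · exact (h.2.2 i h3 h2).trans h.2.1

end Layout

/-! ### The invariant of the data -/

/-- How far the second loop has come with the element at a position: `0` if no thread has started
to process it, `1` if a thread processes it, `2` after the pointer to it in `next` was updated,
`3` after the pointer to it in `prev` was updated, `4` after the test-and-set on the flag of its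
parent. -/
abbrev Stages := ℕ → ℕ

/-- The left subtree of `p` has been processed. -/
def LeftDone (P : ℕ → ℕ) (st : Stages) (p : ℕ) : Prop := ∀ j, LeftDesc P p j → st j = 4

/-- The right subtree of `p` has been processed. -/
def RightDone (P : ℕ → ℕ) (st : Stages) (p : ℕ) : Prop := ∀ j, RightDesc P p j → st j = 4

/-- The phase of the nodes of the two fork trees: `0` before the fork, `1` for a thread that has
not yet forked or started the body of the loop, `2` after the synchronization word was zeroed (at
an inner node) or the body of the loop was started (at a leaf), `3` after the fork or after
the flag was written, `4` for a thread that joins, and `5` after the join. -/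
abbrev Phases := Loop → ℕ → ℕ

open Classical in
-- The node `v` with `v + 1 = D.ptr k + D.n` is the leaf of the fork tree that runs the loop body
-- for position `k`. The fields `next` and `prev` describe two lists, the positions of stage below 2
-- and those of stage below 3, because the two pointers around a spliced element are redirected one
-- after the other. The field `flag` is restricted to stage 0, the only stage in which a child tests
-- the flag. The field `closed` records that elements are started bottom-up.
structure DataInv (D : Layout) (ph : Phases) (st : Stages) (M : Mem Arr) : Prop where
  prio : ∀ k, 1 ≤ k → k ≤ D.n → M .prio (D.ptr k) = D.P k
  out : ∀ k, ¬ (1 ≤ k ∧ k ≤ D.n) → st k = 0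
  zero : ∀ k, st k ≠ 0 → ph .two 1 ≠ 0
  leafZero : ∀ k, 1 ≤ k → k ≤ D.n → IsLeaf D.P k → ∀ v, v + 1 = D.ptr k + D.n → ph .two v ≤ 1 →
    st k = 0
  flag : ∀ k, 1 ≤ k → k ≤ D.n → ∀ v, v + 1 = D.ptr k + D.n → 3 ≤ ph .one v → st k = 0 →
    M .flag (D.ptr k) = if LeftDone D.P st k ∨ RightDone D.P st k then 1 else 0
  leaf : ∀ k, 1 ≤ k → k ≤ D.n → ∀ v, v + 1 = D.ptr k + D.n → 4 ≤ ph .one v →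
    M .leaf (D.ptr k) = if IsLeaf D.P k then 1 else 0
  closed : ∀ k, 1 ≤ st k → LeftDone D.P st k ∧ RightDone D.P st k
  next : ∀ k, 1 ≤ k → k ≤ D.n → st k < 2 → ∃ j, k < j ∧ j ≤ D.n + 1 ∧ st j < 2 ∧
    (∀ i, k < i → i < j → 2 ≤ st i) ∧ M .next (D.ptr k) = D.ptr j
  prev : ∀ k, 1 ≤ k → k ≤ D.n → st k < 3 → ∃ j, j < k ∧ st j < 3 ∧
    (∀ i, j < i → i < k → 3 ≤ st i) ∧ M .prev (D.ptr k) = D.ptr j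

namespace DataInv
variable {D : Layout} {ph ph' : Phases} {st : Stages} {M M' : Mem Arr} {k l r m v : ℕ}

/-- Phases enter the data invariant only through thresholds at the leaves of the fork trees and
through the question whether the second loop has begun. Steps that cross no threshold in the harmful
direction are covered here. -/
theorem frame (H : DataInv D ph st M) (hM : ∀ f, (∀ i, f ≠ .sync i) → M' f = M f)
    (h3 : ∀ v, D.n ≤ v → 3 ≤ ph' .one v → 3 ≤ ph .one v)
    (h4 : ∀ v, D.n ≤ v → 4 ≤ ph' .one v → 4 ≤ ph .one v)
    (h1 : ∀ v, D.n ≤ v → ph' .two v ≤ 1 → ph .two v ≤ 1)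
    (h0 : ph .two 1 ≠ 0 → ph' .two 1 ≠ 0) : DataInv D ph' st M' := by
  have aux : ∀ k v, 1 ≤ k → k ≤ D.n → v + 1 = D.ptr k + D.n → D.n ≤ v := by
    intro k v hk hk' e
    have := D.ptr_pos k hk hk'
    omega
  constructor
  · rw [hM _ (by simp)]; exact H.prio
  · exact H.out
  · exact fun k hk => h0 (H.zero k hk)
  · exact fun k a b c v e hv => H.leafZero k a b c v e (h1 v (aux k v a b e) hv)
  · rw [hM _ (by simp)]; exact fun k a b v e hv => H.flag k a b v e (h3 v (aux k v a b e) hv)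
  · rw [hM _ (by simp)]; exact fun k a b v e hv => H.leaf k a b v e (h4 v (aux k v a b e) hv)
  · exact H.closed
  · rw [hM _ (by simp)]; exact H.next
  · rw [hM _ (by simp)]; exact H.prev

/-- Position `k` lies in the right subtree of `l`, and `closed` forbids starting `l` before that
subtree is finished. -/
theorem leftUp_stage (H : DataInv D ph st M) (hk4 : st k ≠ 4) (h : LeftUp D.P k l) : st l = 0 := by
  by_contra hl
  exact hk4 ((H.closed l (by omega)).2 k (D.rightDesc_of_leftUp h))

theorem rightUp_stage (H : DataInv D ph st M) (hk4 : st k ≠ 4) (h : RightUp D.P k r) :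
    st r = 0 := by
  by_contra hl
  exact hk4 ((H.closed r (by omega)).1 k (D.leftDesc_of_rightUp h))

theorem between_left (H : DataInv D ph st M) (hk : 1 ≤ st k) (h : LeftUp D.P k l) :
    ∀ i, l < i → i < k → st i = 4 := fun i h1 h2 =>
  (H.closed k hk).1 i ⟨h2, fun j h3 h4 => h.2.2 j (by omega) h4⟩

theorem between_right (H : DataInv D ph st M) (hk : 1 ≤ st k) (h : RightUp D.P k r) :
    ∀ i, k < i → i < r → st i = 4 := fun i h1 h2 =>
  (H.closed k hk).2 i ⟨h1, fun j h3 h4 => h.2.2 j h3 (by omega)⟩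

/-- All positions strictly between `l` and `k` are finished descendants of `k`, and `l` has stage 0.
So the left neighbour in the current list is `l`, whatever other threads are doing. -/
theorem load_prev (H : DataInv D ph st M) (h1 : 1 ≤ k) (h2 : k ≤ D.n) (hk : 1 ≤ st k)
    (hk3 : st k < 3) : ∃ l, LeftUp D.P k l ∧ M .prev (D.ptr k) = D.ptr l := by
  obtain ⟨l, hl⟩ := D.exists_leftUp h1 h2
  have h3 := H.leftUp_stage (by omega) hl
  have h4 := H.between_left hk hl
  obtain ⟨j, hj1, hj2, hj3, hj4⟩ := H.prev k h1 h2 hk3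
  have : j = l := by
    rcases lt_trichotomy j l with h | h | h
    · have := hj3 l h hl.1
      omega
    · exact h
    · have := h4 j h hj1
      omega
  exact ⟨l, hl, this ▸ hj4⟩

theorem load_next (H : DataInv D ph st M) (h1 : 1 ≤ k) (h2 : k ≤ D.n) (hk : 1 ≤ st k)
    (hk2 : st k < 2) : ∃ r, r ≤ D.n + 1 ∧ RightUp D.P k r ∧ M .next (D.ptr k) = D.ptr r := by
  obtain ⟨r, hr1, hr⟩ := D.exists_rightUp h1 h2
  have h3 := H.rightUp_stage (by omega) hr
  have h4 := H.between_right hk hr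
  obtain ⟨j, hj1, hj0, hj2, hj3, hj4⟩ := H.next k h1 h2 hk2
  have : j = r := by
    rcases lt_trichotomy j r with h | h | h
    · have := h4 j hj1 h
      omega
    · exact h
    · have := hj3 r hr.1 h
      omega
  exact ⟨r, hr1, hr, this ▸ hj4⟩

/-- Before the second loop begins all stages are 0, so the pointers are those of the input. -/
theorem load_prev_init (H : DataInv D ph st M) (h1 : 1 ≤ k) (h2 : k ≤ D.n)
    (h0 : ph .two 1 = 0) : M .prev (D.ptr k) = D.ptr (k - 1) := by
  have hz : ∀ k, st k = 0 := fun k => by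
    by_contra h
    exact H.zero k h h0
  obtain ⟨j, hj1, hj2, hj3, hj4⟩ := H.prev k h1 h2 (by rw [hz]; omega)
  have : j = k - 1 := by
    by_contra h
    have := hj3 (k - 1) (by omega) (by omega)
    rw [hz] at this
    omega
  rw [hj4, this]

theorem load_next_init (H : DataInv D ph st M) (h1 : 1 ≤ k) (h2 : k ≤ D.n)
    (h0 : ph .two 1 = 0) : M .next (D.ptr k) = D.ptr (k + 1) := by
  have hz : ∀ k, st k = 0 := fun k => by
    by_contra h
    exact H.zero k h h0
  obtain ⟨j, hj1, hj0, hj2, hj3, hj4⟩ := H.next k h1 h2 (by rw [hz]; omega)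
  have : j = k + 1 := by
    by_contra h
    have := hj3 (k + 1) (by omega) (by omega)
    rw [hz] at this
    omega
  rw [hj4, this]

end DataInv

end ListContraction

/-! ### Preservation of the data invariant when an element changes its stage. -/

namespace ListContraction
open BinaryForking

theorem LeftDone.mono {P : ℕ → ℕ} {st st' : Stages} {p : ℕ} (h : ∀ j, st j = 4 → st' j = 4)
    (H : LeftDone P st p) : LeftDone P st' p := fun j hj => h j (H j hj)

theorem RightDone.mono {P : ℕ → ℕ} {st st' : Stages} {p : ℕ} (h : ∀ j, st j = 4 → st' j = 4)
    (H : RightDone P st p) : RightDone P st' p := fun j hj => h j (H j hj)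

namespace Layout
variable (D : Layout) {k l r m p : ℕ}

/-- The nearest larger position to the right of `k` cannot lie beyond `p`, so the smaller of the two
candidates is either `p` or still below `p`. Hence finishing `k` can complete a side of its parent
only: any other subtree containing `k` also contains the unstarted parent. -/
theorem leftDesc_parent (hl : LeftUp D.P k l) (hr : RightUp D.P k r) (hm : Parent D l r m)
    (h : LeftDesc D.P p k) (hp : m ≠ p) : LeftDesc D.P p m := by
  have hk := h.2 k le_rfl h.1
  have hrp : r ≤ p := by
    by_contra hlt
    have := hr.2.2 p h.1 (by omega)
    omega
  have hrP : D.P r ≤ D.P p := by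
    rcases hrp.eq_or_lt with rfl | h'
    · exact le_rfl
    · exact (h.2 r hr.1.le h').le
  have := h.1
  have := hl.1
  have := hr.1
  obtain ⟨_, _, ⟨rfl, hlt⟩ | ⟨rfl, hlt⟩⟩ := hm
  · refine ⟨by omega, fun i h1 h2 => ?_⟩
    rcases h1.eq_or_lt with rfl | h1
    · omega
    · by_cases hik : i < k
      · have := hl.2.2 i h1 hik
        omega
      · exact h.2 i (by omega) h2
  · exact ⟨by omega, fun i h1 h2 => h.2 i (by omega) h2⟩

theorem rightDesc_parent (hl : LeftUp D.P k l) (hr : RightUp D.P k r) (hm : Parent D l r m)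
    (h : RightDesc D.P p k) (hp : m ≠ p) : RightDesc D.P p m := by
  have hk := h.2 k h.1 le_rfl
  have hlp : p ≤ l := by
    by_contra hlt
    have := hl.2.2 p (by omega) h.1
    omega
  have hlP : D.P l ≤ D.P p := by
    rcases hlp.eq_or_lt with rfl | h'
    · exact le_rfl
    · exact (h.2 l h' hl.1.le).le
  have := h.1
  have := hl.1
  have := hr.1
  obtain ⟨_, _, ⟨rfl, hlt⟩ | ⟨rfl, hlt⟩⟩ := hm
  · exact ⟨by omega, fun i h1 h2 => h.2 i h1 (by omega)⟩
  · refine ⟨by omega, fun i h1 h2 => ?_⟩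
    rcases h2.eq_or_lt with rfl | h2
    · omega
    · by_cases hik : k < i
      · have := hr.2.2 i hik h2
        omega
      · exact h.2 i h1 (by omega)

theorem desc_parent (hl : LeftUp D.P k l) (hr : RightUp D.P k r) (hm : Parent D l r m) :
    LeftDesc D.P m k ∨ RightDesc D.P m k := by
  obtain ⟨_, _, ⟨rfl, _⟩ | ⟨rfl, _⟩⟩ := hm
  · exact .inr (D.rightDesc_of_leftUp hl)
  · exact .inl (D.leftDesc_of_rightUp hr)

theorem f_parent (hl : LeftUp D.P k l) (hr : RightUp D.P k r) (hm : Parent D l r m) :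
    D.f m < D.f k := D.f_desc m k hm.1 hm.2.1 (D.desc_parent hl hr hm)

end Layout

namespace DataInv
variable {D : Layout} {ph : Phases} {st : Stages} {M M' : Mem Arr} {k l r m v : ℕ}

/-- Passing from stage 0 to stage 1 crosses none of the thresholds 2, 3 and 4, so the pointer fields
and the finished sides are untouched; what must be supplied is `closed` at `k`. -/
theorem activate (H : DataInv D ph st M) (h1 : 1 ≤ k) (h2 : k ≤ D.n) (hk : st k = 0)
    (hL : LeftDone D.P st k) (hR : RightDone D.P st k) (h0 : ph .two 1 ≠ 0)
    (hleaf : IsLeaf D.P k → ∀ v, v + 1 = D.ptr k + D.n → 2 ≤ ph .two v) :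
    DataInv D ph (Function.update st k 1) M := by
  have e : ∀ j, j ≠ k → Function.update st k 1 j = st j := fun j hj =>
    Function.update_of_ne hj _ _
  have e1 : Function.update st k 1 k = 1 := Function.update_self _ _ _
  have e4 : ∀ j, Function.update st k 1 j = 4 ↔ st j = 4 := by
    intro j
    rcases eq_or_ne j k with rfl | hj
    · rw [e1, hk]; omega
    · rw [e j hj]
  have eL : ∀ p, LeftDone D.P (Function.update st k 1) p ↔ LeftDone D.P st p := fun p =>
    ⟨.mono fun j => (e4 j).1, .mono fun j => (e4 j).2⟩
  have eR : ∀ p, RightDone D.P (Function.update st k 1) p ↔ RightDone D.P st p := fun p =>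
    ⟨.mono fun j => (e4 j).1, .mono fun j => (e4 j).2⟩
  have elt : ∀ s j, 2 ≤ s → (Function.update st k 1 j < s ↔ st j < s) := by
    intro s j hs
    rcases eq_or_ne j k with rfl | hj
    · rw [e1, hk]; omega
    · rw [e j hj]
  constructor
  · exact H.prio
  · intro j hj
    have : j ≠ k := by rintro rfl; exact hj ⟨h1, h2⟩
    rw [e j this]
    exact H.out j hj
  · exact fun _ _ => h0
  · intro j a b c v hv hp
    have : j ≠ k := by
      rintro rfl
      have := hleaf c v hv
      omega
    rw [e j this]
    exact H.leafZero j a b c v hv hp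
  · intro j a b v hv hp hs
    have : j ≠ k := by rintro rfl; omega
    rw [e j this] at hs
    classical
    exact (H.flag j a b v hv hp hs).trans (if_congr (or_congr (eL j) (eR j)).symm rfl rfl)
  · exact H.leaf
  · intro j hj
    rw [eL, eR]
    rcases eq_or_ne j k with rfl | hne
    · exact ⟨hL, hR⟩
    · rw [e j hne] at hj
      exact H.closed j hj
  · intro j a b hj
    rw [elt 2 j le_rfl] at hj
    obtain ⟨i, x1, x2, x3, x4, x5⟩ := H.next j a b hj
    refine ⟨i, x1, x2, (elt 2 i le_rfl).2 x3, fun i' y1 y2 => ?_, x5⟩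
    exact not_lt.1 fun hlt => not_lt.2 (x4 i' y1 y2) ((elt 2 i' le_rfl).1 hlt)
  · intro j a b hj
    rw [elt 3 j (by omega)] at hj
    obtain ⟨i, x1, x3, x4, x5⟩ := H.prev j a b hj
    refine ⟨i, x1, (elt 3 i (by omega)).2 x3, fun i' y1 y2 => ?_, x5⟩
    exact not_lt.1 fun hlt => not_lt.2 (x4 i' y1 y2) ((elt 3 i' (by omega)).1 hlt)

theorem activate_leaf (H : DataInv D ph st M) (h1 : 1 ≤ k) (h2 : k ≤ D.n) (hk : st k = 0)
    (hleaf : IsLeaf D.P k) (h0 : ph .two 1 ≠ 0)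
    (hph : ∀ v, v + 1 = D.ptr k + D.n → 2 ≤ ph .two v) :
    DataInv D ph (Function.update st k 1) M :=
  H.activate h1 h2 hk (fun _ hj => absurd hleaf (D.not_isLeaf_left (D.leftDesc_pos h1 h2 hj) hj))
    (fun _ hj => absurd hleaf (D.not_isLeaf_right hj)) h0 fun _ => hph

/-- Position `k` leaves the list of stages below 2, where its neighbours are `l` and `r`. If `l` is
the sentinel, `hN` imposes no change, so the case without a write is included. -/
theorem set_next (H : DataInv D ph st M) (h1 : 1 ≤ k) (h2 : k ≤ D.n) (hk : st k = 1)
    (hl : LeftUp D.P k l) (hr : RightUp D.P k r) (hrn : r ≤ D.n + 1)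
    (hM : ∀ f, f ≠ .next → M' f = M f)
    (hN : ∀ j, 1 ≤ j → j ≤ D.n →
      M' .next (D.ptr j) = if j = l then D.ptr r else M .next (D.ptr j)) :
    DataInv D ph (Function.update st k 2) M' := by
  have e : ∀ j, j ≠ k → Function.update st k 2 j = st j := fun j hj =>
    Function.update_of_ne hj _ _
  have e1 : Function.update st k 2 k = 2 := Function.update_self _ _ _
  have e4 : ∀ s j, s ≠ 1 → s ≠ 2 → (Function.update st k 2 j = s ↔ st j = s) := by
    intro s j hs hs2
    rcases eq_or_ne j k with rfl | hj
    · rw [e1, hk]; omega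
    · rw [e j hj]
  have eL : ∀ p, LeftDone D.P (Function.update st k 2) p ↔ LeftDone D.P st p := fun p =>
    ⟨.mono fun j => (e4 4 j (by omega) (by omega)).1, .mono fun j => (e4 4 j (by omega) (by omega)).2⟩
  have eR : ∀ p, RightDone D.P (Function.update st k 2) p ↔ RightDone D.P st p := fun p =>
    ⟨.mono fun j => (e4 4 j (by omega) (by omega)).1, .mono fun j => (e4 4 j (by omega) (by omega)).2⟩
  have e0 : ∀ j, Function.update st k 2 j = 0 ↔ st j = 0 := fun j => e4 0 j (by omega) (by omega)
  have el := H.leftUp_stage (by omega) hl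
  have er := H.rightUp_stage (by omega) hr
  have bl := H.between_left (by omega) hl
  have br := H.between_right (by omega) hr
  have elt : ∀ j, Function.update st k 2 j < 3 ↔ st j < 3 := by
    intro j
    rcases eq_or_ne j k with rfl | hj
    · rw [e1, hk]; omega
    · rw [e j hj]
  have ele : ∀ j, 2 ≤ st j → 2 ≤ Function.update st k 2 j := by
    intro j
    rcases eq_or_ne j k with rfl | hj
    · rw [e1, hk]; omega
    · rw [e j hj]; exact id
  constructor
  · rw [hM _ (by simp)]; exact H.prio
  · exact fun j hj => (e0 j).2 (H.out j hj)
  · exact fun j hj => H.zero j fun h => hj ((e0 j).2 h)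
  · exact fun j a b c v hv hp => (e0 j).2 (H.leafZero j a b c v hv hp)
  · intro j a b v hv hp hs
    rw [hM _ (by simp)]
    classical
    exact (H.flag j a b v hv hp ((e0 j).1 hs)).trans
      (if_congr (or_congr (eL j) (eR j)).symm rfl rfl)
  · rw [hM _ (by simp)]; exact H.leaf
  · intro j hj
    rw [eL, eR]
    exact H.closed j (Nat.pos_of_ne_zero fun h => by rw [(e0 j).2 h] at hj; omega)
  · intro j a b hj
    have hjk : j ≠ k := by rintro rfl; omega
    rw [e j hjk] at hj
    rw [hN j a b]
    split_ifs with hjl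
    · subst hjl
      refine ⟨r, hl.1.trans hr.1, hrn, by rw [(e0 r).2 er]; omega, fun i y1 y2 => ?_, rfl⟩
      rcases lt_trichotomy i k with h | rfl | h
      · exact ele i (by rw [bl i y1 h]; omega)
      · omega
      · exact ele i (by rw [br i h y2]; omega)
    · obtain ⟨i, x1, x2, x3, x4, x5⟩ := H.next j a b hj
      -- Only `l` precedes `k` directly in this list, so no other pointer leads to `k`.
      have hik : i ≠ k := by
        rintro rfl
        rcases lt_or_gt_of_ne hjl with h | h
        · have := x4 l h hl.1
          omega
        · have := bl j h x1
          omega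
      exact ⟨i, x1, x2, by rwa [e i hik], fun i' y1 y2 => ele i' (x4 i' y1 y2), x5⟩
  · intro j a b hj
    rw [elt j] at hj
    rw [hM _ (by simp)]
    obtain ⟨i, x1, x3, x4, x5⟩ := H.prev j a b hj
    refine ⟨i, x1, (elt i).2 x3, fun i' y1 y2 => ?_, x5⟩
    exact not_lt.1 fun hlt => not_lt.2 (x4 i' y1 y2) ((elt i').1 hlt)

theorem set_prev (H : DataInv D ph st M) (h1 : 1 ≤ k) (h2 : k ≤ D.n) (hk : st k = 2)
    (hl : LeftUp D.P k l) (hr : RightUp D.P k r)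
    (hM : ∀ f, f ≠ .prev → M' f = M f)
    (hN : ∀ j, 1 ≤ j → j ≤ D.n →
      M' .prev (D.ptr j) = if j = r then D.ptr l else M .prev (D.ptr j)) :
    DataInv D ph (Function.update st k 3) M' := by
  have e : ∀ j, j ≠ k → Function.update st k 3 j = st j := fun j hj =>
    Function.update_of_ne hj _ _
  have e1 : Function.update st k 3 k = 3 := Function.update_self _ _ _
  have e4 : ∀ s j, s ≠ 2 → s ≠ 3 → (Function.update st k 3 j = s ↔ st j = s) := by
    intro s j hs hs2
    rcases eq_or_ne j k with rfl | hj
    · rw [e1, hk]; omega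
    · rw [e j hj]
  have eL : ∀ p, LeftDone D.P (Function.update st k 3) p ↔ LeftDone D.P st p := fun p =>
    ⟨.mono fun j => (e4 4 j (by omega) (by omega)).1, .mono fun j => (e4 4 j (by omega) (by omega)).2⟩
  have eR : ∀ p, RightDone D.P (Function.update st k 3) p ↔ RightDone D.P st p := fun p =>
    ⟨.mono fun j => (e4 4 j (by omega) (by omega)).1, .mono fun j => (e4 4 j (by omega) (by omega)).2⟩
  have e0 : ∀ j, Function.update st k 3 j = 0 ↔ st j = 0 := fun j => e4 0 j (by omega) (by omega)
  have el := H.leftUp_stage (by omega) hl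
  have er := H.rightUp_stage (by omega) hr
  have bl := H.between_left (by omega) hl
  have br := H.between_right (by omega) hr
  have elt : ∀ j, Function.update st k 3 j < 2 ↔ st j < 2 := by
    intro j
    rcases eq_or_ne j k with rfl | hj
    · rw [e1, hk]; omega
    · rw [e j hj]
  have ele : ∀ j, 3 ≤ st j → 3 ≤ Function.update st k 3 j := by
    intro j
    rcases eq_or_ne j k with rfl | hj
    · rw [e1, hk]; omega
    · rw [e j hj]; exact id
  constructor
  · rw [hM _ (by simp)]; exact H.prio
  · exact fun j hj => (e0 j).2 (H.out j hj)
  · exact fun j hj => H.zero j fun h => hj ((e0 j).2 h)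
  · exact fun j a b c v hv hp => (e0 j).2 (H.leafZero j a b c v hv hp)
  · intro j a b v hv hp hs
    rw [hM _ (by simp)]
    classical
    exact (H.flag j a b v hv hp ((e0 j).1 hs)).trans
      (if_congr (or_congr (eL j) (eR j)).symm rfl rfl)
  · rw [hM _ (by simp)]; exact H.leaf
  · intro j hj
    rw [eL, eR]
    exact H.closed j (Nat.pos_of_ne_zero fun h => by rw [(e0 j).2 h] at hj; omega)
  · intro j a b hj
    rw [elt j] at hj
    rw [hM _ (by simp)]
    obtain ⟨i, x1, x2, x3, x4, x5⟩ := H.next j a b hj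
    refine ⟨i, x1, x2, (elt i).2 x3, fun i' y1 y2 => ?_, x5⟩
    exact not_lt.1 fun hlt => not_lt.2 (x4 i' y1 y2) ((elt i').1 hlt)
  · intro j a b hj
    have hjk : j ≠ k := by rintro rfl; omega
    rw [e j hjk] at hj
    rw [hN j a b]
    split_ifs with hjl
    · subst hjl
      refine ⟨l, hl.1.trans hr.1, by rw [(e0 l).2 el]; omega, fun i y1 y2 => ?_, rfl⟩
      rcases lt_trichotomy i k with h | rfl | h
      · exact ele i (by rw [bl i y1 h]; omega)
      · omega
      · exact ele i (by rw [br i h y2]; omega)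
    · obtain ⟨i, x1, x3, x4, x5⟩ := H.prev j a b hj
      have hik : i ≠ k := by
        rintro rfl
        rcases lt_or_gt_of_ne hjl with h | h
        · have := br j x1 h
          omega
        · have := x4 r hr.1 h
          omega
      exact ⟨i, x1, by rwa [e i hik], fun i' y1 y2 => ele i' (x4 i' y1 y2), x5⟩

/-- The side of the parent to which `k` belongs is done as soon as `k` is. -/
theorem side_done (H : DataInv D ph st M) (hk : st k = 3) (hl : LeftUp D.P k l)
    (hr : RightUp D.P k r) (hm : Parent D l r m) :
    (¬ LeftDone D.P st m ∧ LeftDone D.P (Function.update st k 4) m) ∨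
      (¬ RightDone D.P st m ∧ RightDone D.P (Function.update st k 4) m) := by
  have bl := H.between_left (by omega) hl
  have br := H.between_right (by omega) hr
  have e1 : Function.update st k 4 k = 4 := Function.update_self _ _ _
  have e : ∀ j, l < j → j < r → Function.update st k 4 j = 4 := by
    intro j h1 h2
    rcases lt_trichotomy j k with h | rfl | h
    · rw [Function.update_of_ne h.ne, bl j h1 h]
    · exact e1
    · rw [Function.update_of_ne h.ne', br j h h2]
  obtain ⟨_, _, ⟨rfl, hlt⟩ | ⟨rfl, hlt⟩⟩ := hm
  · refine .inr ⟨fun h => ?_, fun j hj => e j hj.1 ?_⟩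
    · have := h k (D.rightDesc_of_leftUp hl)
      omega
    · by_contra hc
      have := hj.2 r (hl.1.trans hr.1) (by omega)
      omega
  · refine .inl ⟨fun h => ?_, fun j hj => e j ?_ hj.1⟩
    · have := h k (D.leftDesc_of_rightUp hr)
      omega
    · by_contra hc
      have := hj.2 l (by omega) (hl.1.trans hr.1)
      omega

/-- Both outcomes of the test-and-set are covered: the flag of `m` is one afterwards in either case,
as it must be now that one side of `m` is finished. For every other element the finished sides stay
the same by `Layout.leftDesc_parent` and `Layout.rightDesc_parent`, because `m` has stage 0. -/
theorem finish (H : DataInv D ph st M) (h1 : 1 ≤ k) (h2 : k ≤ D.n) (hk : st k = 3)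
    (hl : LeftUp D.P k l) (hr : RightUp D.P k r) (hm : Parent D l r m)
    (hM : ∀ f, f ≠ .flag → M' f = M f) (hm1 : M' .flag (D.ptr m) = 1)
    (hF : ∀ j, 1 ≤ j → j ≤ D.n → j ≠ m → M' .flag (D.ptr j) = M .flag (D.ptr j)) :
    DataInv D ph (Function.update st k 4) M' := by
  have e : ∀ j, j ≠ k → Function.update st k 4 j = st j := fun j hj =>
    Function.update_of_ne hj _ _
  have e1 : Function.update st k 4 k = 4 := Function.update_self _ _ _
  have e4 : ∀ s j, s ≠ 3 → s ≠ 4 → (Function.update st k 4 j = s ↔ st j = s) := by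
    intro s j hs hs2
    rcases eq_or_ne j k with rfl | hj
    · rw [e1, hk]; omega
    · rw [e j hj]
  have emono : ∀ j, st j = 4 → Function.update st k 4 j = 4 := by
    intro j
    rcases eq_or_ne j k with rfl | hj
    · exact fun _ => e1
    · rw [e j hj]; exact id
  have e0 : ∀ j, Function.update st k 4 j = 0 ↔ st j = 0 := fun j => e4 0 j (by omega) (by omega)
  have elt : ∀ s j, s ≤ 3 → (Function.update st k 4 j < s ↔ st j < s) := by
    intro s j hs
    rcases eq_or_ne j k with rfl | hj
    · rw [e1, hk]; omega
    · rw [e j hj]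
  have em : st m = 0 := by
    obtain ⟨_, _, ⟨rfl, hlt⟩ | ⟨rfl, hlt⟩⟩ := hm
    · exact H.leftUp_stage (by omega) hl
    · exact H.rightUp_stage (by omega) hr
  have em' : Function.update st k 4 m = 0 := (e0 m).2 em
  constructor
  · rw [hM _ (by simp)]; exact H.prio
  · exact fun j hj => (e0 j).2 (H.out j hj)
  · exact fun j hj => H.zero j fun h => hj ((e0 j).2 h)
  · exact fun j a b c v hv hp => (e0 j).2 (H.leafZero j a b c v hv hp)
  · intro j a b v hv hp hs
    rcases eq_or_ne j m with rfl | hjm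
    · rw [hm1, if_pos]
      exact (H.side_done hk hl hr hm).imp And.right And.right
    · have eL : LeftDone D.P (Function.update st k 4) j ↔ LeftDone D.P st j := by
        refine ⟨fun h i hi => ?_, .mono emono⟩
        rcases eq_or_ne i k with rfl | hik
        · have := h m (D.leftDesc_parent hl hr hm hi hjm.symm)
          omega
        · rw [← e i hik]; exact h i hi
      have eR : RightDone D.P (Function.update st k 4) j ↔ RightDone D.P st j := by
        refine ⟨fun h i hi => ?_, .mono emono⟩
        rcases eq_or_ne i k with rfl | hik
        · have := h m (D.rightDesc_parent hl hr hm hi hjm.symm)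
          omega
        · rw [← e i hik]; exact h i hi
      rw [hF j a b hjm]
      classical
      exact (H.flag j a b v hv hp ((e0 j).1 hs)).trans (if_congr (or_congr eL eR).symm rfl rfl)
  · rw [hM _ (by simp)]; exact H.leaf
  · intro j hj
    have := H.closed j (Nat.pos_of_ne_zero fun h => by rw [(e0 j).2 h] at hj; omega)
    exact ⟨this.1.mono emono, this.2.mono emono⟩
  · intro j a b hj
    rw [elt 2 j (by omega)] at hj
    rw [hM _ (by simp)]
    obtain ⟨i, x1, x2, x3, x4, x5⟩ := H.next j a b hj
    refine ⟨i, x1, x2, (elt 2 i (by omega)).2 x3, fun i' y1 y2 => ?_, x5⟩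
    exact not_lt.1 fun hlt => not_lt.2 (x4 i' y1 y2) ((elt 2 i' (by omega)).1 hlt)
  · intro j a b hj
    rw [elt 3 j (by omega)] at hj
    rw [hM _ (by simp)]
    obtain ⟨i, x1, x3, x4, x5⟩ := H.prev j a b hj
    refine ⟨i, x1, (elt 3 i (by omega)).2 x3, fun i' y1 y2 => ?_, x5⟩
    exact not_lt.1 fun hlt => not_lt.2 (x4 i' y1 y2) ((elt 3 i' (by omega)).1 hlt)

/-- The flag of the parent is one: the thread goes on with the parent. -/
theorem finish_activate (H : DataInv D ph st M) (h1 : 1 ≤ k) (h2 : k ≤ D.n) (hk : st k = 3)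
    (hl : LeftUp D.P k l) (hr : RightUp D.P k r) (hm : Parent D l r m)
    (hone : ∀ v, D.n ≤ v → v < 2 * D.n → 3 ≤ ph .one v) (hflag : M .flag (D.ptr m) ≠ 0) :
    st m = 0 ∧ DataInv D ph (Function.update (Function.update st k 4) m 1) M := by
  have em : st m = 0 := by
    obtain ⟨_, _, ⟨rfl, hlt⟩ | ⟨rfl, hlt⟩⟩ := hm
    · exact H.leftUp_stage (by omega) hl
    · exact H.rightUp_stage (by omega) hr
  have hmk : m ≠ k := by rintro rfl; omega
  have hmp := D.ptr_pos m hm.1 hm.2.1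
  have hmn := D.ptr_le m (by have := hm.2.1; omega)
  have hf := H.flag m hm.1 hm.2.1 (D.ptr m + D.n - 1) (by omega)
    (hone _ (by omega) (by omega)) em
  rw [hf] at hflag
  have hdone : LeftDone D.P st m ∨ RightDone D.P st m := by
    by_contra h
    rw [if_neg h] at hflag
    exact hflag rfl
  rw [if_pos hdone] at hf
  have emono : ∀ j, st j = 4 → Function.update st k 4 j = 4 := by
    intro j
    rcases eq_or_ne j k with rfl | hj
    · exact fun _ => Function.update_self _ _ _
    · rw [Function.update_of_ne hj]; exact id
  have both : LeftDone D.P (Function.update st k 4) m ∧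
      RightDone D.P (Function.update st k 4) m := by
    -- The side of `k` was unfinished, so the flag was one on account of the other side; finishing
    -- `k` completes its own.
    rcases H.side_done hk hl hr hm with ⟨a, b⟩ | ⟨a, b⟩
    · exact ⟨b, (hdone.resolve_left a).mono emono⟩
    · exact ⟨(hdone.resolve_right a).mono emono, b⟩
  refine ⟨em, (H.finish h1 h2 hk hl hr hm (fun _ _ => rfl) hf fun _ _ _ _ => rfl).activate
    hm.1 hm.2.1 ?_ both.1 both.2 ?_ fun hleaf => ?_⟩
  · rw [Function.update_of_ne hmk, em]
  · exact H.zero k (by omega)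
  · rcases D.desc_parent hl hr hm with h | h
    · exact absurd hleaf (D.not_isLeaf_left h1 h)
    · exact absurd hleaf (D.not_isLeaf_right h)

/-- While all stages are 0 a side is finished only if it is empty, which means that the adjacent
priority is larger. So the value computed by the first loop is the one that the invariant requires.
-/
theorem set_flag (H : DataInv D ph st M) {ph' : Phases} (h1 : 1 ≤ k) (h2 : k ≤ D.n)
    (h0 : ph .two 1 = 0) (hv : v + 1 = D.ptr k + D.n)
    (hM : ∀ f, f ≠ .flag → M' f = M f)
    (hF : ∀ j, 1 ≤ j → j ≤ D.n → j ≠ k → M' .flag (D.ptr j) = M .flag (D.ptr j))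
    (hk : M' .flag (D.ptr k) =
      if D.P k < D.P (k - 1) ∨ D.P k < D.P (k + 1) then 1 else 0)
    (h3 : ∀ w, w ≠ v → ph' .one w = ph .one w) (h4 : ph' .one v = 3)
    (h5 : ph' .two = ph .two) : DataInv D ph' st M' := by
  have hz : ∀ k, st k = 0 := fun k => by
    by_contra h
    exact H.zero k h h0
  constructor
  · rw [hM _ (by simp)]; exact H.prio
  · exact H.out
  · rw [h5]; exact H.zero
  · rw [h5]; exact H.leafZero
  · intro j a b w hw hp _
    rcases eq_or_ne j k with rfl | hjk
    · rw [hk]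
      classical
      refine if_congr (or_congr ⟨fun h i hi => ?_, fun h => ?_⟩ ⟨fun h i hi => ?_, fun h => ?_⟩)
        rfl rfl
      · have := hi.2 (j - 1) (by have := hi.1; omega) (by omega)
        omega
      · by_contra hc
        have hne := D.P_ne (j - 1) j (by omega) h1 h2 (by omega)
        have := h (j - 1) ⟨by omega, fun i h1 h2 => by
          rw [show i = j - 1 by omega]; omega⟩
        rw [hz] at this
        omega
      · have := hi.2 (j + 1) (by omega) hi.1
        omega
      · by_contra hc
        have hne := D.P_ne (j + 1) j (by omega) h1 h2 (by omega)
        have := h (j + 1) ⟨by omega, fun i h1 h2 => by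
          rw [show i = j + 1 by omega]; omega⟩
        rw [hz] at this
        omega
    · rw [hF j a b hjk]
      have : w ≠ v := by
        rintro rfl
        exact hjk (D.ptr_inj j k a b h1 h2 (by omega))
      rw [h3 w this] at hp
      exact H.flag j a b w hw hp (hz j)
  · intro j a b w hw hp
    rw [hM _ (by simp)]
    rcases eq_or_ne w v with rfl | hne
    · omega
    · rw [h3 w hne] at hp
      exact H.leaf j a b w hw hp
  · exact H.closed
  · rw [hM _ (by simp)]; exact H.next
  · rw [hM _ (by simp)]; exact H.prev

theorem set_leaf (H : DataInv D ph st M) {ph' : Phases} (h1 : 1 ≤ k) (h2 : k ≤ D.n)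
    (hv : v + 1 = D.ptr k + D.n)
    (hM : ∀ f, f ≠ .leaf → M' f = M f)
    (hF : ∀ j, 1 ≤ j → j ≤ D.n → j ≠ k → M' .leaf (D.ptr j) = M .leaf (D.ptr j))
    (hk : M' .leaf (D.ptr k) =
      if D.P k < D.P (k - 1) ∧ D.P k < D.P (k + 1) then 1 else 0)
    (h3 : ∀ w, w ≠ v → ph' .one w = ph .one w) (h4 : 3 ≤ ph .one v)
    (h5 : ph' .two = ph .two) : DataInv D ph' st M' := by
  constructor
  · rw [hM _ (by simp)]; exact H.prio
  · exact H.out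
  · rw [h5]; exact H.zero
  · rw [h5]; exact H.leafZero
  · intro j a b w hw hp hs
    rw [hM _ (by simp)]
    rcases eq_or_ne w v with rfl | hne
    · exact H.flag j a b w hw h4 hs
    · rw [h3 w hne] at hp
      exact H.flag j a b w hw hp hs
  · intro j a b w hw hp
    rcases eq_or_ne j k with rfl | hjk
    · rw [hk]
      classical
      exact if_congr Iff.rfl rfl rfl
    · rw [hF j a b hjk]
      have : w ≠ v := by
        rintro rfl
        exact hjk (D.ptr_inj j k a b h1 h2 (by omega))
      rw [h3 w this] at hp
      exact H.leaf j a b w hw hp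
  · exact H.closed
  · rw [hM _ (by simp)]; exact H.next
  · rw [hM _ (by simp)]; exact H.prev

end DataInv

end ListContraction

namespace ListContraction
open BinaryForking

/-! ### The fork trees -/

/-- The phases of the nodes of a fork tree and the synchronization words fit together. -/
def TreeInv (n : ℕ) (ph sync : ℕ → ℕ) : Prop := ∀ v, 1 ≤ v → v < n →
  (ph v ≤ 2 → ph (2 * v) = 0 ∧ ph (2 * v + 1) = 0) ∧
  (ph v = 3 → 1 ≤ ph (2 * v) ∧ 1 ≤ ph (2 * v + 1) ∧ ¬ (ph (2 * v) = 5 ∧ ph (2 * v + 1) = 5)) ∧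
  (4 ≤ ph v → ph (2 * v) = 5 ∧ ph (2 * v + 1) = 5) ∧
  (ph v = 2 ∨ ph v = 3 → (sync v = 1 ∧ (ph (2 * v) = 5 ∨ ph (2 * v + 1) = 5)) ∨
    (sync v = 0 ∧ ph (2 * v) ≠ 5 ∧ ph (2 * v + 1) ≠ 5))

theorem update_cases {f f' : ℕ → ℕ} {v : ℕ} (h : ∀ w, w ≠ v → f' w = f w) (w : ℕ) :
    w = v ∧ f' w = f' v ∧ f w = f v ∨ w ≠ v ∧ f' w = f w := by
  rcases eq_or_ne w v with rfl | hw
  · exact .inl ⟨rfl, rfl, rfl⟩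
  · exact .inr ⟨hw, h w hw⟩

namespace TreeInv
variable {n v p : ℕ} {ph sync ph' sync' : ℕ → ℕ}

/-- A node in phase 5 has both children in phase 5. Applied to the first loop: once its root is
joined, all flags and leaf marks have been written. -/
theorem eq_five (H : TreeInv n ph sync) (h1 : ph 1 = 5) :
    ∀ v, 1 ≤ v → v < 2 * n → ph v = 5 := by
  intro v
  induction v using Nat.strong_induction_on with
  | _ v ih =>
    intro hv hn
    rcases hv.eq_or_lt with rfl | hv1
    · exact h1
    · have h2 := ih (v / 2) (by omega) (by omega) (by omega)
      have h3 := (H (v / 2) (by omega) (by omega)).2.2.1 (by omega)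
      rcases Nat.mod_two_eq_zero_or_one v with h | h
      · rw [← h3.1]; congr 1; omega
      · rw [← h3.2]; congr 1; omega

theorem root_ne_zero (H : TreeInv n ph sync) : ∀ v, 1 ≤ v → v < 2 * n → ph v ≠ 0 → ph 1 ≠ 0 := by
  intro v
  induction v using Nat.strong_induction_on with
  | _ v ih =>
    intro hv hn h0
    rcases hv.eq_or_lt with rfl | hv1
    · exact h0
    · refine ih (v / 2) (by omega) (by omega) (by omega) fun h2 => h0 ?_
      have h3 := (H (v / 2) (by omega) (by omega)).1 (by omega)
      rcases Nat.mod_two_eq_zero_or_one v with h | h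
      · rw [← h3.1]; congr 1; omega
      · rw [← h3.2]; congr 1; omega

/-- Zeroing the synchronization word of an inner node. -/
theorem zero_sync (H : TreeInv n ph sync) (hv : 1 ≤ v) (hvn : v < n) (hp : ph v = 1)
    (h : ∀ w, w ≠ v → ph' w = ph w) (h' : ph' v = 2)
    (hs : ∀ w, w ≠ v → sync' w = sync w) (hs' : sync' v = 0) : TreeInv n ph' sync' := by
  intro w hw hwn
  have h1 := H w hw hwn
  rcases eq_or_ne w v with rfl | hwv
  · have := h (2 * w) (by omega)
    have := h (2 * w + 1) (by omega)
    omega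
  · have := h w hwv
    have := hs w hwv
    rcases eq_or_ne (2 * w) v with rfl | e
    · have := h (2 * w + 1) (by omega)
      omega
    · have := h (2 * w) e
      rcases eq_or_ne (2 * w + 1) v with rfl | e'
      · omega
      · have := h (2 * w + 1) e'
        omega

/-- Forking the threads for the children of an inner node. -/
theorem fork (H : TreeInv n ph sync) (hv : 1 ≤ v) (hvn : v < n) (hp : ph v = 2)
    (h : ∀ w, w ≠ v → w ≠ 2 * v → w ≠ 2 * v + 1 → ph' w = ph w) (h' : ph' v = 3)
    (h0 : ph' (2 * v) = 1) (h1 : ph' (2 * v + 1) = 1) : TreeInv n ph' sync := by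
  intro w hw hwn
  have h1' := H w hw hwn
  have h2' := (H v hv hvn).1 (by omega)
  rcases eq_or_ne w v with rfl | hwv
  · omega
  · have hd : ph w = 0 ∧ ph' w ≤ 1 ∧ 2 * w ≠ v ∧ 2 * w + 1 ≠ v ∨ ph' w = ph w := by
      rcases eq_or_ne w (2 * v) with rfl | e
      · exact .inl (by omega)
      · rcases eq_or_ne w (2 * v + 1) with rfl | e'
        · exact .inl (by omega)
        · exact .inr (h w hwv e e')
    rcases eq_or_ne (2 * w) v with rfl | e
    · have := h (2 * w + 1) (by omega) (by omega) (by omega)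
      omega
    · have := h (2 * w) e (by omega) (by omega)
      rcases eq_or_ne (2 * w + 1) v with rfl | e'
      · omega
      · have := h (2 * w + 1) e' (by omega) (by omega)
        omega

/-- Executing the body of the loop at a leaf. -/
theorem body (H : TreeInv n ph sync) (hvn : n ≤ v) (hp : 1 ≤ ph v) (hp4 : ph v ≤ 4)
    (h : ∀ w, w ≠ v → ph' w = ph w) (h' : 1 ≤ ph' v) (h'4 : ph' v ≤ 4) : TreeInv n ph' sync := by
  intro w hw hwn
  have := H w hw hwn
  have := h w (by omega)
  have := update_cases h (2 * w)
  have := update_cases h (2 * w + 1)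
  omega

/-- The root is reached. -/
theorem root (H : TreeInv n ph sync) (h : ∀ w, w ≠ 1 → ph' w = ph w) (h' : ph 1 = 4)
    (h'4 : ph' 1 = 5) : TreeInv n ph' sync := by
  intro w hw hwn
  have := H w hw hwn
  have := update_cases h w
  have := h (2 * w) (by omega)
  have := h (2 * w + 1) (by omega)
  rcases eq_or_ne w 1 with rfl | hw1 <;> omega

theorem begin_root (H : TreeInv n ph sync) (h : ∀ w, w ≠ 1 → ph' w = ph w) (h' : ph 1 = 0)
    (h'4 : ph' 1 = 1) : TreeInv n ph' sync := by
  intro w hw hwn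
  have := H w hw hwn
  have := update_cases h w
  have := h (2 * w) (by omega)
  have := h (2 * w + 1) (by omega)
  rcases eq_or_ne w 1 with rfl | hw1 <;> omega

/-- An earlier phase of the parent would put the child in phase 0, a later one in phase 5. -/
theorem parent (H : TreeInv n ph sync) (hv : 1 < v) (hvn : v < 2 * n) (hp : ph v = 4) :
    ph (v / 2) = 3 ∧ sync (v / 2) ≤ 1 := by
  have := H (v / 2) (by omega) (by omega)
  rcases Nat.mod_two_eq_zero_or_one v with h | h
  · have e : 2 * (v / 2) = v := by omega
    rw [e] at this
    omega
  · have e : 2 * (v / 2) + 1 = v := by omega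
    rw [e] at this
    omega

/-- The first of two siblings arrives at the parent. -/
theorem join_first (H : TreeInv n ph sync) (hv : 1 < v) (hvn : v < 2 * n) (hp : ph v = 4)
    (hs0 : sync (v / 2) = 0) (h : ∀ w, w ≠ v → ph' w = ph w) (h' : ph' v = 5)
    (hs : ∀ w, w ≠ v / 2 → sync' w = sync w) (hs' : sync' (v / 2) = 1) : TreeInv n ph' sync' := by
  intro w hw hwn
  have h3 := H w hw hwn
  have h5 := H.parent hv hvn hp
  have ha := update_cases h w
  have hb := update_cases h (2 * w)
  have hc := update_cases h (2 * w + 1)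
  have hd := update_cases hs w
  rcases eq_or_ne w (v / 2) with rfl | hwv <;> omega

/-- The second of two siblings arrives at the parent. -/
theorem join_second (H : TreeInv n ph sync) (hv : 1 < v) (hvn : v < 2 * n) (hp : ph v = 4)
    (hs0 : sync (v / 2) ≠ 0) (h : ∀ w, w ≠ v → w ≠ v / 2 → ph' w = ph w) (h' : ph' v = 5)
    (h2 : ph' (v / 2) = 4) : TreeInv n ph' sync := by
  intro w hw hwn
  have h3 := H w hw hwn
  have h5 := H.parent hv hvn hp
  have aux : ∀ u, u = v ∧ ph' u = ph' v ∧ ph u = ph v ∨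
      u = v / 2 ∧ ph' u = ph' (v / 2) ∧ ph u = ph (v / 2) ∨ u ≠ v ∧ u ≠ v / 2 ∧ ph' u = ph u := by
    intro u
    rcases eq_or_ne u v with rfl | e
    · exact .inl ⟨rfl, rfl, rfl⟩
    · rcases eq_or_ne u (v / 2) with rfl | e'
      · exact .inr (.inl ⟨rfl, rfl, rfl⟩)
      · exact .inr (.inr ⟨e, e', h u e e'⟩)
  have ha := aux w
  have hb := aux (2 * w)
  have hc := aux (2 * w + 1)
  rcases eq_or_ne w (v / 2) with rfl | hwv <;> omega

end TreeInv
end ListContraction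

namespace ListContraction
open BinaryForking

/-! ### The invariant of the threads -/

/-- Instructions that a thread executes in the same phase have decreasing ranks. -/
def rank : Label → ℕ
  | .start => 39
  | .spawn5 _ => 38 | .spawn0 _ => 37 | .spawn1 _ => 36 | .spawn2 _ => 35 | .spawn3 _ => 34
  | .spawn4 _ => 33
  | .elem0 _ => 32 | .elem1 _ => 31 | .elem2 _ => 30
  | .leaf0 => 29 | .leaf1 => 28
  | .init0 => 27 | .init1 => 26 | .init2 => 25
  | .test1 => 35 | .test2 => 34
  | .while0 => 33 | .while1 => 32 | .while2 => 31 | .while3 => 30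
  | .splice0 => 29 | .splice1 => 28 | .splice2 => 27 | .splice3 => 26
  | .pri0 _ => 24 | .pri1 _ => 23 | .pri2 _ => 23 | .pri3 _ => 22 | .pri4 _ => 21 | .pri5 _ => 21
  | .pick0 => 20 | .pick1 => 19 | .pick2 => 19 | .test0 => 18
  | .init3 => 20 | .init4 => 19 | .init5 => 18 | .init6 => 17 | .init7 => 16 | .init8 => 15
  | .join4 _ => 10 | .join0 _ => 9 | .join1 _ => 8 | .join2 _ => 7 | .join3 _ => 6
  | .dead => 5 | .halt => 5

theorem rank_pos (l : Label) : 1 ≤ rank l := by cases l <;> simp [rank]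

theorem rank_lt (l : Label) : rank l < 40 := by cases l <;> simp [rank]

/-- The number of phases of a thread before phase `p` of node `v` is over, without the iterations
of the while loop. -/
def Layout.budget (D : Layout) (i : Loop) (v p : ℕ) : ℕ :=
  match i with
  | .one => if p ≤ 3 then 3 * Nat.log 2 v + p
      else 3 * Nat.log 2 (2 * D.n) + p + (Nat.log 2 (2 * D.n) - Nat.log 2 v)
  | .two => 4 * Nat.log 2 (2 * D.n) + 6 + if p ≤ 3 then 3 * Nat.log 2 v + p
      else 3 * Nat.log 2 (2 * D.n) + D.h + 3 + p + (Nat.log 2 (2 * D.n) - Nat.log 2 v)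

/-- A bound for the depth of all instructions. -/
def Layout.maxDepth (D : Layout) : ℕ := 40 * (8 * Nat.log 2 (2 * D.n) + D.h + 14)

section
variable (D : Layout) (i : Loop) (v p : ℕ) (S : Stages) (q : ℕ) (ρ : Reg → ℕ)

/-- The thread executes the body of the first loop for the element at position `k`. -/
def InitInv (k : ℕ) : Prop :=
  p = 2 ∧ D.n ≤ v ∧ ρ .v = v ∧ 1 ≤ k ∧ k ≤ D.n ∧ ρ .c = D.ptr k ∧ v + 1 = D.ptr k + D.n

/-- The thread executes the while loop for the element at position `k`, which is at stage `s`. -/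
def BodyInv (s k : ℕ) : Prop :=
  p = 2 ∧ D.n ≤ v ∧ ρ .v = v ∧ 1 ≤ k ∧ k ≤ D.n ∧ ρ .c = D.ptr k ∧ S k = s ∧ q + D.f k ≤ D.h

/-- The thread has loaded pointers to the neighbours `l` and `r` of `k`. -/
def SpliceInv (s k l r : ℕ) : Prop :=
  BodyInv D v p S q ρ s k ∧ LeftUp D.P k l ∧ RightUp D.P k r ∧ r ≤ D.n + 1 ∧
    ρ .a = D.ptr l ∧ ρ .b = D.ptr r

/-- The state of the thread while it loads the priorities of the neighbours `l` and `r` of `k`. -/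
def PriInv (k l r : ℕ) : Prop :=
  match i with
  | .one => InitInv D v p ρ k ∧ k = l + 1 ∧ r = k + 1 ∧ ρ .a = D.ptr l ∧ ρ .b = D.ptr r ∧
      ρ .z = D.P k
  | .two => SpliceInv D v p S q ρ 3 k l r ∧ (ρ .a ≠ 0 ∨ ρ .b ≠ 0)

/-- The invariant of a thread at a label. -/
def LabInv : Label → Prop
  | .start => i = .one ∧ v = 1 ∧ p = 1
  | .spawn0 j => j = i ∧ p = 1 ∧ ρ .v = v
  | .spawn1 j => j = i ∧ p = 1 ∧ ρ .v = v ∧ v < D.n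
  | .spawn2 j => j = i ∧ p = 1 ∧ ρ .v = v ∧ v < D.n ∧ ρ .t = 0
  | .spawn3 j => j = i ∧ p = 2 ∧ ρ .v = v ∧ v < D.n
  | .spawn4 j => j = i ∧ p = 2 ∧ ρ .v = 2 * v ∧ v < D.n
  | .spawn5 j => j = i ∧ p = 1 ∧ ρ .v + ρ .t = v
  | .elem0 j => j = i ∧ p = 1 ∧ ρ .v = v ∧ D.n ≤ v
  | .elem1 j => j = i ∧ p = 1 ∧ ρ .v = v ∧ D.n ≤ v ∧ ρ .c + D.n = v
  | .elem2 j => j = i ∧ p = 1 ∧ ρ .v = v ∧ D.n ≤ v ∧ ρ .c + D.n = v ∧ ρ .t = 1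
  | .leaf0 => i = .two ∧ p = 1 ∧ ρ .v = v ∧ D.n ≤ v ∧ ρ .c + D.n = v + 1
  | .leaf1 => i = .two ∧ p = 1 ∧ ρ .v = v ∧ D.n ≤ v ∧ ρ .c + D.n = v + 1 ∧
      (ρ .t ≠ 0 → ∃ k, 1 ≤ k ∧ k ≤ D.n ∧ D.ptr k = ρ .c ∧ IsLeaf D.P k)
  | .init0 => i = .one ∧ ∃ k, InitInv D v p ρ k
  | .init1 => i = .one ∧ ∃ k, InitInv D v p ρ k ∧ ρ .a = D.ptr (k - 1)
  | .init2 => i = .one ∧ ∃ k, InitInv D v p ρ k ∧ ρ .a = D.ptr (k - 1) ∧ ρ .b = D.ptr (k + 1)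
  | .pri0 j => j = i ∧ ∃ k l r, PriInv D i v p S q ρ k l r
  | .pri1 j => j = i ∧ ∃ k l r, PriInv D i v p S q ρ k l r ∧ ρ .a = 0
  | .pri2 j => j = i ∧ ∃ k l r, PriInv D i v p S q ρ k l r ∧ ρ .a ≠ 0
  | .pri3 j => j = i ∧ ∃ k l r, PriInv D i v p S q ρ k l r ∧ ρ .x = D.P l
  | .pri4 j => j = i ∧ ∃ k l r, PriInv D i v p S q ρ k l r ∧ ρ .x = D.P l ∧ ρ .b = 0
  | .pri5 j => j = i ∧ ∃ k l r, PriInv D i v p S q ρ k l r ∧ ρ .x = D.P l ∧ ρ .b ≠ 0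
  | .init3 => i = .one ∧ ∃ k, InitInv D v p ρ k ∧ ρ .z = D.P k ∧ ρ .x = D.P (k - 1) ∧
      ρ .y = D.P (k + 1)
  | .init4 => i = .one ∧ ∃ k, InitInv D v p ρ k ∧ ρ .z = D.P k ∧
      (ρ .x = if D.P k < D.P (k - 1) then 1 else 0) ∧ ρ .y = D.P (k + 1)
  | .init5 => i = .one ∧ ∃ k, InitInv D v p ρ k ∧
      (ρ .x = if D.P k < D.P (k - 1) then 1 else 0) ∧
      (ρ .y = if D.P k < D.P (k + 1) then 1 else 0)
  | .init6 => i = .one ∧ ∃ k, InitInv D v p ρ k ∧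
      (ρ .x = if D.P k < D.P (k - 1) then 1 else 0) ∧
      (ρ .y = if D.P k < D.P (k + 1) then 1 else 0) ∧
      (ρ .t = if D.P k < D.P (k - 1) ∨ D.P k < D.P (k + 1) then 1 else 0)
  | .init7 => i = .one ∧ ∃ k, InitInv D v p ρ k ∧
      (ρ .t = if D.P k < D.P (k - 1) ∨ D.P k < D.P (k + 1) then 1 else 0) ∧
      (ρ .u = if D.P k < D.P (k - 1) ∧ D.P k < D.P (k + 1) then 1 else 0)
  | .init8 => i = .one ∧ p = 3 ∧ ∃ k, InitInv D v 2 ρ k ∧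
      (ρ .u = if D.P k < D.P (k - 1) ∧ D.P k < D.P (k + 1) then 1 else 0)
  | .while0 => i = .two ∧ ∃ k, BodyInv D v p S q ρ 1 k
  | .while1 => i = .two ∧ ∃ k l, BodyInv D v p S q ρ 1 k ∧ LeftUp D.P k l ∧ ρ .a = D.ptr l
  | .while2 => i = .two ∧ ∃ k l r, SpliceInv D v p S q ρ 1 k l r
  | .while3 => i = .two ∧ ∃ k l r, SpliceInv D v p S q ρ 1 k l r
  | .splice0 => i = .two ∧ ∃ k l r, SpliceInv D v p S q ρ 1 k l r ∧ (ρ .a ≠ 0 ∨ ρ .b ≠ 0)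
  | .splice1 => i = .two ∧ ∃ k l r, SpliceInv D v p S q ρ 1 k l r ∧ ρ .a ≠ 0
  | .splice2 => i = .two ∧ ∃ k l r, SpliceInv D v p S q ρ 2 k l r ∧ (ρ .a ≠ 0 ∨ ρ .b ≠ 0)
  | .splice3 => i = .two ∧ ∃ k l r, SpliceInv D v p S q ρ 2 k l r ∧ ρ .b ≠ 0
  | .pick0 => i = .two ∧ ∃ k l r, SpliceInv D v p S q ρ 3 k l r ∧ (ρ .a ≠ 0 ∨ ρ .b ≠ 0) ∧
      ρ .x = D.P l ∧ ρ .y = D.P r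
  | .pick1 => i = .two ∧ ∃ k l r, SpliceInv D v p S q ρ 3 k l r ∧ Parent D l r l
  | .pick2 => i = .two ∧ ∃ k l r, SpliceInv D v p S q ρ 3 k l r ∧ Parent D l r r
  | .test0 => i = .two ∧ ∃ k l r m, SpliceInv D v p S q ρ 3 k l r ∧ Parent D l r m ∧
      ρ .c' = D.ptr m
  | .test1 => i = .two ∧ p = 2 ∧ D.n ≤ v ∧ ρ .v = v ∧ (ρ .t ≠ 0 → ∃ m, 1 ≤ m ∧ m ≤ D.n ∧
      ρ .c' = D.ptr m ∧ S m = 1 ∧ q + D.f m ≤ D.h)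
  | .test2 => i = .two ∧ p = 2 ∧ D.n ≤ v ∧ ρ .v = v ∧ ∃ m, 1 ≤ m ∧ m ≤ D.n ∧
      ρ .c' = D.ptr m ∧ S m = 1 ∧ q + D.f m ≤ D.h
  | .join0 j => j = i ∧ p = 4 ∧ ρ .v = v
  | .join1 j => j = i ∧ p = 4 ∧ ρ .v = v ∧ ρ .t = 1
  | .join2 j => j = i ∧ p = 4 ∧ ρ .v = v ∧ 1 < v
  | .join3 j => j = i ∧ p = 4 ∧ ρ .v = v / 2 ∧ 1 < v
  | .join4 j => j = i ∧ (p = 5 ∧ ρ .t = 0 ∨ p = 4 ∧ ρ .t = 1 ∧ ρ .v = v)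
  | .dead => p = 5
  | .halt => i = .two ∧ p = 4

/-- The invariant of thread `t`, if it is at node `v` of the fork tree of loop `i`, in phase `p`,
and `S` gives the stages of the elements that it has worked on. -/
def ThInv (t : Thread Label Reg) : Prop :=
  t.regs .n = D.n ∧ (∀ r, t.regs r ≤ 2 * D.n) ∧ p ≤ 5 ∧
    ∃ q, (i = .one ∨ p ≠ 2 ∨ v < D.n → q = 0) ∧ q ≤ D.h ∧ t.depth + rank t.label ≤ 40 * (D.budget i v p + q) ∧
      LabInv D i v p S q t.regs t.label
end

variable {D : Layout} {i : Loop} {v p : ℕ} {S : Stages} {t : Thread Label Reg}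

/-- No thread sits at a node in phase 0 or at an inner node in phase 3. `Inv.eq_none` uses this to
show that a node to which a thread moves is vacant. -/
theorem LabInv.phase {q : ℕ} {ρ : Reg → ℕ} {l : Label} (h : LabInv D i v p S q ρ l) :
    1 ≤ p ∧ (p = 3 → D.n ≤ v) := by
  cases l <;> simp only [LabInv, PriInv, InitInv, SpliceInv, BodyInv] at h <;>
    first
    | omega
    | (obtain ⟨_, _, _, _, h, -⟩ := h
       cases i <;> simp only at h <;> omega)
    | (obtain ⟨_, _, _, _, h⟩ := h
       cases i <;> simp only at h <;> omega)

theorem ThInv.phase (h : ThInv D i v p S t) : 1 ≤ p ∧ (p = 3 → D.n ≤ v) := by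
  obtain ⟨-, -, -, q, -, -, -, h⟩ := h
  exact h.phase

theorem log_le (hv2 : v < 2 * D.n) : Nat.log 2 v ≤ Nat.log 2 (2 * D.n) :=
  Nat.log_mono_right hv2.le

/-- The iteration count `q` is nonzero only in phase 2 of the second loop, where the budget does not
yet contain `D.h`, so the height is counted once. The maximum occurs in the second loop in phase 5.
-/
theorem budget_le (hv2 : v < 2 * D.n) (hp : p ≤ 5) {q : ℕ} (hq : i = .one ∨ p ≠ 2 ∨ v < D.n → q = 0)
    (hqh : q ≤ D.h) : 40 * (D.budget i v p + q) ≤ D.maxDepth := by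
  have := log_le hv2
  unfold Layout.maxDepth
  cases i <;> simp only [Layout.budget] <;> split_ifs <;>
    rcases eq_or_ne p 2 with h | h <;> simp [h] at hq <;> omega

theorem ThInv.depth_lt (h : ThInv D i v p S t) (hv2 : v < 2 * D.n) :
    t.depth + 1 ≤ D.maxDepth := by
  obtain ⟨-, -, h5, q, hq, hqh, h, -⟩ := h
  have := budget_le hv2 h5 hq hqh
  have := rank_pos t.label
  omega

/-! ### The invariant of the computation -/

/-- Change the value of `g` at node `v` of loop `i` to `a`. -/
def upd {A : Type} (g : Loop → ℕ → A) (i : Loop) (v : ℕ) (a : A) : Loop → ℕ → A :=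
  fun j w => if j = i ∧ w = v then a else g j w

@[simp] theorem upd_same {A : Type} (g : Loop → ℕ → A) (i : Loop) (v : ℕ) (a : A) :
    upd g i v a i v = a := by simp [upd]

theorem upd_of_ne {A : Type} (g : Loop → ℕ → A) {i j : Loop} {v w : ℕ} (a : A)
    (h : ¬ (j = i ∧ w = v)) : upd g i v a j w = g j w := by simp [upd, h]

@[simp] theorem upd_of_loop_ne {A : Type} (g : Loop → ℕ → A) {i j : Loop} {v : ℕ} (a : A)
    (h : j ≠ i) : upd g i v a j = g j := by ext; simp [upd, h]

@[simp] theorem upd_of_node_ne {A : Type} (g : Loop → ℕ → A) {i j : Loop} {v w : ℕ} (a : A)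
    (h : w ≠ v) : upd g i v a j w = g j w := by simp [upd, h]

theorem upd_eq_self {A : Type} (g : Loop → ℕ → A) (i : Loop) (v : ℕ) :
    upd g i v (g i v) = g := by
  ext j w
  unfold upd
  split_ifs with h
  · rw [h.1, h.2]
  · rfl

abbrev Threads := Loop → ℕ → Option (Thread Label Reg)

/-- The sum over all nodes of the two fork trees of a quantity that depends on the phase and the
thread at the node. -/
def total {A : Type} [AddCommMonoid A] (n : ℕ) (g : ℕ → Option (Thread Label Reg) → A)
    (ph : Phases) (th : Threads) : A :=
  ∑ x ∈ ({Loop.one, Loop.two} : Finset Loop) ×ˢ Finset.Ico 1 (2 * n), g (ph x.1 x.2) (th x.1 x.2)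

theorem total_upd {A : Type} [AddCommMonoid A] {n : ℕ} (g : ℕ → Option (Thread Label Reg) → A)
    (ph : Phases) (th : Threads) (i : Loop) {v : ℕ} (hv1 : 1 ≤ v) (hv2 : v < 2 * n) (p : ℕ)
    (o : Option (Thread Label Reg)) :
    total n g (upd ph i v p) (upd th i v o) + g (ph i v) (th i v) = total n g ph th + g p o := by
  have hx : (i, v) ∈ ({Loop.one, Loop.two} : Finset Loop) ×ˢ Finset.Ico 1 (2 * n) := by
    cases i <;> simp [hv1, hv2]
  unfold total
  rw [← Finset.add_sum_erase _ _ hx, ← Finset.add_sum_erase (a := (i, v)) _ _ hx]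
  have : ∀ x ∈ (({Loop.one, Loop.two} : Finset Loop) ×ˢ Finset.Ico 1 (2 * n)).erase (i, v),
      g (upd ph i v p x.1 x.2) (upd th i v o x.1 x.2) = g (ph x.1 x.2) (th x.1 x.2) := by
    intro x hx
    have h : ¬ (x.1 = i ∧ x.2 = v) := fun h => (Finset.mem_erase.1 hx).1 (Prod.ext h.1 h.2)
    rw [upd_of_ne _ _ h, upd_of_ne _ _ h]
  rw [Finset.sum_congr rfl this]
  simp only [upd_same]
  abel

def thr : Option (Thread Label Reg) → Multiset (Thread Label Reg)
  | none => 0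
  | some t => {t}

/-- The work that remains to be done at a node. -/
def nodePot (p : ℕ) : Option (Thread Label Reg) → ℕ
  | none => 40 * (5 - p)
  | some t => 40 * (5 - p) + rank t.label

/-- The work that remains to be done for the elements in the while loop. -/
def elemPot (n : ℕ) (st : Stages) : ℕ := ∑ k ∈ Finset.Icc 1 n, 40 * (4 - st k)

theorem elemPot_update {n k : ℕ} (st : Stages) (h1 : 1 ≤ k) (h2 : k ≤ n) (s : ℕ) :
    elemPot n (Function.update st k s) + 40 * (4 - st k) = elemPot n st + 40 * (4 - s) := by
  have hk : k ∈ Finset.Icc 1 n := Finset.mem_Icc.2 ⟨h1, h2⟩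
  unfold elemPot
  rw [← Finset.add_sum_erase _ _ hk, ← Finset.add_sum_erase (a := k) _ _ hk]
  have : ∀ j ∈ (Finset.Icc 1 n).erase k, 40 * (4 - Function.update st k s j) = 40 * (4 - st j) :=
    fun j hj => by rw [Function.update_of_ne (Finset.ne_of_mem_erase hj)]
  rw [Finset.sum_congr rfl this, Function.update_self]
  omega

/-- The stages of the elements, as far as they belong to the thread at node `v` of loop `i`. -/
def owned (st : Stages) (own : ℕ → ℕ) (i : Loop) (v : ℕ) : Stages :=
  fun k => if i = .two ∧ own k = v then st k else 0

structure Glob (D : Layout) (ph : Phases) (st : Stages) (M : Mem Arr) : Prop where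
  tree : ∀ i, TreeInv D.n (ph i) (M (.sync i))
  root : ph .two 1 ≠ 0 → ph .one 1 = 5
  data : DataInv D ph st M

/-- The function `own` assigns elements to leaves of the second fork tree. Since `loc` refers only
to stages of owned elements, a step of one thread cannot invalidate what is known about another.
Each potential starts from 200 per node, for fewer than `4 n` nodes, and 160 per element, which
explains the constant 1000. -/
structure Inv (D : Layout) (c : Config Label Reg Arr) (ph : Phases) (th : Threads) (st : Stages)
    (own : ℕ → ℕ) : Prop where
  threads : c.threads = total D.n (fun _ => thr) ph th
  work : c.work + total D.n nodePot ph th + elemPot D.n st ≤ 1000 * D.n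
  span : c.span ≤ D.maxDepth
  glob : Glob D ph st c.mem
  loc : ∀ i v t, 1 ≤ v → v < 2 * D.n → th i v = some t →
    ThInv D i v (ph i v) (owned st own i v) t

/-- The configuration satisfies the invariant. -/
def Good (D : Layout) (c : Config Label Reg Arr) : Prop := ∃ ph th st own, Inv D c ph th st own

namespace Inv
variable {M M' : Mem Arr} {T : Multiset (Thread Label Reg)} {w s : ℕ} {b b' : Bool}
  {ph ph' : Phases} {th th' : Threads} {st st' : Stages} {own own' : ℕ → ℕ}

theorem exists_node (I : Inv D ⟨M, t ::ₘ T, w, s, b⟩ ph th st own) :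
    ∃ i v, 1 ≤ v ∧ v < 2 * D.n ∧ th i v = some t := by
  have h : t ∈ total D.n (fun _ => thr) ph th := by
    rw [← I.threads]
    exact Multiset.mem_cons_self _ _
  obtain ⟨⟨i, v⟩, hx, ht⟩ := Multiset.mem_sum.1 h
  rw [Finset.mem_product, Finset.mem_Ico] at hx
  refine ⟨i, v, hx.2.1, hx.2.2, ?_⟩
  dsimp only at ht
  cases h : th i v with
  | none => rw [h] at ht; simp [thr] at ht
  | some t' => rw [h] at ht; simp [thr] at ht; rw [ht]

theorem step (I : Inv D ⟨M, t ::ₘ T, w, s, b⟩ ph th st own) (hv1 : 1 ≤ v) (hv2 : v < 2 * D.n)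
    (ht : th i v = some t) {N : Multiset (Thread Label Reg)}
    (hth : total D.n (fun _ => thr) ph' th' + {t} = total D.n (fun _ => thr) ph th + N)
    (hpot : total D.n nodePot ph' th' + elemPot D.n st' + 1 ≤
      total D.n nodePot ph th + elemPot D.n st)
    (hglob : Glob D ph' st' M')
    (hloc : ∀ i v t, 1 ≤ v → v < 2 * D.n → th' i v = some t →
      ThInv D i v (ph' i v) (owned st' own' i v) t) :
    Good D ⟨M', N + T, w + 1, max s (t.depth + 1), b'⟩ := by
  refine ⟨ph', th', st', own', ?_, ?_, ?_, hglob, hloc⟩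
  · have h := I.threads
    dsimp only at h ⊢
    rw [← h, ← Multiset.singleton_add, add_assoc, add_comm, add_comm T N] at hth
    exact (add_left_cancel hth).symm
  · have := I.work
    dsimp only at this ⊢
    omega
  · exact max_le I.span ((I.loc i v t hv1 hv2 ht).depth_lt hv2)

/-- A step that changes the state of a single node. -/
theorem step_node (I : Inv D ⟨M, t ::ₘ T, w, s, b⟩ ph th st own) (hv1 : 1 ≤ v)
    (hv2 : v < 2 * D.n) (ht : th i v = some t) (p' : ℕ) (o : Option (Thread Label Reg))
    (hown : ∀ j w, ¬ (j = i ∧ w = v) → owned st' own' j w = owned st own j w)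
    (hpot : nodePot p' o + elemPot D.n st' + 1 ≤ nodePot (ph i v) (some t) + elemPot D.n st)
    (hglob : Glob D (upd ph i v p') st' M')
    (hloc : ∀ t', o = some t' → ThInv D i v p' (owned st' own' i v) t') :
    Good D ⟨M', thr o + T, w + 1, max s (t.depth + 1), b'⟩ := by
  refine I.step (ph' := upd ph i v p') (th' := upd th i v o) (own' := own') hv1 hv2 ht ?_ ?_ hglob
    ?_
  · have := total_upd (fun _ => thr) ph th i hv1 hv2 p' o
    rwa [ht] at this
  · have := total_upd nodePot ph th i hv1 hv2 p' o
    rw [ht] at this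
    omega
  · intro j w t' hw1 hw2 hj
    by_cases h : j = i ∧ w = v
    · obtain ⟨rfl, rfl⟩ := h
      rw [upd_same] at hj ⊢
      exact hloc t' hj
    · rw [upd_of_ne _ _ h] at hj ⊢
      rw [hown j w h]
      exact I.loc j w t' hw1 hw2 hj

/-- A step that changes only the state of the thread. -/
theorem step_local (I : Inv D ⟨M, t ::ₘ T, w, s, b⟩ ph th st own) (hv1 : 1 ≤ v)
    (hv2 : v < 2 * D.n) (ht : th i v = some t) (t' : Thread Label Reg)
    (hrank : rank t'.label < rank t.label)
    (hloc : ThInv D i v (ph i v) (owned st own i v) t') :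
    Good D ⟨M, {t'} + T, w + 1, max s (t.depth + 1), b'⟩ := by
  refine I.step_node (st' := st) (own' := own) hv1 hv2 ht (ph i v) (some t') (fun _ _ _ => rfl) ?_
    ?_ ?_
  · simp only [nodePot]
    omega
  · rw [upd_eq_self]
    exact I.glob
  · rintro _ ⟨rfl⟩
    exact hloc

end Inv

theorem ThInv.goto {q : ℕ} (hn : t.regs .n = D.n) (hle : ∀ r, t.regs r ≤ 2 * D.n) (hp : p ≤ 5)
    (hq : i = .one ∨ p ≠ 2 ∨ v < D.n → q = 0) (hqh : q ≤ D.h) (l : Label)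
    (hd : t.depth + 1 + rank l ≤ 40 * (D.budget i v p + q)) (h : LabInv D i v p S q t.regs l) :
    ThInv D i v p S (t.goto l) := ⟨hn, hle, hp, q, hq, hqh, hd, h⟩

theorem ThInv.set {q : ℕ} (hn : t.regs .n = D.n) (hle : ∀ r, t.regs r ≤ 2 * D.n) (hp : p ≤ 5)
    (hq : i = .one ∨ p ≠ 2 ∨ v < D.n → q = 0) (hqh : q ≤ D.h) (r : Reg) (x : ℕ) (l : Label)
    (hd : t.depth + 1 + rank l ≤ 40 * (D.budget i v p + q)) (hr : r ≠ .n) (hx : x ≤ 2 * D.n)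
    (h : LabInv D i v p S q (Function.update t.regs r x) l) :
    ThInv D i v p S (t.set r x l) := by
  refine ⟨?_, ?_, hp, q, hq, hqh, hd, h⟩
  · simp only [Thread.set]
    rw [Function.update_of_ne hr.symm, hn]
  · intro r'
    simp only [Thread.set]
    rcases eq_or_ne r' r with rfl | hne
    · rwa [Function.update_self]
    · rw [Function.update_of_ne hne]
      exact hle r'

end ListContraction

namespace ListContraction
open BinaryForking

/-! ### The steps of the program -/

/-- The configuration after a step of thread `t` satisfies the invariant. -/
def StepGood (D : Layout) (M : Mem Arr) (t : Thread Label Reg) (T : Multiset (Thread Label Reg))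
    (w s : ℕ) : Prop :=
  Good D ⟨((program t.label).exec M t).1, ((program t.label).exec M t).2.1 + T,
    w + 1, max s (t.depth + 1), ((program t.label).exec M t).2.2⟩

/-- The invariant holds, and thread `t` is at node `v` of loop `i`. -/
structure At (D : Layout) (i : Loop) (v q : ℕ) (M : Mem Arr) (t : Thread Label Reg)
    (T : Multiset (Thread Label Reg)) (w s : ℕ) (ph : Phases) (th : Threads) (st : Stages)
    (own : ℕ → ℕ) : Prop where
  inv : Inv D ⟨M, t ::ₘ T, w, s, false⟩ ph th st own
  v1 : 1 ≤ v
  v2 : v < 2 * D.n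
  th : th i v = some t
  n : t.regs .n = D.n
  le : ∀ r, t.regs r ≤ 2 * D.n
  p5 : ph i v ≤ 5
  q0 : i = .one ∨ ph i v ≠ 2 ∨ v < D.n → q = 0
  qh : q ≤ D.h
  depth : t.depth + rank t.label ≤ 40 * (D.budget i v (ph i v) + q)
  lab : LabInv D i v (ph i v) (owned st own i v) q t.regs t.label

theorem stepGood_of_at {D : Layout} {M : Mem Arr} {t : Thread Label Reg}
    {T : Multiset (Thread Label Reg)} {w s : ℕ}
    (H : Good D ⟨M, t ::ₘ T, w, s, false⟩)
    (h : ∀ i v q ph th st own, At D i v q M t T w s ph th st own → StepGood D M t T w s) :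
    StepGood D M t T w s := by
  obtain ⟨ph, th, st, own, I⟩ := H
  obtain ⟨i, v, hv1, hv2, ht⟩ := I.exists_node
  obtain ⟨h1, h2, h3, q, h4, h5, h6, h7⟩ := I.loc i v t hv1 hv2 ht
  exact h i v q ph th st own ⟨I, hv1, hv2, ht, h1, h2, h3, h4, h5, h6, h7⟩

theorem budget_mono {D : Layout} {i : Loop} {v p p' : ℕ} (hv2 : v < 2 * D.n) (h : p < p') :
    D.budget i v p + 1 ≤ D.budget i v p' := by
  have := log_le hv2
  cases i <;> simp only [Layout.budget] <;> split_ifs <;> omega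

/-- The summand `D.h` in the budget of the joining phases pays for the iterations of the while loop,
so that `q` can be reset to zero on leaving it. -/
theorem budget_two_four {D : Layout} {i : Loop} {v q p : ℕ} (hv2 : v < 2 * D.n)
    (hp : 1 ≤ p) (hp4 : p < 4) (hqh : q ≤ D.h) (hi : i = .two) :
    D.budget i v p + q + 1 ≤ D.budget i v 4 := by
  have := log_le hv2
  subst hi
  simp only [Layout.budget]
  split_ifs <;> omega

variable {D : Layout} {i : Loop} {v q : ℕ} {M M' : Mem Arr} {t : Thread Label Reg}
  {T : Multiset (Thread Label Reg)} {w s : ℕ} {ph : Phases} {th : Threads} {st : Stages}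
  {own : ℕ → ℕ}

namespace At

theorem set (A : At D i v q M t T w s ph th st own) {r : Reg} {x : ℕ} {l : Label}
    (he : (program t.label).exec M t = (M, {t.set r x l}, false))
    (hrank : rank l < rank t.label) (hr : r ≠ .n) (hx : x ≤ 2 * D.n)
    (hlab : LabInv D i v (ph i v) (owned st own i v) q (Function.update t.regs r x) l) :
    StepGood D M t T w s := by
  unfold StepGood
  rw [he]
  have hd := A.depth
  exact A.inv.step_local A.v1 A.v2 A.th _ hrank
    (ThInv.set A.n A.le A.p5 A.q0 A.qh r x l (by omega) hr hx hlab)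

theorem goto (A : At D i v q M t T w s ph th st own) {l : Label}
    (he : (program t.label).exec M t = (M, {t.goto l}, false))
    (hrank : rank l < rank t.label)
    (hlab : LabInv D i v (ph i v) (owned st own i v) q t.regs l) :
    StepGood D M t T w s := by
  unfold StepGood
  rw [he]
  have hd := A.depth
  exact A.inv.step_local A.v1 A.v2 A.th _ hrank
    (ThInv.goto A.n A.le A.p5 A.q0 A.qh l (by omega) hlab)

theorem pos (A : At D i v q M t T w s ph th st own) : 1 ≤ ph i v := A.lab.phase.1

/-- A step that ends the thread. -/
theorem vanish (A : At D i v q M t T w s ph th st own) {b : Bool}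
    (he : (program t.label).exec M t = (M, 0, b)) : StepGood D M t T w s := by
  unfold StepGood
  rw [he]
  refine A.inv.step_node (st' := st) (own' := own) A.v1 A.v2 A.th (ph i v) none
    (fun _ _ _ => rfl) ?_ ?_ (by simp)
  · have := rank_pos t.label
    simp only [nodePot]
    omega
  · rw [upd_eq_self]
    exact A.inv.glob

/-- A step that leads to another phase of the same node and does not change the stage of any
element. -/
theorem advance (A : At D i v q M t T w s ph th st own) {p' : ℕ} {t' : Thread Label Reg}
    (he : (program t.label).exec M t = (M', {t'}, false)) (hp : ph i v < p') (hp5 : p' ≤ 5)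
    (hglob : Glob D (upd ph i v p') st M')
    (hloc : ThInv D i v p' (owned st own i v) t') :
    StepGood D M t T w s := by
  unfold StepGood
  rw [he]
  refine A.inv.step_node (st' := st) (own' := own) A.v1 A.v2 A.th p' (some t')
    (fun _ _ _ => rfl) ?_ hglob ?_
  · have := rank_lt t'.label
    have := rank_pos t.label
    simp only [nodePot]
    omega
  · rintro _ ⟨rfl⟩
    exact hloc

theorem two_root (A : At D .two v q M t T w s ph th st own) : ph .two 1 ≠ 0 :=
  (A.inv.glob.tree .two).root_ne_zero v A.v1 A.v2 (by have := A.pos; omega)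

theorem one_eq_five (A : At D .two v q M t T w s ph th st own) :
    ∀ u, 1 ≤ u → u < 2 * D.n → ph .one u = 5 :=
  (A.inv.glob.tree .one).eq_five (A.inv.glob.root A.two_root)

theorem two_eq_zero (A : At D .one v q M t T w s ph th st own) (h : ph .one v ≠ 5) :
    ph .two 1 = 0 := by
  by_contra h0
  exact h ((A.inv.glob.tree .one).eq_five (A.inv.glob.root h0) v A.v1 A.v2)

end At

end ListContraction

/-! ### Steps that set up the fork trees and enter the loop bodies. -/

namespace ListContraction
open BinaryForking

variable {D : Layout} {i j : Loop} {v q : ℕ} {M M' : Mem Arr} {t : Thread Label Reg}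
  {T : Multiset (Thread Label Reg)} {w s d p' : ℕ} {ph : Phases} {th : Threads} {st : Stages}
  {own : ℕ → ℕ} {ρ : Reg → ℕ}

/-- The disjunction `h` leaves out the moves of a leaf of the first loop into phases 3 and 4 by
writing its flag and its leaf mark; `DataInv.set_flag` and `DataInv.set_leaf` treat these. -/
theorem Glob.advance (G : Glob D ph st M) (h1 : 1 ≤ ph i v) (hp : ph i v ≤ p') (hp5 : p' ≤ 5)
    (h : v < D.n ∨ i = .two ∨ p' ≤ 2 ∨ 4 ≤ ph i v)
    (hM : ∀ f, (∀ j, f ≠ .sync j) → M' f = M f) (hM2 : ∀ j, j ≠ i → M' (.sync j) = M (.sync j))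
    (htree : TreeInv D.n (upd ph i v p' i) (M' (.sync i))) : Glob D (upd ph i v p') st M' := by
  have hmono : ∀ j w, ph j w ≤ upd ph i v p' j w := by
    intro j w
    unfold upd
    split_ifs with hjw
    · rw [hjw.1, hjw.2]; exact hp
    · exact le_rfl
  have hone : ∀ w, D.n ≤ w → upd ph i v p' .one w = ph .one w ∨
      upd ph i v p' .one w ≤ 2 ∨ 4 ≤ ph .one w := by
    intro w hw
    by_cases hjw : .one = i ∧ w = v
    · obtain ⟨rfl, rfl⟩ := hjw
      rw [upd_same]
      simp at h
      omega
    · rw [upd_of_ne _ _ hjw]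
      exact .inl rfl
  refine ⟨fun j => ?_, fun h0 => ?_, ?_⟩
  · by_cases hj : j = i
    · rw [hj]; exact htree
    · rw [upd_of_loop_ne _ _ hj, hM2 j hj]
      exact G.tree j
  · have h0' : ph .two 1 ≠ 0 := by
      by_cases hjw : .two = i ∧ 1 = v
      · obtain ⟨rfl, rfl⟩ := hjw
        omega
      · rwa [upd_of_ne _ _ hjw] at h0
    have h2 := G.root h0'
    by_cases hjw : .one = i ∧ 1 = v
    · obtain ⟨rfl, rfl⟩ := hjw
      rw [upd_same]
      omega
    · rw [upd_of_ne _ _ hjw, h2]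
  · refine G.data.frame hM (fun w hw h3 => ?_) (fun w hw h3 => ?_) (fun w hw h3 => ?_) fun h0 => ?_
    · have := hone w hw; omega
    · have := hone w hw; omega
    · have := hmono .two w; omega
    · have := hmono .two 1; omega

theorem Glob.body (G : Glob D ph st M) (h1 : 1 ≤ ph i v) (hp : ph i v ≤ p') (hp4 : p' ≤ 4)
    (hv : D.n ≤ v) (h : i = .two ∨ p' ≤ 2) : Glob D (upd ph i v p') st M :=
  G.advance h1 hp (by omega) (.inr (h.imp_right .inl)) (fun _ _ => rfl) (fun _ _ => rfl)
    ((G.tree i).body hv h1 (by omega) (fun _ hw => upd_of_node_ne _ _ hw)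
      (by rw [upd_same]; omega) (by rw [upd_same]; omega))

theorem Mem.write_same (f : Arr) (a x : ℕ) : M.write f a x f a = x := by
  simp [Mem.write]

theorem Mem.write_of_ne {f g : Arr} (a x : ℕ) (h : g ≠ f) : M.write f a x g = M g := by
  simp [Mem.write, h]

theorem Mem.write_of_index_ne {f g : Arr} {a e : ℕ} (x : ℕ) (h : e ≠ a) :
    M.write f a x g e = M g e := by
  unfold Mem.write
  rcases eq_or_ne g f with rfl | hg
  · rw [Function.update_self, Function.update_of_ne h]
  · rw [Function.update_of_ne hg]

namespace At

theorem depth_next (A : At D i v q M t T w s ph th st own) {q' : ℕ} (l : Label)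
    (hb : D.budget i v (ph i v) + q + 1 ≤ D.budget i v p' + q') :
    t.depth + 1 + rank l ≤ 40 * (D.budget i v p' + q') := by
  have := A.depth
  have := rank_pos t.label
  have := rank_lt l
  omega

theorem start (A : At D i v q M ⟨.start, ρ, d⟩ T w s ph th st own) :
    StepGood D M ⟨.start, ρ, d⟩ T w s := by
  obtain ⟨rfl, rfl, hp⟩ := A.lab
  refine A.set rfl (by simp [rank]) (by simp) (by have := D.pos; omega) ⟨rfl, hp, by simp⟩

theorem spawn0 (A : At D i v q M ⟨.spawn0 j, ρ, d⟩ T w s ph th st own) :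
    StepGood D M ⟨.spawn0 j, ρ, d⟩ T w s := by
  obtain ⟨rfl, hp, hv⟩ := A.lab
  have hn := A.n
  dsimp only at hv hn
  refine A.goto (l := if ρ .v < ρ .n then .spawn1 j else .elem0 j) rfl ?_ ?_
  · split_ifs <;> simp [rank]
  · split_ifs
    · exact ⟨rfl, hp, hv, by omega⟩
    · exact ⟨rfl, hp, hv, by omega⟩

theorem spawn1 (A : At D i v q M ⟨.spawn1 j, ρ, d⟩ T w s ph th st own) :
    StepGood D M ⟨.spawn1 j, ρ, d⟩ T w s := by
  obtain ⟨rfl, hp, hv, hvn⟩ := A.lab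
  exact A.set rfl (by simp [rank]) (by simp) (by omega)
    ⟨rfl, hp, by simpa using hv, hvn, by simp⟩

theorem spawn2 (A : At D i v q M ⟨.spawn2 j, ρ, d⟩ T w s ph th st own) :
    StepGood D M ⟨.spawn2 j, ρ, d⟩ T w s := by
  obtain ⟨rfl, hp, hv, hvn, ht⟩ := A.lab
  have hq := A.q0 (.inr (.inl (by omega)))
  dsimp only at hv ht
  refine A.advance (p' := 2) rfl (by omega) (by omega) ?_
    (ThInv.goto (q := 0) A.n A.le (by omega) (by simp) (by omega) _ (A.depth_next _ ?_)
      ⟨rfl, rfl, hv, hvn⟩)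
  · dsimp only
    rw [hv, ht]
    refine A.inv.glob.advance A.pos (by omega) (by omega) (.inl hvn)
      (fun f hf => Mem.write_of_ne _ _ (hf _)) (fun j' hj' => Mem.write_of_ne _ _ (by simpa using hj'))
      ((A.inv.glob.tree j).zero_sync A.v1 hvn hp (fun _ hw => upd_of_node_ne _ _ hw)
        (upd_same _ _ _ _) (fun _ hw => Mem.write_of_index_ne _ hw) (Mem.write_same _ _ _))
  · have := budget_mono (i := j) A.v2 (show ph j v < 2 by omega)
    omega

theorem spawn3 (A : At D i v q M ⟨.spawn3 j, ρ, d⟩ T w s ph th st own) :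
    StepGood D M ⟨.spawn3 j, ρ, d⟩ T w s := by
  obtain ⟨rfl, hp, hv, hvn⟩ := A.lab
  dsimp only at hv
  refine A.set rfl (by simp [rank]) (by simp) ?_ ⟨rfl, hp, ?_, hvn⟩ <;> simp [Op.eval] <;> omega

theorem spawn5 (A : At D i v q M ⟨.spawn5 j, ρ, d⟩ T w s ph th st own) :
    StepGood D M ⟨.spawn5 j, ρ, d⟩ T w s := by
  obtain ⟨rfl, hp, hv⟩ := A.lab
  have := A.v2
  refine A.set rfl (by simp [rank]) (by simp) ?_ ⟨rfl, hp, ?_⟩ <;> simp [Op.eval] <;>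
    simp at hv <;> omega

theorem elem0 (A : At D i v q M ⟨.elem0 j, ρ, d⟩ T w s ph th st own) :
    StepGood D M ⟨.elem0 j, ρ, d⟩ T w s := by
  obtain ⟨rfl, hp, hv, hvn⟩ := A.lab
  have := A.v2
  have hn := A.n
  dsimp only at hv hn
  refine A.set rfl (by simp [rank]) (by simp) ?_ ⟨rfl, hp, ?_, hvn, ?_⟩ <;> simp [Op.eval] <;> omega

theorem elem1 (A : At D i v q M ⟨.elem1 j, ρ, d⟩ T w s ph th st own) :
    StepGood D M ⟨.elem1 j, ρ, d⟩ T w s := by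
  obtain ⟨rfl, hp, hv, hvn, hc⟩ := A.lab
  have := D.pos
  dsimp only at hv hc
  refine A.set rfl (by simp [rank]) (by simp) ?_ ⟨rfl, hp, ?_, hvn, ?_, ?_⟩ <;> (try simp) <;>
    omega

theorem elem2 (A : At D i v q M ⟨.elem2 j, ρ, d⟩ T w s ph th st own) :
    StepGood D M ⟨.elem2 j, ρ, d⟩ T w s := by
  obtain ⟨rfl, hp, hv, hvn, hc, ht⟩ := A.lab
  have hv2 := A.v2
  dsimp only at hv hc ht
  cases j with
  | one =>
    have hq := A.q0 (.inl rfl)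
    obtain ⟨k, hk1, hk2, hk⟩ := D.ptr_surj (ρ .c + ρ .t) (by omega) (by omega)
    refine A.advance (p' := 2) rfl (by omega) (by omega)
      (A.inv.glob.body A.pos (by omega) (by omega) hvn (.inr le_rfl))
      (ThInv.set (q := 0) A.n A.le (by omega) (by simp) (by omega) _ _ _ (A.depth_next _ ?_)
        (by simp) ?_ ⟨rfl, k, rfl, hvn, ?_, hk1, hk2, ?_, ?_⟩)
    · have := budget_mono (i := .one) A.v2 (show ph .one v < 2 by omega)
      omega
    · simp [Op.eval]; omega
    · simpa using hv
    · simpa [Op.eval] using hk.symm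
    · omega
  | two =>
    refine A.set rfl (by simp [rank]) (by simp) ?_ ⟨rfl, hp, ?_, hvn, ?_⟩ <;> simp [Op.eval] <;>
      omega

theorem leaf0 (A : At D i v q M ⟨.leaf0, ρ, d⟩ T w s ph th st own) :
    StepGood D M ⟨.leaf0, ρ, d⟩ T w s := by
  obtain ⟨rfl, hp, hv, hvn, hc⟩ := A.lab
  have hv2 := A.v2
  dsimp only at hv hc
  obtain ⟨k, hk1, hk2, hk⟩ := D.ptr_surj (ρ .c) (by omega) (by omega)
  have hM := A.inv.glob.data.leaf k hk1 hk2 v (by omega)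
    (by have := A.one_eq_five v A.v1 A.v2; omega)
  rw [hk] at hM
  dsimp only at hM
  refine A.set rfl (by simp [rank]) (by simp) ?_ ⟨rfl, hp, ?_, hvn, ?_, ?_⟩
  · simp only [hM]
    split_ifs <;> omega
  · simpa using hv
  · simpa using hc
  · simp only [Function.update_self, hM]
    intro h
    refine ⟨k, hk1, hk2, by simpa using hk, ?_⟩
    by_contra hl
    simp [hl] at h

theorem depth_join (A : At D i v q M t T w s ph th st own) (l : Label)
    (hp : ph i v < 4) (hi : i = .two) :
    t.depth + 1 + rank l ≤ 40 * (D.budget i v 4 + 0) :=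
  A.depth_next _ (budget_two_four A.v2 A.pos hp A.qh hi)

theorem leaf1 (A : At D i v q M ⟨.leaf1, ρ, d⟩ T w s ph th st own) :
    StepGood D M ⟨.leaf1, ρ, d⟩ T w s := by
  obtain ⟨rfl, hp, hv, hvn, hc, ht⟩ := A.lab
  dsimp only at hv hc ht
  have hq := A.q0 (.inr (.inl (by omega)))
  have hroot := A.two_root
  by_cases h0 : ρ .t = 0
  · refine A.advance (p' := 4) (t' := Thread.goto ⟨.leaf1, ρ, d⟩ (.join0 .two)) ?_ (by omega)
      (by omega) (A.inv.glob.body A.pos (by omega) (by omega) hvn (.inl rfl))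
      (ThInv.goto (q := 0) A.n A.le (by omega) (by simp) (by omega) _
        (A.depth_join _ (by omega) rfl) ⟨rfl, rfl, hv⟩)
    simp [program, Instr.exec, h0]
  · obtain ⟨k, hk1, hk2, hk, hleaf⟩ := ht h0
    have hk0 := A.inv.glob.data.leafZero k hk1 hk2 hleaf v (by omega) (by omega)
    have G := A.inv.glob.body (p' := 2) A.pos (by omega) (by omega) hvn (.inl rfl)
    unfold StepGood
    have he : (program .leaf1).exec M ⟨.leaf1, ρ, d⟩ =
        (M, {Thread.goto ⟨.leaf1, ρ, d⟩ .while0}, false) := by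
      simp [program, Instr.exec, h0]
    dsimp only
    rw [he]
    -- The thread becomes the owner of `k`. No other thread can have relied on `k`, whose stage was
    -- 0.
    refine A.inv.step_node (st' := Function.update st k 1) (own' := Function.update own k v)
      A.v1 A.v2 A.th 2 (some (Thread.goto ⟨.leaf1, ρ, d⟩ .while0)) ?_ ?_ ⟨G.tree, G.root, ?_⟩ ?_
    · intro j u hju
      ext k'
      unfold owned
      rcases eq_or_ne k' k with rfl | hne
      · simp only [Function.update_self, hk0]
        cases j <;> simp at hju ⊢
        omega
      · simp [hne]
    · have := elemPot_update (n := D.n) st hk1 hk2 1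
      simp only [nodePot, Thread.goto, rank, hp]
      omega
    · refine G.data.activate_leaf hk1 hk2 hk0 hleaf ?_ ?_
      · unfold upd
        split_ifs
        · omega
        · exact hroot
      · intro u hu
        obtain rfl : u = v := by omega
        rw [upd_same]
    · rintro _ ⟨rfl⟩
      refine ThInv.goto (q := 0) A.n A.le (by omega) (by simp) (by omega) _ (A.depth_next _ ?_)
        ⟨rfl, k, rfl, hvn, hv, hk1, hk2, hk.symm, ?_, ?_⟩
      · have := budget_mono (i := .two) A.v2 (show ph .two v < 2 by omega)
        omega
      · simp [owned]
      · have := D.f_lt k hk1 hk2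
        omega

end At
end ListContraction

/-! ### Steps that load priorities and compute the flags. -/

namespace ListContraction
open BinaryForking

variable {D : Layout} {i j : Loop} {v q : ℕ} {M M' : Mem Arr} {t : Thread Label Reg}
  {T : Multiset (Thread Label Reg)} {w s d p p' x k l r m : ℕ} {ph : Phases} {th : Threads}
  {st S : Stages} {own : ℕ → ℕ} {ρ : Reg → ℕ} {g : Reg}

theorem Layout.P_of_null (D : Layout) (hl : l ≤ D.n + 1) (h : D.ptr l = 0) : D.P l = D.n := by
  rcases Nat.eq_zero_or_pos l with rfl | h1
  · exact D.P_zero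
  · rcases hl.eq_or_lt with rfl | h2
    · exact D.P_last
    · have := D.ptr_pos l h1 (by omega)
      omega

theorem Layout.pos_of_ne_null (D : Layout) (hl : l ≤ D.n + 1) (h : D.ptr l ≠ 0) :
    1 ≤ l ∧ l ≤ D.n := by
  have h1 : l ≠ 0 := by rintro rfl; exact h D.ptr_zero
  have h2 : l ≠ D.n + 1 := by rintro rfl; exact h D.ptr_last
  omega

theorem InitInv.set (h : InitInv D v p ρ k) (hv : g ≠ .v := by decide) (hc : g ≠ .c := by decide) :
    InitInv D v p (Function.update ρ g x) k := by
  unfold InitInv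
  rw [Function.update_of_ne hv.symm, Function.update_of_ne hc.symm]
  exact h

theorem BodyInv.set (h : BodyInv D v p S q ρ s k) (hv : g ≠ .v := by decide)
    (hc : g ≠ .c := by decide) : BodyInv D v p S q (Function.update ρ g x) s k := by
  unfold BodyInv
  rw [Function.update_of_ne hv.symm, Function.update_of_ne hc.symm]
  exact h

theorem SpliceInv.set (h : SpliceInv D v p S q ρ s k l r) (hv : g ≠ .v := by decide)
    (hc : g ≠ .c := by decide) (ha : g ≠ .a := by decide) (hb : g ≠ .b := by decide) :
    SpliceInv D v p S q (Function.update ρ g x) s k l r := by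
  unfold SpliceInv
  rw [Function.update_of_ne ha.symm, Function.update_of_ne hb.symm]
  exact ⟨h.1.set hv hc, h.2⟩

theorem PriInv.set (h : PriInv D i v p S q ρ k l r) (hv : g ≠ .v := by decide)
    (hc : g ≠ .c := by decide) (ha : g ≠ .a := by decide) (hb : g ≠ .b := by decide)
    (hz : g ≠ .z := by decide) :
    PriInv D i v p S q (Function.update ρ g x) k l r := by
  cases i with
  | one =>
    simp only [PriInv] at h ⊢
    rw [Function.update_of_ne ha.symm, Function.update_of_ne hb.symm, Function.update_of_ne hz.symm]
    exact ⟨h.1.set hv hc, h.2⟩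
  | two =>
    simp only [PriInv] at h ⊢
    rw [Function.update_of_ne ha.symm, Function.update_of_ne hb.symm]
    exact ⟨h.1.set hv hc ha hb, h.2⟩

theorem PriInv.ptrs (h : PriInv D i v p S q ρ k l r) :
    l ≤ D.n + 1 ∧ r ≤ D.n + 1 ∧ ρ .a = D.ptr l ∧ ρ .b = D.ptr r := by
  cases i with
  | one =>
    obtain ⟨⟨_, _, _, _, _, _⟩, h2, h3, h4, h5, -⟩ := h
    exact ⟨by omega, by omega, h4, h5⟩
  | two =>
    obtain ⟨⟨⟨_, _, _, _, _, _⟩, h2, h3, h4, h5, h6⟩, -⟩ := h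
    have := h2.1
    exact ⟨by omega, h4, h5, h6⟩

namespace At

theorem init0 (A : At D i v q M ⟨.init0, ρ, d⟩ T w s ph th st own) :
    StepGood D M ⟨.init0, ρ, d⟩ T w s := by
  obtain ⟨rfl, k, hI⟩ := A.lab
  have h0 := A.two_eq_zero (by rw [hI.1]; omega)
  obtain ⟨-, -, -, hk1, hk2, hc, -⟩ := id hI
  have hM := A.inv.glob.data.load_prev_init hk1 hk2 h0
  rw [← hc] at hM
  dsimp only at hM
  refine A.set rfl (by simp [rank]) (by simp) ?_ ⟨rfl, k, hI.set, ?_⟩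
  · rw [hM]
    have := D.ptr_le (k - 1) (by omega)
    omega
  · rw [hM, Function.update_self]

theorem init1 (A : At D i v q M ⟨.init1, ρ, d⟩ T w s ph th st own) :
    StepGood D M ⟨.init1, ρ, d⟩ T w s := by
  obtain ⟨rfl, k, hI, ha⟩ := A.lab
  have h0 := A.two_eq_zero (by rw [hI.1]; omega)
  obtain ⟨-, -, -, hk1, hk2, hc, -⟩ := id hI
  have hM := A.inv.glob.data.load_next_init hk1 hk2 h0
  rw [← hc] at hM
  dsimp only at hM
  refine A.set rfl (by simp [rank]) (by simp) ?_ ⟨rfl, k, hI.set, ?_, ?_⟩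
  · rw [hM]
    have := D.ptr_le (k + 1) (by omega)
    omega
  · simpa using ha
  · rw [hM, Function.update_self]

theorem init2 (A : At D i v q M ⟨.init2, ρ, d⟩ T w s ph th st own) :
    StepGood D M ⟨.init2, ρ, d⟩ T w s := by
  obtain ⟨rfl, k, hI, ha, hb⟩ := A.lab
  obtain ⟨-, -, -, hk1, hk2, hc, -⟩ := id hI
  have hM := A.inv.glob.data.prio k hk1 hk2
  rw [← hc] at hM
  dsimp only at hM
  refine A.set rfl (by simp [rank]) (by simp) ?_ ⟨rfl, k, k - 1, k + 1, hI.set, by omega, rfl, ?_⟩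
  · rw [hM]
    have := D.P_le (k := k) (by omega)
    omega
  · simpa using ⟨ha, hb, hM⟩

theorem pri0 (A : At D i v q M ⟨.pri0 j, ρ, d⟩ T w s ph th st own) :
    StepGood D M ⟨.pri0 j, ρ, d⟩ T w s := by
  obtain ⟨rfl, k, l, r, hI⟩ := A.lab
  refine A.goto (l := if ρ .a = 0 then .pri1 j else .pri2 j) rfl ?_ ?_
  · split_ifs <;> simp [rank]
  · split_ifs with h
    · exact ⟨rfl, k, l, r, hI, h⟩
    · exact ⟨rfl, k, l, r, hI, h⟩

theorem pri1 (A : At D i v q M ⟨.pri1 j, ρ, d⟩ T w s ph th st own) :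
    StepGood D M ⟨.pri1 j, ρ, d⟩ T w s := by
  obtain ⟨rfl, k, l, r, hI, ha⟩ := A.lab
  have hn := A.n
  obtain ⟨hl, hr, h1, h2⟩ := hI.ptrs
  dsimp only at hn ha h1 h2
  refine A.set rfl (by simp [rank]) (by simp) (by dsimp only; omega) ⟨rfl, k, l, r, hI.set, ?_⟩
  rw [Function.update_self, D.P_of_null hl (by omega)]
  exact hn

theorem pri2 (A : At D i v q M ⟨.pri2 j, ρ, d⟩ T w s ph th st own) :
    StepGood D M ⟨.pri2 j, ρ, d⟩ T w s := by
  obtain ⟨rfl, k, l, r, hI, ha⟩ := A.lab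
  obtain ⟨hl, hr, h1, h2⟩ := hI.ptrs
  dsimp only at ha h1 h2
  have hl' := D.pos_of_ne_null hl (by omega)
  have hM := A.inv.glob.data.prio l hl'.1 hl'.2
  rw [← h1] at hM
  dsimp only at hM
  refine A.set rfl (by simp [rank]) (by simp) ?_ ⟨rfl, k, l, r, hI.set, ?_⟩
  · rw [hM]
    have := D.P_le hl
    omega
  · rw [Function.update_self, hM]

theorem pri3 (A : At D i v q M ⟨.pri3 j, ρ, d⟩ T w s ph th st own) :
    StepGood D M ⟨.pri3 j, ρ, d⟩ T w s := by
  obtain ⟨rfl, k, l, r, hI, hx⟩ := A.lab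
  refine A.goto (l := if ρ .b = 0 then .pri4 j else .pri5 j) rfl ?_ ?_
  · split_ifs <;> simp [rank]
  · split_ifs with h
    · exact ⟨rfl, k, l, r, hI, hx, h⟩
    · exact ⟨rfl, k, l, r, hI, hx, h⟩

theorem pri4 (A : At D i v q M ⟨.pri4 j, ρ, d⟩ T w s ph th st own) :
    StepGood D M ⟨.pri4 j, ρ, d⟩ T w s := by
  obtain ⟨rfl, k, l, r, hI, hx, hb⟩ := A.lab
  have hn := A.n
  obtain ⟨hl, hr, h1, h2⟩ := hI.ptrs
  dsimp only at hn hx hb h1 h2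
  have hP := D.P_of_null hr (by omega)
  cases j with
  | one =>
    obtain ⟨hI, rfl, rfl, -, -, hz⟩ := hI
    refine A.set rfl (by simp [rank]) (by simp) (by dsimp only; omega)
      ⟨rfl, l + 1, hI.set, by simpa using hz, by simpa using hx, ?_⟩
    rw [Function.update_self, hP]
    exact hn
  | two =>
    refine A.set rfl (by simp [rank]) (by simp) (by dsimp only; omega)
      ⟨rfl, k, l, r, hI.1.set, by simpa using hI.2, by simpa using hx, ?_⟩
    rw [Function.update_self, hP]
    exact hn

theorem pri5 (A : At D i v q M ⟨.pri5 j, ρ, d⟩ T w s ph th st own) :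
    StepGood D M ⟨.pri5 j, ρ, d⟩ T w s := by
  obtain ⟨rfl, k, l, r, hI, hx, hb⟩ := A.lab
  obtain ⟨hl, hr, h1, h2⟩ := hI.ptrs
  dsimp only at hx hb h1 h2
  have hr' := D.pos_of_ne_null hr (by omega)
  have hM := A.inv.glob.data.prio r hr'.1 hr'.2
  rw [← h2] at hM
  dsimp only at hM
  have hle := D.P_le hr
  cases j with
  | one =>
    obtain ⟨hI, rfl, rfl, -, -, hz⟩ := hI
    exact A.set rfl (by simp [rank]) (by simp) (by rw [hM]; omega)
      ⟨rfl, l + 1, hI.set, by simpa using hz, by simpa using hx, by rw [Function.update_self, hM]⟩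
  | two =>
    exact A.set rfl (by simp [rank]) (by simp) (by rw [hM]; omega)
      ⟨rfl, k, l, r, hI.1.set, by simpa using hI.2, by simpa using hx,
        by rw [Function.update_self, hM]⟩

theorem init3 (A : At D i v q M ⟨.init3, ρ, d⟩ T w s ph th st own) :
    StepGood D M ⟨.init3, ρ, d⟩ T w s := by
  obtain ⟨rfl, k, hI, hz, hx, hy⟩ := A.lab
  have := D.pos
  dsimp only at hz hx hy
  refine A.set rfl (by simp [rank]) (by simp) ?_ ⟨rfl, k, hI.set, ?_, ?_, ?_⟩
  · simp only [Op.eval]; split_ifs <;> omega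
  · simpa using hz
  · simp [Op.eval, hz, hx]
  · simpa using hy

theorem init4 (A : At D i v q M ⟨.init4, ρ, d⟩ T w s ph th st own) :
    StepGood D M ⟨.init4, ρ, d⟩ T w s := by
  obtain ⟨rfl, k, hI, hz, hx, hy⟩ := A.lab
  have := D.pos
  dsimp only at hz hx hy
  refine A.set rfl (by simp [rank]) (by simp) ?_ ⟨rfl, k, hI.set, ?_, ?_⟩
  · simp only [Op.eval]; split_ifs <;> omega
  · simpa using hx
  · simp [Op.eval, hz, hy]

theorem init5 (A : At D i v q M ⟨.init5, ρ, d⟩ T w s ph th st own) :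
    StepGood D M ⟨.init5, ρ, d⟩ T w s := by
  obtain ⟨rfl, k, hI, hx, hy⟩ := A.lab
  have := D.pos
  dsimp only at hx hy
  have he : Op.or.eval (ρ .x) (ρ .y) =
      if D.P k < D.P (k - 1) ∨ D.P k < D.P (k + 1) then 1 else 0 := by
    rw [hx, hy]
    by_cases h1 : D.P k < D.P (k - 1) <;> by_cases h2 : D.P k < D.P (k + 1) <;>
      simp [h1, h2, Op.eval]
  refine A.set rfl (by simp [rank]) (by simp) ?_ ⟨rfl, k, hI.set, ?_, ?_, ?_⟩
  · simp only [he]; split_ifs <;> omega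
  · simpa using hx
  · simpa using hy
  · simpa using he

theorem init6 (A : At D i v q M ⟨.init6, ρ, d⟩ T w s ph th st own) :
    StepGood D M ⟨.init6, ρ, d⟩ T w s := by
  obtain ⟨rfl, k, hI, hx, hy, ht⟩ := A.lab
  have := D.pos
  dsimp only at hx hy ht
  have he : Op.and.eval (ρ .x) (ρ .y) =
      if D.P k < D.P (k - 1) ∧ D.P k < D.P (k + 1) then 1 else 0 := by
    rw [hx, hy]
    by_cases h1 : D.P k < D.P (k - 1) <;> by_cases h2 : D.P k < D.P (k + 1) <;>
      simp [h1, h2, Op.eval]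
  refine A.set rfl (by simp [rank]) (by simp) ?_ ⟨rfl, k, hI.set, ?_, ?_⟩
  · simp only [he]; split_ifs <;> omega
  · simpa using ht
  · simpa using he

theorem init7 (A : At D i v q M ⟨.init7, ρ, d⟩ T w s ph th st own) :
    StepGood D M ⟨.init7, ρ, d⟩ T w s := by
  obtain ⟨rfl, k, hI, ht, hu⟩ := A.lab
  obtain ⟨hp, hvn, hv, hk1, hk2, hc, hvk⟩ := id hI
  have h0 := A.two_eq_zero (by omega)
  have hq := A.q0 (.inl rfl)
  dsimp only at ht hc
  refine A.advance (p' := 3) rfl (by omega) (by omega) ⟨?_, ?_, ?_⟩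
    (ThInv.goto (q := 0) A.n A.le (by omega) (by simp) (by omega) _ (A.depth_next _ ?_)
      ⟨rfl, rfl, k, ⟨rfl, hI.2⟩, hu⟩)
  · intro j
    rw [Mem.write_of_ne _ _ (by simp)]
    cases j with
    | one =>
      exact (A.inv.glob.tree .one).body hvn A.pos (by omega)
        (fun _ hw => upd_of_node_ne _ _ hw) (by rw [upd_same]; omega) (by rw [upd_same]; omega)
    | two => rw [upd_of_loop_ne _ _ (by simp)]; exact A.inv.glob.tree .two
  · rw [upd_of_loop_ne _ _ (by simp), h0]
    simp
  · refine A.inv.glob.data.set_flag hk1 hk2 h0 hvk (fun f hf => Mem.write_of_ne _ _ hf) ?_ ?_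
      (fun u hu => upd_of_node_ne _ _ hu) (upd_same _ _ _ _) (upd_of_loop_ne _ _ (by simp))
    · intro j hj1 hj2 hjk
      refine Mem.write_of_index_ne _ fun e => hjk (D.ptr_inj j k hj1 hj2 hk1 hk2 ?_)
      rw [e]
      exact hc
    · dsimp only
      rw [hc, Mem.write_same, ht]
  · have := budget_mono (i := .one) A.v2 (show ph .one v < 3 by omega)
    omega

theorem init8 (A : At D i v q M ⟨.init8, ρ, d⟩ T w s ph th st own) :
    StepGood D M ⟨.init8, ρ, d⟩ T w s := by
  obtain ⟨rfl, hp, k, hI, hu⟩ := A.lab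
  obtain ⟨-, hvn, hv, hk1, hk2, hc, hvk⟩ := id hI
  have h0 := A.two_eq_zero (by omega)
  have hq := A.q0 (.inl rfl)
  dsimp only at hu hc
  refine A.advance (p' := 4) rfl (by omega) (by omega) ⟨?_, ?_, ?_⟩
    (ThInv.goto (q := 0) A.n A.le (by omega) (by simp) (by omega) _ (A.depth_next _ ?_)
      ⟨rfl, rfl, hv⟩)
  · intro j
    rw [Mem.write_of_ne _ _ (by simp)]
    cases j with
    | one =>
      exact (A.inv.glob.tree .one).body hvn A.pos (by omega)
        (fun _ hw => upd_of_node_ne _ _ hw) (by rw [upd_same]; omega) (by rw [upd_same])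
    | two => rw [upd_of_loop_ne _ _ (by simp)]; exact A.inv.glob.tree .two
  · rw [upd_of_loop_ne _ _ (by simp), h0]
    simp
  · refine A.inv.glob.data.set_leaf hk1 hk2 hvk (fun f hf => Mem.write_of_ne _ _ hf) ?_ ?_
      (fun u hu => upd_of_node_ne _ _ hu) hp.ge (upd_of_loop_ne _ _ (by simp))
    · intro j hj1 hj2 hjk
      refine Mem.write_of_index_ne _ fun e => hjk (D.ptr_inj j k hj1 hj2 hk1 hk2 ?_)
      rw [e]
      exact hc
    · dsimp only
      rw [hc, Mem.write_same, hu]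
  · have := budget_mono (i := .one) A.v2 (show ph .one v < 4 by omega)
    omega

end At
end ListContraction

/-! ### Steps that move threads between nodes of the fork trees. -/

namespace ListContraction
open BinaryForking

variable {D : Layout} {i j : Loop} {u v q : ℕ} {M M' : Mem Arr} {t : Thread Label Reg}
  {T : Multiset (Thread Label Reg)} {w s d p p' x k l r m : ℕ} {ph : Phases} {th : Threads}
  {st S : Stages} {own : ℕ → ℕ} {ρ : Reg → ℕ} {g : Reg}

theorem owned_eq {s : ℕ} (h : owned st own i v k = s) (hs : s ≠ 0) :
    st k = s ∧ i = .two ∧ own k = v := by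
  unfold owned at h
  split_ifs at h with hi
  · exact ⟨h, hi⟩
  · exact absurd h.symm hs

theorem Inv.eq_none {c : Config Label Reg Arr} (I : Inv D c ph th st own) (h1 : 1 ≤ v)
    (h2 : v < 2 * D.n) (h : ph i v = 0 ∨ ph i v = 3 ∧ v < D.n) : th i v = none := by
  cases ht : th i v with
  | none => rfl
  | some t =>
    have := (I.loc i v t h1 h2 ht).phase
    omega

namespace At

/-- A step with which the thread moves to another node. -/
theorem move (A : At D i v q M t T w s ph th st own) {t' : Thread Label Reg} {p'' : ℕ}
    (he : (program t.label).exec M t = (M, {t'}, false)) (hu1 : 1 ≤ u) (hu2 : u < 2 * D.n)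
    (hne : ¬ (j = i ∧ u = v)) (hnone : th j u = none)
    (hp : p' > ph i v) (hp5 : p' ≤ 5) (hp'' : ph j u < p'') (hp''5 : p'' ≤ 5)
    (hglob : Glob D (upd (upd ph i v p') j u p'') st M)
    (hloc : ThInv D j u p'' (owned st own j u) t') :
    StepGood D M t T w s := by
  unfold StepGood
  rw [he]
  refine A.inv.step (ph' := upd (upd ph i v p') j u p'')
    (th' := upd (upd th i v none) j u (some t')) (own' := own) A.v1 A.v2 A.th ?_ ?_ hglob ?_
  · have h1 := total_upd (fun _ => thr) ph th i A.v1 A.v2 p' none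
    have h2 := total_upd (fun _ => thr) (upd ph i v p') (upd th i v none) j hu1 hu2 p'' (some t')
    rw [A.th] at h1
    rw [upd_of_ne _ _ hne, hnone] at h2
    simp only [thr, add_zero] at h1 h2
    rw [h2, ← h1]
    abel
  · have h1 := total_upd nodePot ph th i A.v1 A.v2 p' none
    have h2 := total_upd nodePot (upd ph i v p') (upd th i v none) j hu1 hu2 p'' (some t')
    rw [A.th] at h1
    rw [upd_of_ne _ _ hne, upd_of_ne _ _ hne, hnone] at h2
    have := rank_lt t'.label
    simp only [nodePot] at h1 h2
    omega
  · intro a b t1 hb1 hb2 hab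
    by_cases h : a = j ∧ b = u
    · obtain ⟨rfl, rfl⟩ := h
      rw [upd_same] at hab ⊢
      obtain rfl := Option.some.inj hab
      exact hloc
    · rw [upd_of_ne _ _ h] at hab ⊢
      by_cases h' : a = i ∧ b = v
      · obtain ⟨rfl, rfl⟩ := h'
        rw [upd_same] at hab
        cases hab
      · rw [upd_of_ne _ _ h'] at hab ⊢
        exact A.inv.loc a b t1 hb1 hb2 hab

theorem spawn4 (A : At D i v q M ⟨.spawn4 j, ρ, d⟩ T w s ph th st own) :
    StepGood D M ⟨.spawn4 j, ρ, d⟩ T w s := by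
  obtain ⟨rfl, hp, hv, hvn⟩ := A.lab
  have hq := A.q0 (.inr (.inr hvn))
  have hd := A.depth
  have hv1 := A.v1
  dsimp only at hv hd
  have hidle := (A.inv.glob.tree j v A.v1 hvn).1 (by omega)
  have hn0 := A.inv.eq_none (i := j) (v := 2 * v) (by omega) (by omega) (.inl hidle.1)
  have hn1 := A.inv.eq_none (i := j) (v := 2 * v + 1) (by omega) (by omega) (.inl hidle.2)
  have ha : ¬ (j = j ∧ 2 * v = v) := by omega
  have hb : ¬ (j = j ∧ 2 * v + 1 = 2 * v) := by omega
  have hc : ¬ (j = j ∧ 2 * v + 1 = v) := by omega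
  have hlog : Nat.log 2 (2 * v) = Nat.log 2 v + 1 := by
    rw [mul_comm]; exact Nat.log_mul_base (by omega) (by omega)
  have hlog' : Nat.log 2 (2 * v + 1) = Nat.log 2 v + 1 := by
    rw [← hlog, Nat.log_of_one_lt_of_le (by omega) (by omega : 2 ≤ 2 * v + 1),
      Nat.log_of_one_lt_of_le (by omega) (by omega : 2 ≤ 2 * v)]
    congr 2
    omega
  -- Descending one level adds 3 to the budget, which exceeds the drop from phase 2 to phase 1.
  have hbud : ∀ u, Nat.log 2 u = Nat.log 2 v + 1 →
      D.budget j v (ph j v) + q + 1 ≤ D.budget j u 1 + 0 := by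
    intro u hu
    rw [hp, hq]
    cases j <;> simp only [Layout.budget, hu] <;> split_ifs <;> omega
  have hdep : ∀ u, Nat.log 2 u = Nat.log 2 v + 1 →
      d + 1 + rank (.spawn5 j) ≤ 40 * (D.budget j u 1 + 0) := by
    intro u hu
    have := hbud u hu
    have := rank_pos (.spawn4 j)
    have := rank_lt (.spawn5 j)
    omega
  unfold StepGood
  let t0 := Thread.set ⟨Label.spawn4 j, ρ, d⟩ .t 0 (.spawn5 j)
  let t1 := Thread.set ⟨Label.spawn4 j, ρ, d⟩ .t 1 (.spawn5 j)
  refine A.inv.step (ph' := upd (upd (upd ph j v 3) j (2 * v) 1) j (2 * v + 1) 1)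
    (th' := upd (upd (upd th j v none) j (2 * v) (some t0)) j (2 * v + 1) (some t1)) (own' := own)
    (st' := st) (N := {t0, t1}) A.v1 A.v2 A.th ?_ ?_ ⟨?_, ?_, ?_⟩ ?_
  · have h1 := total_upd (fun _ => thr) ph th j A.v1 A.v2 3 none
    have h2 := total_upd (fun _ => thr) (upd ph j v 3) (upd th j v none) j
      (n := D.n) (v := 2 * v) (by omega) (by omega) 1 (some t0)
    have h3 := total_upd (fun _ => thr) (upd (upd ph j v 3) j (2 * v) 1)
      (upd (upd th j v none) j (2 * v) (some t0)) j (n := D.n) (v := 2 * v + 1) (by omega) (by omega) 1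
      (some t1)
    rw [A.th] at h1
    rw [upd_of_ne _ _ ha, hn0] at h2
    rw [upd_of_ne _ _ hb, upd_of_ne _ _ hc, hn1] at h3
    simp only [thr, add_zero] at h1 h2 h3
    rw [h3, h2, ← h1, Multiset.insert_eq_cons, ← Multiset.singleton_add]
    abel
  · have h1 := total_upd nodePot ph th j A.v1 A.v2 3 none
    have h2 := total_upd nodePot (upd ph j v 3) (upd th j v none) j
      (n := D.n) (v := 2 * v) (by omega) (by omega) 1 (some t0)
    have h3 := total_upd nodePot (upd (upd ph j v 3) j (2 * v) 1)
      (upd (upd th j v none) j (2 * v) (some t0)) j (n := D.n) (v := 2 * v + 1) (by omega) (by omega) 1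
      (some t1)
    rw [A.th] at h1
    rw [upd_of_ne _ _ ha, upd_of_ne _ _ ha, hn0, hidle.1] at h2
    rw [upd_of_ne _ _ hb, upd_of_ne _ _ hb, upd_of_ne _ _ hc, upd_of_ne _ _ hc, hn1, hidle.2] at h3
    -- The children leave phase 0, which releases 80 units of potential and pays for two threads of
    -- rank 38.
    have r0 : rank t0.label = 38 := rfl
    have r1 : rank t1.label = 38 := rfl
    simp only [nodePot, hp, r0, r1] at h1 h2 h3
    omega
  · intro a
    show TreeInv D.n _ (M _)
    by_cases haj : a = j
    · subst haj
      refine (A.inv.glob.tree a).fork A.v1 hvn hp (fun u h1 h2 h3 => ?_) ?_ ?_ ?_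
      · rw [upd_of_node_ne _ _ h3, upd_of_node_ne _ _ h2, upd_of_node_ne _ _ h1]
      · rw [upd_of_node_ne _ _ (by omega), upd_of_node_ne _ _ (by omega), upd_same]
      · rw [upd_of_node_ne _ _ (by omega), upd_same]
      · rw [upd_same]
    · rw [upd_of_loop_ne _ _ haj, upd_of_loop_ne _ _ haj, upd_of_loop_ne _ _ haj]
      exact A.inv.glob.tree a
  · cases j with
    | one =>
      have := A.two_eq_zero (by omega)
      simp [this]
    | two =>
      rw [upd_of_loop_ne (j := .one) _ _ (by simp), upd_of_loop_ne (j := .one) _ _ (by simp),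
        upd_of_loop_ne (j := .one) _ _ (by simp)]
      exact fun _ => A.inv.glob.root A.two_root
  · have hcase : ∀ a u, upd (upd (upd ph j v 3) j (2 * v) 1) j (2 * v + 1) 1 a u = ph a u ∨
        a = j ∧ (u = v ∧ upd (upd (upd ph j v 3) j (2 * v) 1) j (2 * v + 1) 1 a u = 3 ∨
          upd (upd (upd ph j v 3) j (2 * v) 1) j (2 * v + 1) 1 a u = 1 ∧ ph a u = 0) := by
      intro a u
      by_cases h1 : a = j ∧ u = 2 * v + 1
      · obtain ⟨rfl, rfl⟩ := h1
        rw [upd_same]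
        exact .inr ⟨rfl, .inr ⟨rfl, hidle.2⟩⟩
      · rw [upd_of_ne _ _ h1]
        by_cases h2 : a = j ∧ u = 2 * v
        · obtain ⟨rfl, rfl⟩ := h2
          rw [upd_same]
          exact .inr ⟨rfl, .inr ⟨rfl, hidle.1⟩⟩
        · rw [upd_of_ne _ _ h2]
          by_cases h3 : a = j ∧ u = v
          · obtain ⟨rfl, rfl⟩ := h3
            rw [upd_same]
            exact .inr ⟨rfl, .inl ⟨rfl, rfl⟩⟩
          · rw [upd_of_ne _ _ h3]
            exact .inl rfl
    refine A.inv.glob.data.frame (fun _ _ => rfl) (fun u hu h => ?_) (fun u hu h => ?_)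
      (fun u hu h => ?_) fun h => ?_
    · have := hcase .one u; omega
    · have := hcase .one u; omega
    · have := hcase .two u; omega
    · have := hcase .two 1; omega
  · intro a b t' hb1 hb2 hab
    by_cases h1 : a = j ∧ b = 2 * v + 1
    · obtain ⟨rfl, rfl⟩ := h1
      rw [upd_same] at hab ⊢
      obtain rfl := Option.some.inj hab
      exact ThInv.set (q := 0) A.n A.le (by omega) (by simp) (by omega) _ _ _ (hdep _ hlog')
        (by simp) (by have := D.pos; omega) ⟨rfl, rfl, by simpa using hv⟩
    · rw [upd_of_ne _ _ h1] at hab ⊢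
      by_cases h2 : a = j ∧ b = 2 * v
      · obtain ⟨rfl, rfl⟩ := h2
        rw [upd_same] at hab ⊢
        obtain rfl := Option.some.inj hab
        exact ThInv.set (q := 0) A.n A.le (by omega) (by simp) (by omega) _ _ _ (hdep _ hlog)
          (by simp) (by omega) ⟨rfl, rfl, by simpa using hv⟩
      · rw [upd_of_ne _ _ h2] at hab ⊢
        by_cases h3 : a = j ∧ b = v
        · obtain ⟨rfl, rfl⟩ := h3
          rw [upd_same] at hab
          cases hab
        · rw [upd_of_ne _ _ h3] at hab ⊢
          exact A.inv.loc a b t' hb1 hb2 hab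

theorem join0 (A : At D i v q M ⟨.join0 j, ρ, d⟩ T w s ph th st own) :
    StepGood D M ⟨.join0 j, ρ, d⟩ T w s := by
  obtain ⟨rfl, hp, hv⟩ := A.lab
  have := D.pos
  exact A.set rfl (by simp [rank]) (by simp) (by omega)
    ⟨rfl, hp, by simpa using hv, by simp⟩

theorem join1 (A : At D i v q M ⟨.join1 j, ρ, d⟩ T w s ph th st own) :
    StepGood D M ⟨.join1 j, ρ, d⟩ T w s := by
  obtain ⟨rfl, hp, hv, ht⟩ := A.lab
  have hv1 := A.v1
  dsimp only at hv ht
  by_cases h : 1 < v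
  · refine A.goto (l := .join2 j) ?_ (by simp [rank]) ⟨rfl, hp, hv, h⟩
    cases j <;> simp [program, Instr.exec, hv, ht, h]
  · obtain rfl : v = 1 := by omega
    cases j with
    | two =>
      refine A.goto (l := .halt) ?_ (by simp [rank]) ⟨rfl, hp⟩
      simp [program, Instr.exec, hv, ht]
    | one =>
      have h0 := A.two_eq_zero (by omega)
      have hq := A.q0 (.inl rfl)
      have hd := A.depth
      refine A.move (t' := Thread.goto ⟨.join1 .one, ρ, d⟩ (.spawn0 .two)) (j := .two) (u := 1)
        (p' := 5) (p'' := 1) ?_ le_rfl A.v2 (by simp)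
        (A.inv.eq_none le_rfl A.v2 (.inl h0)) (by omega) (by omega) (by omega) (by omega)
        ⟨fun a => ?_, fun _ => ?_, ?_⟩
        (ThInv.goto (q := 0) A.n A.le (by omega) (by simp) (by omega) _ ?_ ⟨rfl, rfl, hv⟩)
      · simp [program, Instr.exec, hv, ht]
      · cases a with
        | one =>
          rw [upd_of_loop_ne _ _ (by simp)]
          exact (A.inv.glob.tree .one).root (fun _ hw => upd_of_node_ne _ _ hw) hp (upd_same _ _ _ _)
        | two =>
          refine (A.inv.glob.tree .two).begin_root (fun u hu => ?_) h0 (upd_same _ _ _ _)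
          rw [upd_of_node_ne _ _ hu, upd_of_node_ne _ _ hu]
      · rw [upd_of_loop_ne _ _ (by simp), upd_same]
      · have h1 : ∀ u, upd (upd ph .one 1 5) .two 1 1 .one u = ph .one u ∨
            upd (upd ph .one 1 5) .two 1 1 .one u = 5 ∧ ph .one u = 4 := by
          intro u
          rw [upd_of_loop_ne _ _ (by simp)]
          rcases eq_or_ne u 1 with rfl | hu
          · rw [upd_same]
            exact .inr ⟨rfl, hp⟩
          · exact .inl (upd_of_node_ne _ _ hu)
        have h2 : ∀ u, upd (upd ph .one 1 5) .two 1 1 .two u = ph .two u ∨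
            upd (upd ph .one 1 5) .two 1 1 .two u = 1 ∧ ph .two u = 0 := by
          intro u
          rcases eq_or_ne u 1 with rfl | hu
          · rw [upd_same]
            exact .inr ⟨rfl, h0⟩
          · rw [upd_of_node_ne _ _ hu, upd_of_node_ne _ _ hu]
            exact .inl rfl
        refine A.inv.glob.data.frame (fun _ _ => rfl) (fun u hu h => ?_) (fun u hu h => ?_)
          (fun u hu h => ?_) fun h => ?_
        · have := h1 u; omega
        · have := h1 u; omega
        · have := h2 u; omega
        · omega
      -- With `L = Nat.log 2 (2 * D.n)`, the first loop ends at its root with budget `4 L + 4`, and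
      -- the second begins with `4 L + 7`.
      · simp only [hp, Layout.budget, rank, Nat.log_one_right] at hd ⊢
        norm_num at hd ⊢
        omega

theorem join2 (A : At D i v q M ⟨.join2 j, ρ, d⟩ T w s ph th st own) :
    StepGood D M ⟨.join2 j, ρ, d⟩ T w s := by
  obtain ⟨rfl, hp, hv, h⟩ := A.lab
  have := A.v2
  dsimp only at hv
  exact A.set rfl (by simp [rank]) (by simp) (by dsimp only; omega) ⟨rfl, hp, by simp [hv], h⟩

theorem join3 (A : At D i v q M ⟨.join3 j, ρ, d⟩ T w s ph th st own) :
    StepGood D M ⟨.join3 j, ρ, d⟩ T w s := by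
  obtain ⟨rfl, hp, hv, h⟩ := A.lab
  have hv2 := A.v2
  have hq := A.q0 (.inr (.inl (by omega)))
  dsimp only at hv
  have hpar := (A.inv.glob.tree j).parent h hv2 hp
  by_cases h0 : M (.sync j) (v / 2) = 0
  · refine A.advance (p' := 5) (t' := Thread.set ⟨.join3 j, ρ, d⟩ .t 0 (.join4 j))
      (M' := M.write (.sync j) (v / 2) 1) ?_ (by omega) le_rfl ?_
      (ThInv.set (q := 0) A.n A.le (by omega) (by simp) (by omega) _ _ _ (A.depth_next _ ?_)
        (by simp) (by omega) ⟨rfl, .inl ⟨rfl, by simp⟩⟩)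
    · simp [program, Instr.exec, hv, h0]
    · exact A.inv.glob.advance A.pos (by omega) le_rfl (.inr (.inr (.inr hp.ge)))
        (fun f hf => Mem.write_of_ne _ _ (hf _))
        (fun j' hj' => Mem.write_of_ne _ _ (by simpa using hj'))
        ((A.inv.glob.tree j).join_first h hv2 hp h0 (fun _ hw => upd_of_node_ne _ _ hw)
          (upd_same _ _ _ _) (fun _ hw => Mem.write_of_index_ne _ hw) (Mem.write_same _ _ _))
    · have := budget_mono (i := j) A.v2 (show ph j v < 5 by omega)
      omega
  · have hlog : Nat.log 2 v = Nat.log 2 (v / 2) + 1 := Nat.log_of_one_lt_of_le (by omega) h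
    have hcase : ∀ a u, upd (upd ph j v 5) j (v / 2) 4 a u = ph a u ∨
        a = j ∧ (u = v ∧ upd (upd ph j v 5) j (v / 2) 4 a u = 5 ∧ ph a u = 4 ∨
          u = v / 2 ∧ upd (upd ph j v 5) j (v / 2) 4 a u = 4 ∧ ph a u = 3) := by
      intro a u
      by_cases h1 : a = j ∧ u = v / 2
      · obtain ⟨rfl, rfl⟩ := h1
        rw [upd_same]
        exact .inr ⟨rfl, .inr ⟨rfl, rfl, hpar.1⟩⟩
      · rw [upd_of_ne _ _ h1]
        by_cases h2 : a = j ∧ u = v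
        · obtain ⟨rfl, rfl⟩ := h2
          rw [upd_same]
          exact .inr ⟨rfl, .inl ⟨rfl, rfl, hp⟩⟩
        · rw [upd_of_ne _ _ h2]
          exact .inl rfl
    refine A.move (t' := Thread.set ⟨.join3 j, ρ, d⟩ .t 1 (.join4 j)) (j := j) (u := v / 2)
      (p' := 5) (p'' := 4) ?_ (by omega) (by omega) (by omega)
      (A.inv.eq_none (by omega) (by omega) (.inr ⟨hpar.1, by omega⟩)) (by omega) (by omega)
      (by omega) (by omega) ⟨fun a => ?_, ?_, ?_⟩
      (ThInv.set (q := 0) A.n A.le (by omega) (by simp) (by omega) _ _ _ ?_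
        (by simp) (by omega) ⟨rfl, .inr ⟨rfl, by simp, by simpa using hv⟩⟩)
    · simp [program, Instr.exec, hv, h0]
    · by_cases ha : a = j
      · subst ha
        refine (A.inv.glob.tree a).join_second h hv2 hp h0 (fun u hu hu' => ?_) ?_
          (upd_same _ _ _ _)
        · rw [upd_of_node_ne _ _ hu', upd_of_node_ne _ _ hu]
        · rw [upd_of_node_ne _ _ (by omega), upd_same]
      · rw [upd_of_loop_ne _ _ ha, upd_of_loop_ne _ _ ha]
        exact A.inv.glob.tree a
    · cases j with
      | one =>
        have := A.two_eq_zero (by omega)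
        simp [this]
      | two =>
        rw [upd_of_loop_ne (j := .one) _ _ (by simp), upd_of_loop_ne (j := .one) _ _ (by simp)]
        exact fun _ => A.inv.glob.root A.two_root
    · refine A.inv.glob.data.frame (fun _ _ => rfl) (fun u hu h => ?_) (fun u hu h => ?_)
        (fun u hu h => ?_) fun h => ?_
      · have := hcase .one u; omega
      · have := hcase .one u; omega
      · have := hcase .two u; omega
      · have := hcase .two 1; omega
    -- Going up one level keeps phase 4 and lowers the logarithm of the node by one, so the budget
    -- grows by one.
    · have hd := A.depth
      have := log_le hv2
      cases j <;> simp only [hp, Layout.budget, rank, hlog] at hd ⊢ <;> norm_num at hd ⊢ <;> omega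

theorem join4 (A : At D i v q M ⟨.join4 j, ρ, d⟩ T w s ph th st own) :
    StepGood D M ⟨.join4 j, ρ, d⟩ T w s := by
  obtain ⟨rfl, ⟨hp, ht⟩ | ⟨hp, ht, hv⟩⟩ := A.lab
  · dsimp only at ht
    exact A.goto (l := .dead) (by simp [program, Instr.exec, ht]) (by simp [rank]) hp
  · dsimp only at ht
    exact A.goto (l := .join0 j) (by simp [program, Instr.exec, ht]) (by simp [rank]) ⟨rfl, hp, hv⟩

end At
end ListContraction

/-! ### Steps of the while loop. -/

namespace ListContraction
open BinaryForking

variable {D : Layout} {i j : Loop} {u v q : ℕ} {M M' : Mem Arr} {t : Thread Label Reg}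
  {T : Multiset (Thread Label Reg)} {w s d p p' x k l r m : ℕ} {ph : Phases} {th : Threads}
  {st S : Stages} {own : ℕ → ℕ} {ρ : Reg → ℕ} {g : Reg}

theorem BodyInv.mono {S' : Stages} {q' s' : ℕ} (h : BodyInv D v p S q ρ s k) (hS : S' k = s')
    (hq : q' ≤ q) : BodyInv D v p S' q' ρ s' k := by
  obtain ⟨h1, h2, h3, h4, h5, h6, h7, h8⟩ := h
  exact ⟨h1, h2, h3, h4, h5, h6, hS, by omega⟩

theorem SpliceInv.mono {S' : Stages} {s' : ℕ} (h : SpliceInv D v p S q ρ s k l r)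
    (hS : S' k = s') : SpliceInv D v p S' q ρ s' k l r := ⟨h.1.mono hS le_rfl, h.2⟩

namespace At

/-- A step with which the element of the thread reaches the next stage. -/
theorem set_stage (A : At D i v q M t T w s ph th st own) {t' : Thread Label Reg} {s' : ℕ}
    (he : (program t.label).exec M t = (M', {t'}, false)) (hk1 : 1 ≤ k) (hk2 : k ≤ D.n)
    (hi : i = .two) (hown : own k = v) (hs : st k < s') (hs4 : s' ≤ 4)
    (hsync : ∀ j, M' (.sync j) = M (.sync j))
    (hdata : DataInv D ph (Function.update st k s') M')
    (hloc : ThInv D i v (ph i v) (owned (Function.update st k s') own i v) t') :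
    StepGood D M t T w s := by
  unfold StepGood
  rw [he]
  subst hi
  refine A.inv.step_node (st' := Function.update st k s') (own' := own) A.v1 A.v2 A.th
    (ph .two v) (some t') ?_ ?_ ?_ ?_
  · intro j u hju
    ext k'
    unfold owned
    rcases eq_or_ne k' k with rfl | hne
    · rw [hown]
      cases j <;> simp at hju ⊢
      split_ifs <;> omega
    · simp [hne]
  · have := elemPot_update (n := D.n) st hk1 hk2 s'
    have := rank_lt t'.label
    have := rank_pos t.label
    simp only [nodePot]
    omega
  · rw [upd_eq_self]
    exact ⟨fun j => by show TreeInv D.n _ (M' _); rw [hsync]; exact A.inv.glob.tree j, A.inv.glob.root, hdata⟩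
  · rintro _ ⟨rfl⟩
    exact hloc

theorem while0 (A : At D i v q M ⟨.while0, ρ, d⟩ T w s ph th st own) :
    StepGood D M ⟨.while0, ρ, d⟩ T w s := by
  obtain ⟨rfl, k, hB⟩ := A.lab
  obtain ⟨-, -, -, hk1, hk2, hc, hS, -⟩ := id hB
  obtain ⟨hst, -, -⟩ := owned_eq hS one_ne_zero
  obtain ⟨l, hl, hM⟩ := A.inv.glob.data.load_prev hk1 hk2 (by omega) (by omega)
  rw [← hc] at hM
  dsimp only at hM
  refine A.set rfl (by simp [rank]) (by simp) ?_ ⟨rfl, k, l, hB.set, hl, ?_⟩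
  · rw [hM]
    have := hl.1
    have := D.ptr_le l (by omega)
    omega
  · rw [Function.update_self, hM]

theorem while1 (A : At D i v q M ⟨.while1, ρ, d⟩ T w s ph th st own) :
    StepGood D M ⟨.while1, ρ, d⟩ T w s := by
  obtain ⟨rfl, k, l, hB, hl, ha⟩ := A.lab
  obtain ⟨-, -, -, hk1, hk2, hc, hS, -⟩ := id hB
  obtain ⟨hst, -, -⟩ := owned_eq hS one_ne_zero
  obtain ⟨r, hrn, hr, hM⟩ := A.inv.glob.data.load_next hk1 hk2 (by omega) (by omega)
  rw [← hc] at hM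
  dsimp only at hM
  refine A.set rfl (by simp [rank]) (by simp) ?_
    ⟨rfl, k, l, r, hB.set, hl, hr, hrn, by simpa using ha, ?_⟩
  · rw [hM]
    have := D.ptr_le r hrn
    omega
  · rw [Function.update_self, hM]

theorem while2 (A : At D i v q M ⟨.while2, ρ, d⟩ T w s ph th st own) :
    StepGood D M ⟨.while2, ρ, d⟩ T w s := by
  obtain ⟨rfl, k, l, r, hI⟩ := A.lab
  refine A.goto (l := if ρ .a = 0 then .while3 else .splice0) rfl ?_ ?_
  · split_ifs <;> simp [rank]
  · split_ifs with h
    · exact ⟨rfl, k, l, r, hI⟩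
    · exact ⟨rfl, k, l, r, hI, .inl h⟩

/-- The thread leaves the while loop. -/
theorem leave (A : At D .two v q M t T w s ph th st own)
    (he : (program t.label).exec M t = (M, {t.goto (.join0 .two)}, false))
    (hp : ph .two v = 2) (hvn : D.n ≤ v) (hv : t.regs .v = v) : StepGood D M t T w s :=
  A.advance (p' := 4) he (by omega) (by omega)
    (A.inv.glob.body A.pos (by omega) (by omega) hvn (.inl rfl))
    (ThInv.goto (q := 0) A.n A.le (by omega) (by simp) (by omega) _
      (A.depth_join _ (by omega) rfl) ⟨rfl, rfl, hv⟩)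

theorem while3 (A : At D i v q M ⟨.while3, ρ, d⟩ T w s ph th st own) :
    StepGood D M ⟨.while3, ρ, d⟩ T w s := by
  obtain ⟨rfl, k, l, r, hI⟩ := A.lab
  by_cases h : ρ .b = 0
  · exact A.leave (by simp [program, Instr.exec, h]) hI.1.1 hI.1.2.1 hI.1.2.2.1
  · exact A.goto (l := .splice0) (by simp [program, Instr.exec, h]) (by simp [rank])
      ⟨rfl, k, l, r, hI, .inr h⟩

theorem splice0 (A : At D i v q M ⟨.splice0, ρ, d⟩ T w s ph th st own) :
    StepGood D M ⟨.splice0, ρ, d⟩ T w s := by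
  obtain ⟨rfl, k, l, r, hI, hab⟩ := A.lab
  obtain ⟨⟨hp, hvn, hv, hk1, hk2, hc, hS, hf⟩, hl, hr, hrn, ha, hb⟩ := id hI
  obtain ⟨hst, -, hown⟩ := owned_eq hS one_ne_zero
  have hd := A.depth
  by_cases h : ρ .a = 0
  · refine A.set_stage (s' := 2) (t' := Thread.goto ⟨.splice0, ρ, d⟩ .splice2) (M' := M)
      (by simp [program, Instr.exec, h]) hk1 hk2 rfl hown (by omega) (by omega) (fun _ => rfl) ?_
      (ThInv.goto A.n A.le A.p5 A.q0 A.qh _ ?_ ⟨rfl, k, l, r, hI.mono ?_, hab⟩)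
    · refine A.inv.glob.data.set_next hk1 hk2 hst hl hr hrn (fun _ _ => rfl) fun e he1 he2 => ?_
      rw [if_neg]
      rintro rfl
      have := D.ptr_pos e he1 he2
      dsimp only at ha
      omega
    · simp only [rank] at hd ⊢
      omega
    · simp [owned, hown]
  · exact A.goto (l := .splice1) (by simp [program, Instr.exec, h]) (by simp [rank])
      ⟨rfl, k, l, r, hI, h⟩

theorem splice1 (A : At D i v q M ⟨.splice1, ρ, d⟩ T w s ph th st own) :
    StepGood D M ⟨.splice1, ρ, d⟩ T w s := by
  obtain ⟨rfl, k, l, r, hI, ha0⟩ := A.lab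
  obtain ⟨⟨hp, hvn, hv, hk1, hk2, hc, hS, hf⟩, hl, hr, hrn, ha, hb⟩ := id hI
  obtain ⟨hst, -, hown⟩ := owned_eq hS one_ne_zero
  have hd := A.depth
  dsimp only at ha hb ha0
  have hl' := D.pos_of_ne_null (by have := hl.1; omega) (ha ▸ ha0)
  refine A.set_stage (s' := 2) rfl hk1 hk2 rfl hown (by omega) (by omega)
    (fun j => Mem.write_of_ne _ _ (by simp)) ?_
    (ThInv.goto A.n A.le A.p5 A.q0 A.qh _ ?_ ⟨rfl, k, l, r, hI.mono ?_, .inl ha0⟩)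
  · refine A.inv.glob.data.set_next hk1 hk2 hst hl hr hrn (fun _ hf => Mem.write_of_ne _ _ hf)
      fun e he1 he2 => ?_
    dsimp only
    rw [ha, hb]
    split_ifs with h
    · rw [h, Mem.write_same]
    · exact Mem.write_of_index_ne _ fun h' => h (D.ptr_inj e l he1 he2 hl'.1 hl'.2 h')
  · simp only [rank] at hd ⊢
    omega
  · simp [owned, hown]

theorem splice2 (A : At D i v q M ⟨.splice2, ρ, d⟩ T w s ph th st own) :
    StepGood D M ⟨.splice2, ρ, d⟩ T w s := by
  obtain ⟨rfl, k, l, r, hI, hab⟩ := A.lab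
  obtain ⟨⟨hp, hvn, hv, hk1, hk2, hc, hS, hf⟩, hl, hr, hrn, ha, hb⟩ := id hI
  obtain ⟨hst, -, hown⟩ := owned_eq hS two_ne_zero
  have hd := A.depth
  by_cases h : ρ .b = 0
  · refine A.set_stage (s' := 3) (t' := Thread.goto ⟨.splice2, ρ, d⟩ (.pri0 .two)) (M' := M)
      (by simp [program, Instr.exec, h]) hk1 hk2 rfl hown (by omega) (by omega) (fun _ => rfl) ?_
      (ThInv.goto A.n A.le A.p5 A.q0 A.qh _ ?_ ⟨rfl, k, l, r, hI.mono ?_, hab⟩)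
    · refine A.inv.glob.data.set_prev hk1 hk2 hst hl hr (fun _ _ => rfl) fun e he1 he2 => ?_
      rw [if_neg]
      rintro rfl
      have := D.ptr_pos e he1 he2
      dsimp only at hb
      omega
    · simp only [rank] at hd ⊢
      omega
    · simp [owned, hown]
  · exact A.goto (l := .splice3) (by simp [program, Instr.exec, h]) (by simp [rank])
      ⟨rfl, k, l, r, hI, h⟩

theorem splice3 (A : At D i v q M ⟨.splice3, ρ, d⟩ T w s ph th st own) :
    StepGood D M ⟨.splice3, ρ, d⟩ T w s := by
  obtain ⟨rfl, k, l, r, hI, hb0⟩ := A.lab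
  obtain ⟨⟨hp, hvn, hv, hk1, hk2, hc, hS, hf⟩, hl, hr, hrn, ha, hb⟩ := id hI
  obtain ⟨hst, -, hown⟩ := owned_eq hS two_ne_zero
  have hd := A.depth
  dsimp only at ha hb hb0
  have hr' := D.pos_of_ne_null hrn (hb ▸ hb0)
  refine A.set_stage (s' := 3) rfl hk1 hk2 rfl hown (by omega) (by omega)
    (fun j => Mem.write_of_ne _ _ (by simp)) ?_
    (ThInv.goto A.n A.le A.p5 A.q0 A.qh _ ?_ ⟨rfl, k, l, r, hI.mono ?_, .inr hb0⟩)
  · refine A.inv.glob.data.set_prev hk1 hk2 hst hl hr (fun _ hf => Mem.write_of_ne _ _ hf)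
      fun e he1 he2 => ?_
    dsimp only
    rw [ha, hb]
    split_ifs with h
    · rw [h, Mem.write_same]
    · exact Mem.write_of_index_ne _ fun h' => h (D.ptr_inj e r he1 he2 hr'.1 hr'.2 h')
  · simp only [rank] at hd ⊢
    omega
  · simp [owned, hown]

theorem pick0 (A : At D i v q M ⟨.pick0, ρ, d⟩ T w s ph th st own) :
    StepGood D M ⟨.pick0, ρ, d⟩ T w s := by
  obtain ⟨rfl, k, l, r, hI, hab, hx, hy⟩ := A.lab
  obtain ⟨⟨hp, hvn, hv, hk1, hk2, hc, hS, hf⟩, hl, hr, hrn, ha, hb⟩ := id hI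
  dsimp only at hx hy ha hb hab
  have h1 := hl.1
  have h2 := hr.1
  have h3 := D.P_zero
  have h4 := D.P_last
  have h5 := D.P_le hrn
  have h6 := D.P_le (k := l) (by omega)
  refine A.goto (l := if ρ .x < ρ .y then .pick1 else .pick2) rfl ?_ ?_
  · split_ifs <;> simp [rank]
  · split_ifs with h
    · refine ⟨rfl, k, l, r, hI, Nat.pos_of_ne_zero ?_, by omega, .inl ⟨rfl, by omega⟩⟩
      rintro rfl
      omega
    -- Distinct positions tie only if both are sentinels, and then both pointers would be null.
    · have hne : D.P l ≠ D.P r := by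
        intro e
        by_cases hrn' : r = D.n + 1
        · subst hrn'
          have : l = 0 := by
            by_contra hl0
            have := D.P_lt l (by omega) (by omega)
            omega
          subst this
          rw [D.ptr_zero] at ha
          rw [D.ptr_last] at hb
          omega
        · exact D.P_ne l r (by omega) (by omega) (by omega) (by omega) e
      refine ⟨rfl, k, l, r, hI, by omega, ?_, .inr ⟨rfl, by omega⟩⟩
      by_contra hrn'
      obtain rfl : r = D.n + 1 := by omega
      omega

theorem pick1 (A : At D i v q M ⟨.pick1, ρ, d⟩ T w s ph th st own) :
    StepGood D M ⟨.pick1, ρ, d⟩ T w s := by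
  obtain ⟨rfl, k, l, r, hI, hm⟩ := A.lab
  have ha := hI.2.2.2.2.1
  have := D.ptr_le l (by have := hm.2.1; omega)
  dsimp only at ha
  exact A.set rfl (by simp [rank]) (by simp) (by dsimp only; omega)
    ⟨rfl, k, l, r, l, hI.set, hm, by simpa using ha⟩

theorem pick2 (A : At D i v q M ⟨.pick2, ρ, d⟩ T w s ph th st own) :
    StepGood D M ⟨.pick2, ρ, d⟩ T w s := by
  obtain ⟨rfl, k, l, r, hI, hm⟩ := A.lab
  have hb := hI.2.2.2.2.2
  have := D.ptr_le r (by have := hm.2.1; omega)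
  dsimp only at hb
  exact A.set rfl (by simp [rank]) (by simp) (by dsimp only; omega)
    ⟨rfl, k, l, r, r, hI.set, hm, by simpa using hb⟩

theorem test0 (A : At D i v q M ⟨.test0, ρ, d⟩ T w s ph th st own) :
    StepGood D M ⟨.test0, ρ, d⟩ T w s := by
  obtain ⟨rfl, k, l, r, m, hI, hm, hc'⟩ := A.lab
  obtain ⟨⟨hp, hvn, hv, hk1, hk2, hc, hS, hf⟩, hl, hr, hrn, ha, hb⟩ := id hI
  obtain ⟨hst, -, hown⟩ := owned_eq hS three_ne_zero
  have hd := A.depth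
  have hfm := D.f_parent hl hr hm
  have hn := D.pos
  dsimp only at hc' hd hv
  simp only [rank] at hd
  by_cases h : M .flag (D.ptr m) = 0
  -- The test-and-set counts as the end of an iteration: `q` grows by one, which allows the rank to
  -- rise from 18 to 35. The bound `q + 1 ≤ D.h` holds because `f` has dropped from `k` to `m`.
  · refine A.set_stage (s' := 4) (t' := Thread.set ⟨.test0, ρ, d⟩ .t 0 .test1)
      (M' := M.write .flag (D.ptr m) 1)
      (by simp [program, Instr.exec, hc', h]) hk1 hk2 rfl hown (by omega) (by omega)
      (fun _ => Mem.write_of_ne _ _ (by simp)) ?_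
      (ThInv.set (q := q + 1) A.n A.le A.p5 (by simp [hp, hvn]) (by omega) _ _ _ ?_ (by simp)
        (by omega) ⟨rfl, hp, hvn, by simpa using hv, by simp⟩)
    · refine A.inv.glob.data.finish hk1 hk2 hst hl hr hm (fun _ hf => Mem.write_of_ne _ _ hf)
        (Mem.write_same _ _ _) fun e he1 he2 he => ?_
      exact Mem.write_of_index_ne _ fun h' => he (D.ptr_inj e m he1 he2 hm.1 hm.2.1 h')
    · simp only [rank]
      omega
  · obtain ⟨hm0, G⟩ := A.inv.glob.data.finish_activate hk1 hk2 hst hl hr hm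
      (fun u h1 h2 => by rw [A.one_eq_five u (by omega) h2]; omega) h
    have hmk : m ≠ k := by rintro rfl; omega
    unfold StepGood
    have he : (program .test0).exec M ⟨.test0, ρ, d⟩ =
        (M, {Thread.set ⟨.test0, ρ, d⟩ .t 1 .test1}, false) := by
      simp [program, Instr.exec, hc', h]
    dsimp only
    rw [he]
    -- The test-and-set failed, so this thread takes over `m`; the changes of stage of `k` and `m`
    -- release 80 units of potential.
    refine A.inv.step_node (st' := Function.update (Function.update st k 4) m 1)
      (own' := Function.update own m v) A.v1 A.v2 A.th (ph .two v)
      (some (Thread.set ⟨.test0, ρ, d⟩ .t 1 .test1)) ?_ ?_ ?_ ?_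
    · intro j u hju
      ext k'
      unfold owned
      rcases eq_or_ne k' m with rfl | hne
      · simp only [Function.update_self, hm0]
        cases j <;> simp at hju ⊢
        omega
      · rw [Function.update_of_ne hne, Function.update_of_ne hne]
        rcases eq_or_ne k' k with rfl | hne'
        · rw [hown]
          cases j <;> simp at hju ⊢
          split_ifs <;> omega
        · rw [Function.update_of_ne hne']
    · have h1 := elemPot_update (n := D.n) st hk1 hk2 4
      have h2 := elemPot_update (n := D.n) (Function.update st k 4) hm.1 hm.2.1 1
      rw [Function.update_of_ne hmk, hm0] at h2
      simp only [nodePot, Thread.set, rank]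
      omega
    · rw [upd_eq_self]
      exact ⟨A.inv.glob.tree, A.inv.glob.root, G⟩
    · rintro _ ⟨rfl⟩
      refine ThInv.set (q := q + 1) A.n A.le A.p5 (by simp [hp, hvn]) (by omega) _ _ _ ?_ (by simp)
        (by omega) ⟨rfl, hp, hvn, by simpa using hv, fun _ => ⟨m, hm.1, hm.2.1, ?_, ?_, by omega⟩⟩
      · simp only [rank]
        omega
      · simpa using hc'
      · simp [owned]

theorem test1 (A : At D i v q M ⟨.test1, ρ, d⟩ T w s ph th st own) :
    StepGood D M ⟨.test1, ρ, d⟩ T w s := by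
  obtain ⟨rfl, hp, hvn, hv, ht⟩ := A.lab
  by_cases h : ρ .t = 0
  · exact A.leave (by simp [program, Instr.exec, h]) hp hvn hv
  · exact A.goto (l := .test2) (by simp [program, Instr.exec, h]) (by simp [rank])
      ⟨rfl, hp, hvn, hv, ht h⟩

theorem test2 (A : At D i v q M ⟨.test2, ρ, d⟩ T w s ph th st own) :
    StepGood D M ⟨.test2, ρ, d⟩ T w s := by
  obtain ⟨rfl, hp, hvn, hv, m, hm1, hm2, hm, hS, hq⟩ := A.lab
  have := D.ptr_le m (by omega)
  dsimp only at hm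
  exact A.set rfl (by simp [rank]) (by simp) (by dsimp only; omega)
    ⟨rfl, m, hp, hvn, by simpa using hv, hm1, hm2, by simpa using hm, hS, hq⟩

theorem stepGood (A : At D i v q M t T w s ph th st own) : StepGood D M t T w s := by
  obtain ⟨l, ρ, d⟩ := t
  cases l with
  | start => exact A.start
  | spawn0 => exact A.spawn0
  | spawn1 => exact A.spawn1
  | spawn2 => exact A.spawn2
  | spawn3 => exact A.spawn3
  | spawn4 => exact A.spawn4
  | spawn5 => exact A.spawn5
  | elem0 => exact A.elem0
  | elem1 => exact A.elem1
  | elem2 => exact A.elem2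
  | join0 => exact A.join0
  | join1 => exact A.join1
  | join2 => exact A.join2
  | join3 => exact A.join3
  | join4 => exact A.join4
  | pri0 => exact A.pri0
  | pri1 => exact A.pri1
  | pri2 => exact A.pri2
  | pri3 => exact A.pri3
  | pri4 => exact A.pri4
  | pri5 => exact A.pri5
  | init0 => exact A.init0
  | init1 => exact A.init1
  | init2 => exact A.init2
  | init3 => exact A.init3
  | init4 => exact A.init4
  | init5 => exact A.init5
  | init6 => exact A.init6
  | init7 => exact A.init7
  | init8 => exact A.init8
  | leaf0 => exact A.leaf0
  | leaf1 => exact A.leaf1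
  | while0 => exact A.while0
  | while1 => exact A.while1
  | while2 => exact A.while2
  | while3 => exact A.while3
  | splice0 => exact A.splice0
  | splice1 => exact A.splice1
  | splice2 => exact A.splice2
  | splice3 => exact A.splice3
  | pick0 => exact A.pick0
  | pick1 => exact A.pick1
  | pick2 => exact A.pick2
  | test0 => exact A.test0
  | test1 => exact A.test1
  | test2 => exact A.test2
  | dead => exact A.vanish rfl
  | halt => exact A.vanish rfl

end At

/-! ### The invariant along an arbitrary interleaving. -/

theorem Good.step {c c' : Config Label Reg Arr} (h : Good D c) (hs : Step program c c') :
    Good D c' := by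
  cases hs with
  | run M t T w s => exact stepGood_of_at h fun _ _ _ _ _ _ _ A => A.stepGood

theorem Good.reaches {c c' : Config Label Reg Arr} (h : Good D c) (hs : Reaches program c c') :
    Good D c' := by
  induction hs with
  | refl => exact h
  | tail _ hs ih => exact ih.step hs

theorem Good.bounds {c : Config Label Reg Arr} (h : Good D c) :
    c.work ≤ 1000 * D.n ∧ c.span ≤ D.maxDepth ∧ ∀ t ∈ c.threads, ∀ r, t.regs r ≤ 2 * D.n := by
  obtain ⟨ph, th, st, own, I⟩ := h
  have := I.work
  refine ⟨by omega, I.span, fun t ht => ?_⟩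
  obtain ⟨T, hT⟩ := Multiset.exists_cons_of_mem ht
  obtain ⟨M, threads, w, s, b⟩ := c
  dsimp only at hT
  subst hT
  obtain ⟨i, v, h1, h2, h3⟩ := I.exists_node
  exact (I.loc i v t h1 h2 h3).2.1

end ListContraction

namespace ListContraction
open BinaryForking

/-! ### The initial configuration -/

section
variable {n : ℕ} (σ π : Equiv.Perm (Fin n))

/-- The priority of the element at position `k`, for positions `1, …, n`. -/
def priority (k : ℕ) : ℕ :=
  if h : 1 ≤ k ∧ k ≤ n then π (σ ⟨k - 1, by omega⟩) else n

/-- The pointer to the element at position `k`. -/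
def pointer (k : ℕ) : ℕ :=
  if h : 1 ≤ k ∧ k ≤ n then (σ ⟨k - 1, by omega⟩ : ℕ) + 1 else 0

theorem priority_succ (a : Fin n) : priority σ π (a + 1) = π (σ a) := by
  have := a.2
  rw [priority, dif_pos (by omega)]
  rfl

theorem pointer_succ (a : Fin n) : pointer σ (a + 1) = σ a + 1 := by
  have := a.2
  rw [pointer, dif_pos (by omega)]
  rfl

theorem exists_fin_succ {k : ℕ} (h1 : 1 ≤ k) (h2 : k ≤ n) : ∃ a : Fin n, k = a + 1 :=
  ⟨⟨k - 1, by omega⟩, by simp; omega⟩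

theorem exists_depth_priority : ∃ f : ℕ → ℕ, (∀ k, 1 ≤ k → k ≤ n → f k < dependenceHeight σ π) ∧
    ∀ p k, 1 ≤ p → p ≤ n → 1 ≤ k → k ≤ n → p ≠ k →
      (∀ i, min p k ≤ i → i ≤ max p k → priority σ π i ≤ priority σ π p) → f p < f k := by
  obtain ⟨f, hf1, hf2⟩ := exists_depth (List.ofFn fun k : Fin n => (π (σ k) : ℕ))
    (List.nodup_ofFn.2 fun a b h => σ.injective (π.injective (Fin.ext h)))
  simp only [List.length_ofFn, List.getElem_ofFn] at hf1 hf2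
  refine ⟨fun k => f (k - 1), fun k h1 h2 => hf1 _ (by omega), ?_⟩
  intro p k hp1 hp2 hk1 hk2 hpk h
  refine hf2 (p - 1) (k - 1) (by omega) (by omega) (by omega) fun i hi h1 h2 => ?_
  have := h (i + 1) (by omega) (by omega)
  rwa [priority_succ σ π ⟨i, hi⟩, priority, dif_pos ⟨hp1, hp2⟩] at this

/-- The layout of an input list. -/
theorem exists_layout (hn : 1 ≤ n) : ∃ D : Layout, D.n = n ∧ D.h = dependenceHeight σ π ∧
    D.P = priority σ π ∧ D.ptr = pointer σ := by
  obtain ⟨f, hf1, hf2⟩ := exists_depth_priority σ π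
  have hP0 : priority σ π 0 = n := dif_neg (by omega)
  have hP1 : priority σ π (n + 1) = n := dif_neg (by omega)
  have hPlt : ∀ k, 1 ≤ k → k ≤ n → priority σ π k < n := fun k h1 h2 => by
    rw [priority, dif_pos ⟨h1, h2⟩]
    exact Fin.is_lt _
  refine ⟨⟨n, dependenceHeight σ π, priority σ π, pointer σ, f, hn, dif_neg (by omega),
    dif_neg (by omega), ?_, ?_, ?_, ?_, hP0, hP1, hPlt, ?_, hf1, ?_⟩, rfl, rfl, rfl, rfl⟩
  · intro k h1 h2
    rw [pointer, dif_pos ⟨h1, h2⟩]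
    omega
  · intro k _
    unfold pointer
    split_ifs
    · exact Fin.is_lt _
    · omega
  · intro j k h1 h2 h3 h4 h
    obtain ⟨a, rfl⟩ := exists_fin_succ h1 h2
    obtain ⟨b, rfl⟩ := exists_fin_succ h3 h4
    rw [pointer_succ, pointer_succ] at h
    rw [σ.injective (Fin.ext (Nat.succ_injective h))]
  · intro e h1 h2
    obtain ⟨a, rfl⟩ := exists_fin_succ h1 h2
    refine ⟨(σ.symm a : ℕ) + 1, by omega, (σ.symm a).2, ?_⟩
    rw [pointer_succ, Equiv.apply_symm_apply]
  · intro j k h1 h2 h3 h4 h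
    obtain ⟨a, rfl⟩ := exists_fin_succ h1 h2
    obtain ⟨b, rfl⟩ := exists_fin_succ h3 h4
    rw [priority_succ, priority_succ] at h
    rw [σ.injective (π.injective (Fin.ext h))]
  · rintro p k h1 h2 (⟨h3, h4⟩ | ⟨h3, h4⟩)
    · have hk : 1 ≤ k := by
        by_contra hk
        have := h4 0 (by omega) (by omega)
        have := hPlt p h1 h2
        omega
      refine hf2 p k h1 h2 hk (by omega) (by omega) fun i h5 h6 => ?_
      rcases eq_or_ne i p with rfl | hne
      · exact le_rfl
      · exact (h4 i (by omega) (by omega)).le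
    · have hk : k ≤ n := by
        by_contra hk
        have := h4 (n + 1) (by omega) (by omega)
        have := hPlt p h1 h2
        omega
      refine hf2 p k h1 h2 (by omega) hk (by omega) fun i h5 h6 => ?_
      rcases eq_or_ne i p with rfl | hne
      · exact le_rfl
      · exact (h4 i (by omega) (by omega)).le

variable {σ π} {D : Layout} {M : Mem Arr}

theorem IsInput.dataInv (hM : IsInput σ π M) (h1 : D.n = n) (h2 : D.P = priority σ π)
    (h3 : D.ptr = pointer σ) {ph : Phases} (hph : ∀ i v, ph i v ≤ 1) :
    DataInv D ph (fun _ => 0) M := by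
  constructor
  · intro k hk1 hk2
    obtain ⟨a, rfl⟩ := exists_fin_succ hk1 (h1 ▸ hk2)
    rw [h2, h3, pointer_succ, priority_succ, hM.prio]
  · exact fun _ _ => rfl
  · exact fun k hk => (hk rfl).elim
  · exact fun _ _ _ _ _ _ _ => rfl
  · intro k _ _ v _ hv
    have := hph .one v
    omega
  · intro k _ _ v _ hv
    have := hph .one v
    omega
  · intro k hk
    omega
  · intro k hk1 hk2 _
    refine ⟨k + 1, by omega, by omega, by omega, fun i _ _ => by omega, ?_⟩
    obtain ⟨a, rfl⟩ := exists_fin_succ hk1 (h1 ▸ hk2)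
    rw [h3, pointer_succ, hM.next]
    split_ifs with h
    · exact (pointer_succ σ ⟨a + 1, h⟩).symm
    · rw [pointer, dif_neg (by omega)]
  · intro k hk1 hk2 _
    refine ⟨k - 1, by omega, by omega, fun i _ _ => by omega, ?_⟩
    obtain ⟨a, rfl⟩ := exists_fin_succ hk1 (h1 ▸ hk2)
    rw [h3, pointer_succ, hM.prev, Nat.add_sub_cancel]
    split_ifs with h
    · rw [← pointer_succ]
      congr 1
      simp
      omega
    · rw [pointer, dif_neg (by omega)]

theorem IsInput.good (hM : IsInput σ π M) (h1 : D.n = n) (h2 : D.P = priority σ π)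
    (h3 : D.ptr = pointer σ) :
    Good D (Config.initial .start (fun r => if r = Reg.n then n else 0) M) := by
  have hn := D.pos
  set t : Thread Label Reg := ⟨.start, fun r => if r = Reg.n then n else 0, 0⟩ with ht
  have hz : ∀ {A : Type} [AddCommMonoid A] (g : ℕ → Option (Thread Label Reg) → A),
      total D.n g (fun _ _ => 0) (fun _ _ => none) = (2 * (2 * D.n - 1)) • g 0 none := by
    intro A _ g
    unfold total
    rw [Finset.sum_const, Finset.card_product, Nat.card_Ico]
    rfl
  have h0 : ∀ sync, TreeInv D.n (fun _ => 0) sync := fun sync v _ _ => by simp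
  refine ⟨upd (fun _ _ => 0) .one 1 1, upd (fun _ _ => none) .one 1 (some t), fun _ => 0,
    fun _ => 0, ?_, ?_, ?_, ⟨?_, ?_, ?_⟩, ?_⟩
  · have := total_upd (n := D.n) (fun _ => thr) (fun _ _ => 0) (fun _ _ => none) .one le_rfl
      (by omega) 1 (some t)
    rw [hz] at this
    simpa [thr, Config.initial] using this.symm
  -- The idle nodes contribute `200 * 2 * (2 n - 1)` and the elements `160 n`, below `1000 n` even
  -- with the first thread.
  · have := total_upd (n := D.n) nodePot (fun _ _ => 0) (fun _ _ => none) .one le_rfl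
      (by omega) 1 (some t)
    rw [hz] at this
    simp [nodePot, rank, ht, elemPot, Config.initial] at this ⊢
    omega
  · simp [Config.initial]
  · intro i
    cases i
    · exact (h0 _).begin_root (fun w hw => upd_of_ne _ _ (by simp [hw])) rfl (upd_same _ _ _ _)
    · rw [upd_of_loop_ne _ _ (by simp)]
      exact h0 _
  · simp [upd]
  · refine hM.dataInv h1 h2 h3 fun i v => ?_
    unfold upd
    split_ifs
    · exact le_rfl
    · exact zero_le_one
  · intro i v t' hv1 hv2 h
    by_cases hiv : i = .one ∧ v = 1
    · obtain ⟨rfl, rfl⟩ := hiv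
      simp only [upd_same, Option.some.injEq] at h
      subst h
      refine ⟨by simp [ht, h1], fun r => ?_, by simp, 0, fun _ => rfl, by omega, ?_, ?_⟩
      · simp only [ht]
        split_ifs <;> omega
      · simp [ht, rank, Layout.budget]
      · simp [ht, LabInv]
    · rw [upd_of_ne _ _ hiv] at h
      cases h
end

/-! ### Explicit bounds for executions. -/

theorem one_le_dependenceHeight {n : ℕ} (hn : 1 ≤ n) (σ π : Equiv.Perm (Fin n)) :
    1 ≤ dependenceHeight σ π := by
  obtain ⟨f, hf, -⟩ := exists_depth_priority σ π
  have := hf 1 le_rfl hn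
  omega

/-- Bounds for all executions on a list. -/
theorem IsExecution.bounds {n : ℕ} (hn : 1 ≤ n) {σ π : Equiv.Perm (Fin n)} {M : Mem Arr}
    (hM : IsInput σ π M) {c : Config Label Reg Arr} (hc : IsExecution n M c) :
    c.work ≤ 1000 * n ∧ c.span ≤ 40 * (8 * Nat.log 2 (2 * n) + dependenceHeight σ π + 14) ∧
      ∀ t ∈ c.threads, ∀ r, t.regs r ≤ 2 * n := by
  obtain ⟨D, h1, h2, h3, h4⟩ := exists_layout σ π hn
  have := ((hM.good h1 h3 h4).reaches hc).bounds
  rwa [Layout.maxDepth, h1, h2] at this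

/-- Since `log 2 > 1 / 2`, the binary logarithm is at most twice the natural one, and the additive
constants are absorbed by the height, which is at least 1. This also covers `n = 1`, where the
logarithm vanishes. -/
theorem IsExecution.span_le {n : ℕ} (hn : 1 ≤ n) {σ π : Equiv.Perm (Fin n)} {M : Mem Arr}
    (hM : IsInput σ π M) {c : Config Label Reg Arr} (hc : IsExecution n M c) :
    (c.span : ℝ) ≤ 1000 * (Real.log n + dependenceHeight σ π) := by
  have h := (hc.bounds hn hM).2.1
  have h1 := one_le_dependenceHeight hn σ π
  have h2 : Nat.log 2 (2 * n) = Nat.log 2 n + 1 := by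
    rw [mul_comm, Nat.log_mul_base (by norm_num) (by omega)]
  rw [h2] at h
  have h3 : (Nat.log 2 n : ℝ) * Real.log 2 ≤ Real.log n := by
    rw [← Real.log_pow]
    exact Real.log_le_log (by positivity) (by exact_mod_cast Nat.pow_log_le_self 2 (by omega))
  have h4 := Real.log_two_gt_d9
  have h5 : (Nat.log 2 n : ℝ) ≤ 2 * Real.log n := by nlinarith [(Nat.log 2 n).cast_nonneg (α := ℝ)]
  have h6 : (c.span : ℝ) ≤ 40 * (8 * (Nat.log 2 n + 1) + dependenceHeight σ π + 14) := by
    exact_mod_cast h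
  have h7 : (1 : ℝ) ≤ dependenceHeight σ π := by exact_mod_cast h1
  have h8 : 0 ≤ Real.log n := Real.log_natCast_nonneg n
  linarith

/-! ### Random priorities -/

/-- The three extra factors are at most `3 n`, `2 n` and `2 n`, and `12 n ^ 3 ≤ 6 n ^ 4` for `n ≥
2`. -/
theorem factorial_add_three_le {n : ℕ} (hn : 2 ≤ n) :
    (n + 3).factorial ≤ 6 * (n.factorial * n ^ 4) := by
  have h : (n + 3).factorial = (n + 3) * ((n + 2) * ((n + 1) * n.factorial)) := by
    simp [Nat.factorial_succ]
  have h1 : 2 * ((n + 3) * ((n + 2) * (n + 1))) ≤ 2 * (6 * n ^ 4) := by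
    calc 2 * ((n + 3) * ((n + 2) * (n + 1))) ≤ 2 * ((3 * n) * ((2 * n) * (2 * n))) := by
          gcongr <;> omega
      _ = 12 * n ^ 3 * 2 := by ring
      _ ≤ 12 * n ^ 3 * n := by gcongr
      _ = 2 * (6 * n ^ 4) := by ring
  rw [h]
  nlinarith [Nat.factorial_pos n]

/-- The dependence tree of a list with random priorities is low with high probability. -/
theorem card_height_mul_rpow_le {n : ℕ} (hn : 2 ≤ n) (k : ℝ) (σ : Equiv.Perm (Fin n)) {m : ℕ}
    (hm : 2 * (k + 4) * Real.log n ≤ m) :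
    ((Finset.univ.filter fun π : Equiv.Perm (Fin n) => m ≤ dependenceHeight σ π).card : ℝ) *
      (n : ℝ) ^ k ≤ n.factorial := by
  have h1 := (card_height_mul_le σ m).trans (factorial_add_three_le hn)
  generalize (Finset.univ.filter fun π : Equiv.Perm (Fin n) => m ≤ dependenceHeight σ π).card = b
    at h1 ⊢
  have hn0 : (0 : ℝ) < n := by exact_mod_cast (by omega : 0 < n)
  have h2 : (b : ℝ) * 2 ^ m ≤ n.factorial * (n : ℝ) ^ 4 := by
    exact_mod_cast Nat.le_of_mul_le_mul_left h1 (by norm_num)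
  -- The factor 2 in `hm` compensates for `log 2 > 1 / 2`, and the 4 added to `k` for the polynomial
  -- loss in the mean weight.
  have h3 : (n : ℝ) ^ k * (n : ℝ) ^ 4 ≤ 2 ^ m := by
    rw [← Real.rpow_natCast, ← Real.rpow_natCast, ← Real.rpow_add hn0, Real.rpow_def_of_pos hn0,
      Real.rpow_def_of_pos two_pos]
    have h4 := Real.log_two_gt_d9
    have h5 : (0 : ℝ) ≤ m := m.cast_nonneg
    refine Real.exp_le_exp.2 ?_
    push_cast
    nlinarith
  refine le_of_mul_le_mul_right (a := (n : ℝ) ^ 4) ?_ (by positivity)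
  rw [mul_assoc]
  exact (mul_le_mul_of_nonneg_left h3 b.cast_nonneg).trans h2

theorem le_toOuterMeasure_height_lt {n : ℕ} (hn : 2 ≤ n) (k : ℝ)
    (σ : Equiv.Perm (Fin n)) {m : ℕ} (hm : 2 * (k + 4) * Real.log n ≤ m) :
    ENNReal.ofReal (1 - 1 / (n : ℝ) ^ k) ≤
      (PMF.uniformOfFintype (Equiv.Perm (Fin n))).toOuterMeasure
        {π | dependenceHeight σ π < m} := by
  classical
  have h := card_height_mul_rpow_le hn k σ hm
  have hc := Finset.card_filter_add_card_filter_not (s := (Finset.univ : Finset (Equiv.Perm (Fin n))))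
    (fun π => m ≤ dependenceHeight σ π)
  simp only [not_le, Finset.card_univ] at hc
  rw [PMF.toOuterMeasure_uniformOfFintype_apply]
  simp only [Set.coe_ofPred, Fintype.card_subtype]
  have hr : (((Finset.univ.filter fun π : Equiv.Perm (Fin n) => m ≤ dependenceHeight σ π).card : ℝ) +
      (Finset.univ.filter fun π : Equiv.Perm (Fin n) => dependenceHeight σ π < m).card) =
      n.factorial := by
    rw [Fintype.card_perm, Fintype.card_fin] at hc
    exact_mod_cast hc
  have hf : (0 : ℝ) < n.factorial := by exact_mod_cast n.factorial_pos
  have hk0 : (0 : ℝ) < (n : ℝ) ^ k := Real.rpow_pos_of_pos (by exact_mod_cast (by omega : 0 < n)) k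
  rw [Fintype.card_perm, Fintype.card_fin, ← ENNReal.ofReal_natCast, ← ENNReal.ofReal_natCast,
    ← ENNReal.ofReal_div_of_pos hf]
  refine ENNReal.ofReal_le_ofReal ?_
  rw [← le_div_iff₀ hk0] at h
  rw [le_div_iff₀ hf, sub_mul, one_mul, one_div_mul_eq_div]
  linarith

end ListContraction

open BinaryForking ListContraction in
theorem mainTheorem1 :
    ∃ C : ℝ, 0 < C ∧
      -- worst-case work, with registers that hold numbers up to `2 n`
      (∀ n : ℕ, 1 ≤ n → ∀ (σ π : Equiv.Perm (Fin n)) (M : Mem Arr), IsInput σ π M →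
        ∀ c, IsExecution n M c →
          (c.work : ℝ) ≤ C * n ∧ ∀ t ∈ c.threads, ∀ r, t.regs r ≤ 2 * n) ∧
      -- span in terms of the height of the dependence tree
      (∀ n : ℕ, 1 ≤ n → ∀ (σ π : Equiv.Perm (Fin n)) (M : Mem Arr), IsInput σ π M →
        ∀ c, IsExecution n M c →
          (c.span : ℝ) ≤ C * (Real.log n + dependenceHeight σ π)) ∧
      -- span with high probability over the random priorities
      (∀ n : ℕ, 2 ≤ n → ∀ k : ℝ, 1 ≤ k → ∀ σ : Equiv.Perm (Fin n),
        ENNReal.ofReal (1 - 1 / (n : ℝ) ^ k) ≤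
          (PMF.uniformOfFintype (Equiv.Perm (Fin n))).toOuterMeasure
            {π | ∀ M : Mem Arr, IsInput σ π M → ∀ c, IsExecution n M c →
              (c.span : ℝ) ≤ C * k * Real.log n}) := by
  -- With high probability the height is at most `2 (k + 4) log n`, hence at most `10 k log n` as `k
  -- ≥ 1`; together with `log n ≤ k log n` and the factor 1000 of `IsExecution.span_le` this gives
  -- 11000.
  refine ⟨11000, by norm_num, ?_, ?_, ?_⟩
  · intro n hn σ π M hM c hc
    obtain ⟨h1, -, h2⟩ := hc.bounds hn hM
    refine ⟨?_, h2⟩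
    have : (c.work : ℝ) ≤ 1000 * n := by exact_mod_cast h1
    have := n.cast_nonneg (α := ℝ)
    linarith
  · intro n hn σ π M hM c hc
    have := hc.span_le hn hM
    have := Real.log_natCast_nonneg n
    have := (dependenceHeight σ π).cast_nonneg (α := ℝ)
    linarith
  · intro n hn k hk σ
    refine (le_toOuterMeasure_height_lt hn k σ (Nat.le_ceil _)).trans
      (MeasureTheory.measure_mono fun π hπ M hM c hc => ?_)
    have h1 := (Nat.lt_ceil.1 hπ).le
    have h2 := IsExecution.span_le (by omega) hM hc
    have h3 := Real.log_natCast_nonneg n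
    nlinarith [mul_nonneg (sub_nonneg.2 hk) h3]
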